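/- There exists an absolute constant $c>0$ such that the following holds. Let $\mathcal H$ be a $3$-uniform hypergraph on $n$ vertices (a family of $3$-element subsets, called edges, of an $n$-element set). If $\mathcal H$ does not contain a triangulation of the torus, then $\mathcal H$ has at most $c\,n^{5/2}$ edges. Here $\mathcal H$ contains a triangulation of the torus if there is a subfamily $\mathcal T$ of its edges such that the (geometric realization of the) simplicial complex formed by all subsets of the edges in $\mathcal T$ is homeomorphic to the torus $S^1\times S^1$. -/

import Mathlib

/-- `H` is (the edge set of) a 3-uniform hypergraph on the vertex set `V`:
each edge has exactly three vertices. -/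
def IsThreeUniform {V : Type*} (H : Finset (Finset V)) : Prop :=
  ∀ e ∈ H, e.card = 3

/-- The geometric realization, in barycentric coordinates, of the simplicial complex formed by
the subsets of the edges in `T`: the points of the standard simplex on `V` whose support is
contained in some edge of `T`. It carries the subspace topology of the finite-dimensional
space `V → ℝ`. -/
def geometricRealization {V : Type*} [Fintype V] (T : Finset (Finset V)) : Set (V → ℝ) :=
  {x | x ∈ stdSimplex ℝ V ∧ ∃ e ∈ T, ∀ v, v ∉ e → x v = 0}

/-- The hypergraph `T` is a triangulation of the torus: its simplicial complex is
homeomorphic to `S¹ × S¹`. -/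
def IsTorusTriangulation {V : Type*} [Fintype V] (T : Finset (Finset V)) : Prop :=
  IsThreeUniform T ∧ Nonempty (geometricRealization T ≃ₜ Circle × Circle)

/-- The hypergraph `H` contains a triangulation of the torus as a (not necessarily induced)
subhypergraph. -/
def ContainsTorus {V : Type*} [Fintype V] (H : Finset (Finset V)) : Prop :=
  ∃ T : Finset (Finset V), T ⊆ H ∧ IsTorusTriangulation T

/-! Split the vertices into three parts, losing a factor 27, and read an edge as a pair (b, c)
between parts 1 and 2 together with an apex a in part 0. The heart of the matter is
`exists_density_containsTorus`: a nonempty set E of pairs with D chosen apices each forces a torus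
as soon as |E| D² ≥ K n³. Without a torus, the number of pairs with at least D apices is therefore
at most min(n², K n³ / D²), and summing over D, with the balance at D ≈ √n, gives n^(5/2)
(`sum_card_le_of_level_sets`).

The torus is a toroidal grid of quadrilaterals a x a' y, each filled by a disc. The basic disc is
the join of {a, a'} with a path from x to y in the common link of a and a'. `IsDisc` records the
only property of a disc that matters: in any complex avoiding its inner vertices it can be exchanged
for a fan with one inner vertex. A grid of fans is the triangulated product of two cycles, hence a
torus (`isTorusTriangulation_of_discs`). To keep the discs disjoint, the vertices are coloured
randomly with a bounded number R of colours, and each quadrilateral receives private colours. So x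
and y should be `Robust`: joined through every colour class not containing them.

Since |E| D² ≥ K n³, an average pair of apices has at least K n pairs of E in its common link. In
such a bipartite graph, for an average colouring all but a small proportion of the pairs are
themselves robust, and they fall into large classes of pairs sharing one end whose other ends are
mutually robust (`exists_core`). The argument ranks vertices by degree and labels components of a
colour class by their lowest vertex of higher rank.

Over two apices a, a' one can now walk randomly from (b, c) to (b', c) to (b', c'), so that b, b'
and c, c' are robust over a, a'. A bounded closed walk that never repeats a vertex or an apex gives
the torus (`containsTorus_of_walk`): each step supplies two quadrilaterals, and each visited pair
supplies two more, between the apices of consecutive steps, filled with the help of an auxiliary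
apex.

Such a walk comes from counting closed walks by traces (`exists_closed_walk`). For a symmetric
substochastic M, the walks of length 8h with a given conflict weigh at most η tr M^(2h), where η
bounds the probability of a conflicting step; some h = 4^j has tr M^(8h) much larger than that,
because the traces cannot drop quickly at every scale. This needs that no vertex is hit with
probability above 1/m. If deleting the steps to such popular vertices costs too much, then for some
pair a positive proportion of its apex pairs have four popular vertices pairwise robust; few
quadruples are possible, so one of them serves a dense graph of apex pairs, which contains a
4-cycle, and a 2 × 2 grid is a torus (`exists_four_apices`, `containsTorus_of_four_apices`). -/

/-! ### Realizations up to homeomorphism: renaming and edge subdivision. -/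

/-- Mutually inverse continuous maps between two subsets give a homeomorphism. -/
theorem nonempty_homeomorph_of_maps {X Y : Type*} [TopologicalSpace X] [TopologicalSpace Y]
    {A : Set X} {B : Set Y} (f : X → Y) (g : Y → X) (hf : ContinuousOn f A)
    (hg : ContinuousOn g B)
    (hAB : ∀ x ∈ A, f x ∈ B) (hBA : ∀ y ∈ B, g y ∈ A) (hgf : ∀ x ∈ A, g (f x) = x)
    (hfg : ∀ y ∈ B, f (g y) = y) : Nonempty (A ≃ₜ B) :=
  ⟨{ toFun := fun x => ⟨f x, hAB x x.2⟩
     invFun := fun y => ⟨g y, hBA y y.2⟩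
     left_inv := fun x => Subtype.ext (hgf x x.2)
     right_inv := fun y => Subtype.ext (hfg y y.2)
     continuous_toFun := hf.domRestrict.subtype_mk _
     continuous_invFun := hg.domRestrict.subtype_mk _ }⟩

/-- Two families have homeomorphic realizations. -/
def SameSpace {V W : Type*} [Fintype V] [Fintype W] (S : Finset (Finset V))
    (T : Finset (Finset W)) : Prop :=
  Nonempty (geometricRealization S ≃ₜ geometricRealization T)

theorem SameSpace.symm {V W : Type*} [Fintype V] [Fintype W] {S : Finset (Finset V)}
    {T : Finset (Finset W)} (h : SameSpace S T) : SameSpace T S :=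
  h.map Homeomorph.symm

theorem SameSpace.trans {U V W : Type*} [Fintype U] [Fintype V] [Fintype W]
    {R : Finset (Finset U)} {S : Finset (Finset V)}
    {T : Finset (Finset W)} (h : SameSpace R S) (h' : SameSpace S T) : SameSpace R T :=
  h.elim fun f => h'.elim fun g => ⟨f.trans g⟩

theorem SameSpace.refl {V : Type*} [Fintype V] (S : Finset (Finset V)) : SameSpace S S :=
  ⟨Homeomorph.refl _⟩

/-- Renaming the vertices injectively does not change the realization. -/
theorem sameSpace_image {W V : Type*} [Fintype W] [Fintype V] [DecidableEq V] (φ : W → V)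
    (hφ : Function.Injective φ) (T : Finset (Finset W)) :
    SameSpace T (T.image fun e => e.image φ) := by
  have hext : ∀ (x : W → ℝ) w, Function.extend φ x 0 (φ w) = x w := fun x w => hφ.extend_apply _ _ _
  have hout : ∀ (x : W → ℝ) v, (¬ ∃ w, φ w = v) → Function.extend φ x 0 v = 0 := fun x v hv =>
    Function.extend_apply' _ _ _ hv
  have hsum : ∀ y : V → ℝ, (∀ v, (¬ ∃ w, φ w = v) → y v = 0) → ∑ w, y (φ w) = ∑ v, y v := by
    intro y hy
    rw [← Finset.sum_image (s := Finset.univ) (g := φ) (f := y) (fun a _ b _ h => hφ h)]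
    refine Finset.sum_subset (Finset.subset_univ _) fun v _ hv => hy v ?_
    rintro ⟨w, rfl⟩
    exact hv (Finset.mem_image_of_mem _ (Finset.mem_univ _))
  refine nonempty_homeomorph_of_maps (fun x => Function.extend φ x 0) (fun y w => y (φ w)) ?_ ?_
    ?_ ?_ ?_ ?_
  · refine Continuous.continuousOn (continuous_pi fun v => ?_)
    by_cases hv : ∃ w, φ w = v
    · obtain ⟨w, rfl⟩ := hv
      simp only [hext]
      exact continuous_apply w
    · simp only [hout _ _ hv]
      exact continuous_const
  · exact Continuous.continuousOn (continuous_pi fun w => continuous_apply _)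
  · rintro x ⟨⟨h0, h1⟩, e, he, hx⟩
    refine ⟨⟨fun v => ?_, ?_⟩, e.image φ, Finset.mem_image_of_mem _ he, fun v hv => ?_⟩
    · by_cases hv : ∃ w, φ w = v
      · obtain ⟨w, rfl⟩ := hv
        rw [hext]; exact h0 w
      · rw [hout _ _ hv]
    · rw [← hsum _ (hout x)]
      simpa only [hext] using h1
    · by_cases hv' : ∃ w, φ w = v
      · obtain ⟨w, rfl⟩ := hv'
        rw [hext]
        exact hx w fun hw => hv (Finset.mem_image_of_mem _ hw)
      · exact hout _ _ hv'
  · rintro y ⟨⟨h0, h1⟩, e', he', hy⟩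
    obtain ⟨e, he, rfl⟩ := Finset.mem_image.1 he'
    refine ⟨⟨fun w => h0 _, ?_⟩, e, he, fun w hw => hy _ ?_⟩
    · rw [hsum y fun v hv => hy v fun hv' => ?_]
      · exact h1
      · obtain ⟨w, -, hw⟩ := Finset.mem_image.1 hv'
        exact hv ⟨w, hw⟩
    · intro h
      obtain ⟨w', hw', h⟩ := Finset.mem_image.1 h
      exact hw (hφ h ▸ hw')
  · intro x _
    funext w
    exact hext x w
  · rintro y ⟨_, e', he', hy⟩
    obtain ⟨e, he, rfl⟩ := Finset.mem_image.1 he'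
    funext v
    by_cases hv : ∃ w, φ w = v
    · obtain ⟨w, rfl⟩ := hv
      exact hext _ w
    · rw [hout _ _ hv]
      refine (hy v fun hv' => ?_).symm
      obtain ⟨w, -, hw⟩ := Finset.mem_image.1 hv'
      exact hv ⟨w, hw⟩

/-- Subdividing the edge `u w` of a complex at a new vertex `m` does not change the realization:
every face `insert u (insert w l)` with `l ∈ P` is replaced by its two halves. -/
theorem sameSpace_subdivide {V : Type*} [Fintype V] [DecidableEq V] {S P T T' : Finset (Finset V)}
    {u w m : V} (huw : u ≠ w) (hmu : m ≠ u) (hmw : m ≠ w)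
    (hT : ∀ e, e ∈ T ↔ e ∈ S ∨ ∃ l ∈ P, e = insert u (insert w l))
    (hT' : ∀ e, e ∈ T' ↔ e ∈ S ∨ ∃ l ∈ P, e = insert m (insert u l) ∨ e = insert m (insert w l))
    (hSm : ∀ e ∈ S, m ∉ e) (hSuw : ∀ e ∈ S, u ∈ e → w ∉ e)
    (hP : ∀ l ∈ P, m ∉ l ∧ u ∉ l ∧ w ∉ l) : SameSpace T T' := by
  -- The direction `D` has total mass zero. Subtracting 2 min(y u, y w) `D` moves the common part of
  -- the masses at u and w to the midpoint m; adding x m times `D` gives the mass at m back in equal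
  -- halves. These are inverse because m carries no mass before subdivision, and u, w are never both
  -- charged after it.
  set D : V → ℝ := fun v => (if v = u then 1 / 2 else 0) + (if v = w then 1 / 2 else 0)
    - (if v = m then 1 else 0) with hD
  have hDs : ∑ v, D v = 0 := by
    simp only [hD, Finset.sum_sub_distrib, Finset.sum_add_distrib, Finset.sum_ite_eq',
      Finset.mem_univ, if_true]
    norm_num
  have hDu : D u = 1 / 2 := by simp [hD, huw, hmu.symm]
  have hDw : D w = 1 / 2 := by simp [hD, huw.symm, hmw.symm]
  have hDm : D m = -1 := by simp [hD, hmu, hmw]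
  have hDo : ∀ v, v ≠ u → v ≠ w → v ≠ m → D v = 0 := by
    intro v h1 h2 h3; simp [hD, h1, h2, h3]
  clear_value D
  -- properties of points of the two realizations
  have hTm : ∀ y ∈ geometricRealization T, y m = 0 := by
    rintro y ⟨_, e, he, hy⟩
    rcases (hT e).1 he with h | ⟨l, hl, rfl⟩
    · exact hy _ (hSm e h)
    · exact hy _ (by simp [hmu, hmw, (hP l hl).1])
  have hTmin : ∀ x ∈ geometricRealization T', min (x u) (x w) = 0 := by
    rintro x ⟨⟨h0, _⟩, e, he, hx⟩
    have : x u = 0 ∨ x w = 0 := by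
      rcases (hT' e).1 he with h | ⟨l, hl, rfl | rfl⟩
      · by_cases hu : u ∈ e
        · exact Or.inr (hx _ (hSuw e h hu))
        · exact Or.inl (hx _ hu)
      · exact Or.inr (hx _ (by simp [huw.symm, hmw.symm, (hP l hl).2.2]))
      · exact Or.inl (hx _ (by simp [huw, hmu.symm, (hP l hl).2.1]))
    rcases this with h | h
    · rw [h]; exact min_eq_left (h0 w)
    · rw [h]; exact min_eq_right (h0 u)
  refine nonempty_homeomorph_of_maps (fun y v => y v - 2 * min (y u) (y w) * D v)
    (fun x v => x v + x m * D v) ?_ ?_ ?_ ?_ ?_ ?_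
  · fun_prop
  · fun_prop
  · intro y hy'
    have hm0 := hTm y hy'
    obtain ⟨⟨h0, h1⟩, e, he, hy⟩ := hy'
    have hmin0 : 0 ≤ min (y u) (y w) := le_min (h0 u) (h0 w)
    refine ⟨⟨fun v => ?_, ?_⟩, ?_⟩
    · change 0 ≤ y v - 2 * min (y u) (y w) * D v
      by_cases hu : v = u
      · subst hu; rw [hDu]; linarith [min_le_left (y v) (y w)]
      by_cases hw : v = w
      · subst hw; rw [hDw]; linarith [min_le_right (y u) (y v)]
      by_cases hm : v = m
      · subst hm; rw [hDm]; linarith [h0 v]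
      rw [hDo v hu hw hm]; linarith [h0 v]
    · rw [Finset.sum_sub_distrib, ← Finset.mul_sum, hDs, h1]; ring
    · rcases (hT e).1 he with h | ⟨l, hl, rfl⟩
      · have : min (y u) (y w) = 0 := by
          by_cases hu : u ∈ e
          · rw [hy _ (hSuw e h hu)]; exact min_eq_right (h0 u)
          · rw [hy _ hu]; exact min_eq_left (h0 w)
        refine ⟨e, (hT' e).2 (Or.inl h), fun v hv => ?_⟩
        simp only [this, hy v hv]; ring
      · rcases le_total (y u) (y w) with h | h
        · refine ⟨_, (hT' _).2 (Or.inr ⟨l, hl, Or.inr rfl⟩), fun v hv => ?_⟩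
          simp only [Finset.mem_insert, not_or] at hv
          by_cases hu : v = u
          · subst hu; simp only [min_eq_left h, hDu]; ring
          · simp only [hDo v hu hv.2.1 hv.1]
            rw [hy v (by simp [hu, hv])]; ring
        · refine ⟨_, (hT' _).2 (Or.inr ⟨l, hl, Or.inl rfl⟩), fun v hv => ?_⟩
          simp only [Finset.mem_insert, not_or] at hv
          by_cases hw : v = w
          · subst hw; simp only [min_eq_right h, hDw]; ring
          · simp only [hDo v hv.2.1 hw hv.1]
            rw [hy v (by simp [hw, hv])]; ring
  · intro x hx'
    obtain ⟨⟨h0, h1⟩, e, he, hx⟩ := hx'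
    refine ⟨⟨fun v => ?_, ?_⟩, ?_⟩
    · change 0 ≤ x v + x m * D v
      by_cases hu : v = u
      · subst hu; rw [hDu]; linarith [h0 v, h0 m]
      by_cases hw : v = w
      · subst hw; rw [hDw]; linarith [h0 v, h0 m]
      by_cases hm : v = m
      · subst hm; rw [hDm]; linarith
      rw [hDo v hu hw hm]; linarith [h0 v]
    · rw [Finset.sum_add_distrib, ← Finset.mul_sum, hDs, h1]; ring
    · rcases (hT' e).1 he with h | ⟨l, hl, he⟩
      · refine ⟨e, (hT e).2 (Or.inl h), fun v hv => ?_⟩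
        simp only [hx _ (hSm e h), hx v hv]; ring
      · refine ⟨_, (hT _).2 (Or.inr ⟨l, hl, rfl⟩), fun v hv => ?_⟩
        simp only [Finset.mem_insert, not_or] at hv
        by_cases hm : v = m
        · subst hm; simp only [hDm]; ring
        · simp only [hDo v hv.1 hv.2.1 hm]
          rw [hx v]
          · ring
          · rcases he with rfl | rfl <;> simp [hm, hv]
  · intro y hy
    have hm0 := hTm y hy
    funext v
    simp only [hm0, hDm]; ring
  · intro x hx
    have hmin := hTmin x hx
    funext v
    simp only [hDu, hDw]
    rw [min_add_add_right, hmin]; ring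

/-! ### Triangulated products of bipartite graphs. -/

/-- The complex with facets the two-element sets `{s i, t i}`. -/
def edgeFamily {P I : Type*} [Fintype I] [DecidableEq P] (s t : I → P) : Finset (Finset P) :=
  Finset.univ.image fun i => {s i, t i}

/-- The triangulated product of two bipartite graphs: each cell is cut along the diagonal joining
the two source vertices to the two target vertices. -/
def productFamily {P Q I J : Type*} [Fintype I] [Fintype J] [DecidableEq P] [DecidableEq Q]
    (s t : I → P) (s' t' : J → Q) : Finset (Finset (P × Q)) :=
  (Finset.univ.image fun ij : I × J =>
    {(s ij.1, s' ij.2), (t ij.1, s' ij.2), (t ij.1, t' ij.2)}) ∪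
  (Finset.univ.image fun ij : I × J =>
    {(s ij.1, s' ij.2), (s ij.1, t' ij.2), (t ij.1, t' ij.2)})

theorem mem_edgeRealization {P I : Type*} [Fintype P] [Fintype I] [DecidableEq P] {s t : I → P}
    {X : P → ℝ} (hX : X ∈ geometricRealization (edgeFamily s t)) (hst : ∀ i, s i ≠ t i) :
    ∃ i, (∀ p, p ≠ s i → p ≠ t i → X p = 0) ∧ X (s i) + X (t i) = 1 := by
  obtain ⟨⟨_, h1⟩, e, he, hx⟩ := hX
  obtain ⟨i, -, rfl⟩ := Finset.mem_image.1 he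
  have h : ∀ p, p ≠ s i → p ≠ t i → X p = 0 := fun p h1 h2 => hx p (by simp [h1, h2])
  refine ⟨i, h, ?_⟩
  rw [← Fintype.sum_eq_add (s i) (t i) (hst i) fun p hp => h p hp.1 hp.2]
  exact h1

theorem le_one_of_mem_stdSimplex {P : Type*} [Fintype P] {X : P → ℝ} (hX : X ∈ stdSimplex ℝ P)
    (p : P) : X p ≤ 1 := by
  rw [← hX.2]
  exact Finset.single_le_sum (fun i _ => hX.1 i) (Finset.mem_univ p)

/-- The weight that the point with marginals `X`, `Y` gives to `(p, q)`. -/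
noncomputable def jointWeight {P Q : Type*} (σ : P → Bool) (τ : Q → Bool) (X : P → ℝ)
    (Y : Q → ℝ) (r : P × Q) : ℝ :=
  if σ r.1 = τ r.2 then min (X r.1) (Y r.2) else max (X r.1 + Y r.2 - 1) 0

theorem jointWeight_swap {P Q : Type*} (σ : P → Bool) (τ : Q → Bool) (X : P → ℝ)
    (Y : Q → ℝ) (p : P) (q : Q) :
    jointWeight σ τ X Y (p, q) = jointWeight τ σ Y X (q, p) := by
  simp only [jointWeight, eq_comm (a := σ p), min_comm (X p), add_comm (X p)]

theorem jointWeight_eq_zero {P Q : Type*} {σ : P → Bool} {τ : Q → Bool} {X : P → ℝ}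
    {Y : Q → ℝ} {p : P} {q : Q}   (hp : X p = 0) (h0 : 0 ≤ Y q) (h1 : Y q ≤ 1) : jointWeight σ τ X Y (p, q) = 0 := by
  unfold jointWeight
  split_ifs
  · simp [hp, h0]
  · simp [hp, h1]

/-- Only the two ends of the edge carrying Y contribute, with masses y and 1 - y. The two terms are
min(x, y) and max(x - y, 0) in one order or the other, according to the side of p, and they add up
to x. -/
theorem sum_jointWeight {P Q J : Type*} [Fintype P] [Fintype Q] [Fintype J] [DecidableEq Q]
    {s' t' : J → Q} {σ : P → Bool} {τ : Q → Bool} (hs : ∀ j, τ (s' j) = true)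
    (ht : ∀ j, τ (t' j) = false) {X : P → ℝ} {Y : Q → ℝ} (hX : X ∈ stdSimplex ℝ P)
    (hY : Y ∈ geometricRealization (edgeFamily s' t')) (p : P) :
    ∑ q, jointWeight σ τ X Y (p, q) = X p := by
  have hst : ∀ j, s' j ≠ t' j := fun j h => by simpa [hs, ht] using congrArg τ h
  obtain ⟨j, hj, hj1⟩ := mem_edgeRealization hY hst
  have hp0 := hX.1 p
  have hp1 := le_one_of_mem_stdSimplex hX p
  have hY0 := hY.1.1
  rw [Fintype.sum_eq_add (s' j) (t' j) (hst j) fun q hq => ?_]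
  · have : Y (t' j) = 1 - Y (s' j) := by linarith
    have h2 := hY0 (s' j)
    have h3 := hY0 (t' j)
    unfold jointWeight
    cases hσ : σ p
    · simp only [hs, ht, this]
      simp only [Bool.false_eq_true, if_false, if_true]
      rcases le_total (X p) (1 - Y (s' j)) with h | h
      · rw [min_eq_left h, max_eq_right (by linarith)]; ring
      · rw [min_eq_right h, max_eq_left (by linarith)]; ring
    · simp only [hs, ht, this]
      simp only [Bool.true_eq_false, if_false, if_true]
      rcases le_total (X p) (Y (s' j)) with h | h
      · rw [min_eq_left h, max_eq_right (by linarith)]; ring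
      · rw [min_eq_right h, max_eq_left (by linarith)]; ring
  · rw [jointWeight_swap, jointWeight_eq_zero (hj q hq.1 hq.2) hp0 hp1]

theorem sum_jointWeight' {P Q I : Type*} [Fintype P] [Fintype Q] [Fintype I] [DecidableEq P]
    {s t : I → P} {σ : P → Bool} {τ : Q → Bool} (hs : ∀ j, σ (s j) = true)
    (ht : ∀ j, σ (t j) = false) {X : P → ℝ} {Y : Q → ℝ} (hY : Y ∈ stdSimplex ℝ Q)
    (hX : X ∈ geometricRealization (edgeFamily s t)) (q : Q) :
    ∑ p, jointWeight σ τ X Y (p, q) = Y q := by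
  simp only [jointWeight_swap σ τ X Y]
  exact sum_jointWeight hs ht hY hX q

section product

variable {P Q I J : Type*} [Fintype P] [Fintype Q] [Fintype I] [Fintype J] [DecidableEq P]
  [DecidableEq Q]

/-- The realization of the triangulated product is the product of the realizations. -/
theorem productFamily_homeomorph (s t : I → P) (s' t' : J → Q) (σ : P → Bool) (τ : Q → Bool)
    (hs : ∀ i, σ (s i) = true) (ht : ∀ i, σ (t i) = false)
    (hs' : ∀ i, τ (s' i) = true) (ht' : ∀ i, τ (t' i) = false) :
    Nonempty (geometricRealization (productFamily s t s' t') ≃ₜ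
      geometricRealization (edgeFamily s t) × geometricRealization (edgeFamily s' t')) := by
  have hst : ∀ j, s j ≠ t j := fun j h => by simpa [hs, ht] using congrArg σ h
  have hst' : ∀ j, s' j ≠ t' j := fun j h => by simpa [hs', ht'] using congrArg τ h
  have hmem : ∀ i j, ({(s i, s' j), (t i, s' j), (t i, t' j)} : Finset (P × Q)) ∈
      productFamily s t s' t' := fun i j =>
    Finset.mem_union_left _ (Finset.mem_image.2 ⟨(i, j), Finset.mem_univ _, rfl⟩)
  have hmem' : ∀ i j, ({(s i, s' j), (s i, t' j), (t i, t' j)} : Finset (P × Q)) ∈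
      productFamily s t s' t' := fun i j =>
    Finset.mem_union_right _ (Finset.mem_image.2 ⟨(i, j), Finset.mem_univ _, rfl⟩)
  -- a point of the product complex lives in one cell, and misses one of its corners
  have hcell : ∀ z ∈ geometricRealization (productFamily s t s' t'), ∃ i j,
      (∀ p q, (p ≠ s i ∧ p ≠ t i ∨ q ≠ s' j ∧ q ≠ t' j) → z (p, q) = 0) ∧
      (z (s i, t' j) = 0 ∨ z (t i, s' j) = 0) := by
    rintro z ⟨_, e, he, hz⟩
    rcases Finset.mem_union.1 he with he | he
    · obtain ⟨⟨i, j⟩, -, rfl⟩ := Finset.mem_image.1 he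
      refine ⟨i, j, fun p q h => hz _ ?_, Or.inl (hz _ ?_)⟩
      · simp only [Finset.mem_insert, Finset.mem_singleton, Prod.mk.injEq]; tauto
      · simp [hst i, (hst' j).symm]
    · obtain ⟨⟨i, j⟩, -, rfl⟩ := Finset.mem_image.1 he
      refine ⟨i, j, fun p q h => hz _ ?_, Or.inr (hz _ ?_)⟩
      · simp only [Finset.mem_insert, Finset.mem_singleton, Prod.mk.injEq]; tauto
      · simp [hst' j, (hst i).symm]
  -- A point of the product complex is a probability measure on P × Q and is sent to its two
  -- marginals. The inverse is the monotone coupling, with sources before targets: it charges at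
  -- most one of the two mixed corners of a cell, so it lives on one of the two triangles. The sides
  -- `σ`, `τ` make its formula uniform over all cells, hence continuous.
  refine (nonempty_homeomorph_of_maps (A := geometricRealization (productFamily s t s' t'))
    (B := geometricRealization (edgeFamily s t) ×ˢ geometricRealization (edgeFamily s' t'))
    (fun z => (fun p => ∑ q, z (p, q), fun q => ∑ p, z (p, q)))
    (fun XY => jointWeight σ τ XY.1 XY.2) ?_ ?_ ?_ ?_ ?_ ?_).map
    fun h => h.trans (Homeomorph.Set.prod _ _)
  · fun_prop
  · refine Continuous.continuousOn (continuous_pi fun r => ?_)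
    unfold jointWeight
    split_ifs <;> fun_prop
  · intro z hz
    obtain ⟨i, j, hij, -⟩ := hcell z hz
    obtain ⟨⟨h0, h1⟩, -⟩ := hz
    refine ⟨⟨⟨fun p => Finset.sum_nonneg fun q _ => h0 _, ?_⟩, {s i, t i},
      Finset.mem_image_of_mem _ (Finset.mem_univ i), fun p hp => ?_⟩,
      ⟨⟨fun p => Finset.sum_nonneg fun q _ => h0 _, ?_⟩, {s' j, t' j},
      Finset.mem_image_of_mem _ (Finset.mem_univ j), fun q hq => ?_⟩⟩
    · rw [← h1, Fintype.sum_prod_type]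
    · simp only [Finset.mem_insert, Finset.mem_singleton, not_or] at hp
      exact Finset.sum_eq_zero fun q _ => hij p q (Or.inl hp)
    · rw [← h1, Fintype.sum_prod_type_right]
    · simp only [Finset.mem_insert, Finset.mem_singleton, not_or] at hq
      exact Finset.sum_eq_zero fun p _ => hij p q (Or.inr hq)
  · rintro ⟨X, Y⟩ ⟨hX, hY⟩
    obtain ⟨i, hi, hi1⟩ := mem_edgeRealization hX hst
    obtain ⟨j, hj, hj1⟩ := mem_edgeRealization hY hst'
    have hX1 := le_one_of_mem_stdSimplex hX.1
    have hY1 := le_one_of_mem_stdSimplex hY.1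
    have hz : ∀ p q, (p ≠ s i ∧ p ≠ t i ∨ q ≠ s' j ∧ q ≠ t' j) →
        jointWeight σ τ X Y (p, q) = 0 := by
      rintro p q (h | h)
      · exact jointWeight_eq_zero (hi p h.1 h.2) (hY.1.1 q) (hY1 q)
      · rw [jointWeight_swap]
        exact jointWeight_eq_zero (hj q h.1 h.2) (hX.1.1 p) (hX1 p)
    refine ⟨⟨fun r => ?_, ?_⟩, ?_⟩
    · simp only [jointWeight]
      split_ifs
      · exact le_min (hX.1.1 _) (hY.1.1 _)
      · exact le_max_right _ _
    · rw [Fintype.sum_prod_type]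
      simp only [sum_jointWeight hs' ht' hX.1 hY]
      exact hX.1.2
    · rcases le_total (X (s i)) (Y (s' j)) with h | h
      · refine ⟨_, hmem i j, ?_⟩
        rintro ⟨p, q⟩ hpq
        by_cases hp : p ≠ s i ∧ p ≠ t i ∨ q ≠ s' j ∧ q ≠ t' j
        · exact hz p q hp
        · simp only [Finset.mem_insert, Finset.mem_singleton, Prod.mk.injEq] at hpq
          obtain ⟨rfl, rfl⟩ : p = s i ∧ q = t' j := by tauto
          simp only [jointWeight, hs, ht']
          simp only [Bool.true_eq_false, if_false]
          exact max_eq_right (by linarith)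
      · refine ⟨_, hmem' i j, ?_⟩
        rintro ⟨p, q⟩ hpq
        by_cases hp : p ≠ s i ∧ p ≠ t i ∨ q ≠ s' j ∧ q ≠ t' j
        · exact hz p q hp
        · simp only [Finset.mem_insert, Finset.mem_singleton, Prod.mk.injEq] at hpq
          obtain ⟨rfl, rfl⟩ : p = t i ∧ q = s' j := by tauto
          simp only [jointWeight, ht, hs']
          simp only [Bool.false_eq_true, if_false]
          exact max_eq_right (by linarith)
  · intro z hz
    obtain ⟨i, j, hij, hc⟩ := hcell z hz
    obtain ⟨⟨h0, h1⟩, -⟩ := hz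
    have hX : ∀ p, ∑ q, z (p, q) = z (p, s' j) + z (p, t' j) := fun p =>
      Fintype.sum_eq_add _ _ (hst' j) fun q hq => hij p q (Or.inr hq)
    have hY : ∀ q, ∑ p, z (p, q) = z (s i, q) + z (t i, q) := fun q =>
      Fintype.sum_eq_add _ _ (hst i) fun p hp => hij p q (Or.inl hp)
    have h1' : z (s i, s' j) + z (s i, t' j) + (z (t i, s' j) + z (t i, t' j)) = 1 := by
      rw [← hX, ← hX, ← h1, Fintype.sum_prod_type]
      exact (Fintype.sum_eq_add _ _ (hst i) fun p hp =>
        Finset.sum_eq_zero fun q _ => hij p q (Or.inl hp)).symm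
    have h00 := h0 (s i, s' j)
    have h01 := h0 (s i, t' j)
    have h10 := h0 (t i, s' j)
    have h11 := h0 (t i, t' j)
    funext ⟨p, q⟩
    simp only [jointWeight, hX, hY]
    by_cases hp : p ≠ s i ∧ p ≠ t i ∨ q ≠ s' j ∧ q ≠ t' j
    · rw [hij p q hp]
      rcases hp with hp | hq
      · rw [hij p _ (Or.inl hp), hij p _ (Or.inl hp)]
        have h1q : z (s i, q) + z (t i, q) ≤ 1 := by
          by_cases hq1 : q = s' j
          · subst hq1; linarith
          · by_cases hq2 : q = t' j
            · subst hq2; linarith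
            · rw [hij _ q (Or.inr ⟨hq1, hq2⟩), hij _ q (Or.inr ⟨hq1, hq2⟩)]; norm_num
        split_ifs
        · rw [min_eq_left] <;> linarith [h0 (s i, q), h0 (t i, q)]
        · rw [max_eq_right]; linarith
      · rw [hij _ q (Or.inr hq), hij _ q (Or.inr hq)]
        have h1p : z (p, s' j) + z (p, t' j) ≤ 1 := by
          by_cases hp1 : p = s i
          · subst hp1; linarith
          · by_cases hp2 : p = t i
            · subst hp2; linarith
            · rw [hij p _ (Or.inl ⟨hp1, hp2⟩), hij p _ (Or.inl ⟨hp1, hp2⟩)]; norm_num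
        split_ifs
        · rw [min_eq_right] <;> linarith [h0 (p, s' j), h0 (p, t' j)]
        · rw [max_eq_right]; linarith
    · obtain ⟨hp, hq⟩ : (p = s i ∨ p = t i) ∧ (q = s' j ∨ q = t' j) := by tauto
      rcases hp with rfl | rfl <;> rcases hq with rfl | rfl
      · rw [if_pos (by rw [hs, hs'])]
        rcases hc with hc | hc <;> rw [hc]
        · rw [min_eq_left] <;> linarith
        · rw [min_eq_right] <;> linarith
      · rw [if_neg (by rw [hs, ht']; decide)]
        rcases hc with hc | hc
        · rw [max_eq_right] <;> linarith
        · rw [max_eq_left] <;> linarith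
      · rw [if_neg (by rw [ht, hs']; decide)]
        rcases hc with hc | hc
        · rw [max_eq_left] <;> linarith
        · rw [max_eq_right] <;> linarith
      · rw [if_pos (by rw [ht, ht'])]
        rcases hc with hc | hc <;> rw [hc]
        · rw [min_eq_right] <;> linarith
        · rw [min_eq_left] <;> linarith
  · rintro ⟨X, Y⟩ ⟨hX, hY⟩
    refine Prod.ext (funext fun p => ?_) (funext fun q => ?_)
    · exact sum_jointWeight hs' ht' hX.1 hY p
    · exact sum_jointWeight' hs ht hY.1 hX q

end product

/-! ### Polygons are circles, and products of cycles are tori. -/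

/-- The closed polygon through `v 0, …, v (N - 1)`. -/
def polygon {V : Type*} [DecidableEq V] (v : ℕ → V) (N : ℕ) : Finset (Finset V) :=
  insert {v (N - 1), v 0} ((Finset.range (N - 1)).image fun i => {v i, v (i + 1)})

/-- The new vertex v N subdivides the closing edge. With N ≥ 3 no other edge joins the two ends of
the closing edge, as subdivision requires. -/
theorem polygon_succ {V : Type*} [Fintype V] [DecidableEq V] {v : ℕ → V} {N : ℕ} (hN : 3 ≤ N)
    (hv : Set.InjOn v (Set.Iio (N + 1))) : SameSpace (polygon v N) (polygon v (N + 1)) := by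
  have hne : ∀ i j, i < N + 1 → j < N + 1 → (v i = v j ↔ i = j) := fun i j hi hj =>
    ⟨fun h => hv hi hj h, fun h => h ▸ rfl⟩
  refine sameSpace_subdivide (u := v (N - 1)) (w := v 0) (m := v N)
    (S := (Finset.range (N - 1)).image fun i => {v i, v (i + 1)}) (P := {∅}) ?_ ?_ ?_ ?_ ?_ ?_ ?_ ?_
  · rw [Ne, hne] <;> omega
  · rw [Ne, hne] <;> omega
  · rw [Ne, hne] <;> omega
  · intro e
    simp only [polygon, Finset.mem_insert, Finset.mem_singleton, exists_eq_left,
      insert_empty_eq]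
    tauto
  · intro e
    simp only [polygon, Finset.mem_insert, Finset.mem_singleton, exists_eq_left,
      insert_empty_eq, Nat.add_sub_cancel]
    obtain ⟨M, rfl⟩ : ∃ M, N = M + 1 := ⟨N - 1, by omega⟩
    simp only [Nat.add_sub_cancel, Finset.range_add_one, Finset.image_insert, Finset.mem_insert,
      Finset.pair_comm (v (M + 1)) (v M)]
    tauto
  · intro e he
    obtain ⟨i, hi, rfl⟩ := Finset.mem_image.1 he
    have := Finset.mem_range.1 hi
    simp only [Finset.mem_insert, Finset.mem_singleton]
    rw [hne _ _ (by omega) (by omega), hne _ _ (by omega) (by omega)]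
    omega
  · intro e he
    obtain ⟨i, hi, rfl⟩ := Finset.mem_image.1 he
    have := Finset.mem_range.1 hi
    simp only [Finset.mem_insert, Finset.mem_singleton]
    rw [hne _ _ (by omega) (by omega), hne _ _ (by omega) (by omega), hne _ _ (by omega) (by omega),
      hne _ _ (by omega) (by omega)]
    omega
  · simp

theorem polygon_four {V : Type*} [Fintype V] [DecidableEq V] {v : ℕ → V} :
    ∀ {N : ℕ}, 4 ≤ N → Set.InjOn v (Set.Iio N) → SameSpace (polygon v 4) (polygon v N) := by
  intro N hN
  induction N, hN using Nat.le_induction with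
  | base => exact fun _ => SameSpace.refl _
  | succ N hN ih =>
    intro hv
    exact (ih (hv.mono (Set.Iio_subset_Iio (Nat.le_succ N)))).trans (polygon_succ (by omega) hv)

/-- The boundary of a square is a circle. -/
theorem square_homeomorph_circle :
    Nonempty (geometricRealization
      ({{0, 1}, {1, 2}, {2, 3}, {3, 0}} : Finset (Finset (Fin 4))) ≃ₜ Circle) := by
  change Nonempty (_ ≃ₜ Metric.sphere (0 : ℂ) 1)
  set T : Finset (Finset (Fin 4)) := {{0, 1}, {1, 2}, {2, 3}, {3, 0}} with hT
  have hmem : ∀ x : Fin 4 → ℝ, x ∈ geometricRealization T ↔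
      (∀ i, 0 ≤ x i) ∧ x 0 + x 1 + x 2 + x 3 = 1 ∧ (x 0 = 0 ∨ x 2 = 0) ∧ (x 1 = 0 ∨ x 3 = 0) := by
    intro x
    -- A face of the square is a set without opposite vertices. With 0, 2 and 1, 3 as the positive
    -- and negative ends of the two axes, the realization becomes the ℓ¹ unit circle of ℂ, and
    -- radial projection takes it to the round circle.
    simp only [geometricRealization, stdSimplex, Set.mem_ofPred_eq, Fin.sum_univ_four, hT,
      Finset.mem_insert, Finset.mem_singleton, exists_eq_or_imp, exists_eq_left, Fin.forall_fin_succ,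
      and_assoc]
    refine and_congr_right fun _ => and_congr_right fun _ => and_congr_right fun _ =>
      and_congr_right fun _ => ?_
    simp
    tauto
  set g : (Fin 4 → ℝ) → ℂ := fun x => ⟨x 0 - x 2, x 1 - x 3⟩ with hg
  set h : ℂ → Fin 4 → ℝ := fun z =>
    (|z.re| + |z.im|)⁻¹ • ![max z.re 0, max z.im 0, max (-z.re) 0, max (-z.im) 0] with hh
  have hgc : Continuous g := by
    have : g = fun x => ((x 0 - x 2 : ℝ) : ℂ) + ((x 1 - x 3 : ℝ) : ℂ) * Complex.I := by
      funext x; apply Complex.ext <;> simp [hg]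
    rw [this]; fun_prop
  have hg1 : ∀ x ∈ geometricRealization T, |(g x).re| + |(g x).im| = 1 := by
    intro x hx
    obtain ⟨h0, h1, h2, h3⟩ := (hmem x).1 hx
    have e1 : |x 0 - x 2| = x 0 + x 2 := by
      rcases h2 with h2 | h2 <;> simp [h2, abs_of_nonneg (h0 _)]
    have e2 : |x 1 - x 3| = x 1 + x 3 := by
      rcases h3 with h3 | h3 <;> simp [h3, abs_of_nonneg (h0 _)]
    simp only [hg, e1, e2]; linarith
  have hg0 : ∀ x ∈ geometricRealization T, 0 < ‖g x‖ := by
    intro x hx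
    refine norm_pos_iff.2 fun h0 => ?_
    have := hg1 x hx
    rw [h0] at this
    simp at this
  have hpos : ∀ z : ℂ, z ≠ 0 → 0 < |z.re| + |z.im| := by
    intro z hz
    by_contra hlt
    have h1 := abs_nonneg z.re
    have h2 := abs_nonneg z.im
    exact hz (Complex.ext (abs_eq_zero.1 (by linarith)) (abs_eq_zero.1 (by linarith)))
  have hsph0 : ∀ z ∈ Metric.sphere (0 : ℂ) 1, z ≠ 0 := by
    rintro z hz rfl
    simp at hz
  have hscale : ∀ (c : ℝ) (z : ℂ), 0 < c → h (c * z) = h z := by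
    intro c z hc
    have hm : ∀ a : ℝ, max (c * a) 0 = c * max a 0 := fun a => by
      rw [mul_max_of_nonneg _ _ hc.le, mul_zero]
    have e : ∀ a b : ℝ, a * c⁻¹ * (c * b) = a * b := fun a b => by
      rw [mul_assoc, inv_mul_cancel_left₀ hc.ne']
    funext i
    fin_cases i <;>
    simp [hh, abs_mul, abs_of_pos hc, ← mul_add, ← mul_neg, hm, e]
  have hgh : ∀ z : ℂ, g (h z) = ((|z.re| + |z.im|)⁻¹ : ℝ) * z := by
    intro z
    have e : ∀ a : ℝ, max a 0 - max (-a) 0 = a := fun a => by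
      rcases le_total 0 a with ha | ha
      · rw [max_eq_left ha, max_eq_right (by linarith)]; ring
      · rw [max_eq_right ha, max_eq_left (by linarith)]; ring
    apply Complex.ext
    · rw [Complex.re_ofReal_mul]; simp [hg, hh, ← mul_sub, e]
    · rw [Complex.im_ofReal_mul]; simp [hg, hh, ← mul_sub, e]
  refine nonempty_homeomorph_of_maps (B := Metric.sphere (0 : ℂ) 1)
    (fun x => (((‖g x‖)⁻¹ : ℝ) : ℂ) * g x) h ?_ ?_ ?_ ?_ ?_ ?_
  · refine ContinuousOn.mul ?_ hgc.continuousOn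
    exact Complex.continuous_ofReal.comp_continuousOn
      (hgc.norm.continuousOn.inv₀ fun x hx => (hg0 x hx).ne')
  · refine ContinuousOn.smul (ContinuousOn.inv₀ (by fun_prop) fun z hz => (hpos z (hsph0 z hz)).ne')
      (Continuous.continuousOn (continuous_pi fun i => ?_))
    fin_cases i <;> simp <;> fun_prop
  · intro x hx
    have := hg0 x hx
    simp [this.ne']
  · intro z hz
    have hp := hpos z (hsph0 z hz)
    rw [hmem]
    refine ⟨fun i => ?_, ?_, ?_, ?_⟩
    · fin_cases i <;> simp [hh] <;> positivity
    · have e : ∀ a : ℝ, max a 0 + max (-a) 0 = |a| := fun a => by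
        rcases le_total 0 a with ha | ha
        · rw [max_eq_left ha, max_eq_right (by linarith), abs_of_nonneg ha]; ring
        · rw [max_eq_right ha, max_eq_left (by linarith), abs_of_nonpos ha]; ring
      simp only [hh, Pi.smul_apply, smul_eq_mul, ← mul_add]
      have : ∀ a b c d : ℝ, a + b + c + d = (a + c) + (b + d) := fun _ _ _ _ => by ring
      rw [this]
      simp only [Matrix.cons_val]
      rw [e, e, inv_mul_cancel₀ hp.ne']
    · simp only [hh, Pi.smul_apply, smul_eq_mul, Matrix.cons_val]
      rcases le_total 0 z.re with ha | ha
      · right; rw [max_eq_right (by linarith), mul_zero]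
      · left; rw [max_eq_right (by linarith), mul_zero]
    · simp only [hh, Pi.smul_apply, smul_eq_mul, Matrix.cons_val]
      rcases le_total 0 z.im with ha | ha
      · right; rw [max_eq_right (by linarith), mul_zero]
      · left; rw [max_eq_right (by linarith), mul_zero]
  · intro x hx
    rw [hscale _ _ (inv_pos.2 (hg0 x hx))]
    obtain ⟨h0, h1, h2, h3⟩ := (hmem x).1 hx
    have e := hg1 x hx
    have e2 : ∀ a b : ℝ, 0 ≤ a → 0 ≤ b → (a = 0 ∨ b = 0) → max (a - b) 0 = a := by
      rintro a b ha hb (rfl | rfl)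
      · simp [hb]
      · simp [ha]
    funext i
    simp only [hh, e, inv_one, one_smul]
    fin_cases i
    · exact e2 _ _ (h0 0) (h0 2) h2
    · exact e2 _ _ (h0 1) (h0 3) h3
    · simpa [hg] using e2 _ _ (h0 2) (h0 0) h2.symm
    · simpa [hg] using e2 _ _ (h0 3) (h0 1) h3.symm
  · intro z hz
    have hp := hpos z (hsph0 z hz)
    have hz1 : ‖z‖ = 1 := by simpa using hz
    change (((‖g (h z)‖)⁻¹ : ℝ) : ℂ) * g (h z) = z
    rw [hgh, norm_mul, hz1, mul_one, Complex.norm_real, Real.norm_of_nonneg (by positivity),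
      ← mul_assoc, ← Complex.ofReal_mul, inv_mul_cancel₀ (by positivity), Complex.ofReal_one, one_mul]

/-- A closed polygon with at least four vertices is a circle. -/
theorem polygon_homeomorph_circle {V : Type*} [Fintype V] [DecidableEq V] {v : ℕ → V} {N : ℕ}
    (hN : 4 ≤ N) (hv : Set.InjOn v (Set.Iio N)) :
    Nonempty (geometricRealization (polygon v N) ≃ₜ Circle) := by
  have h4 : SameSpace ({{0, 1}, {1, 2}, {2, 3}, {3, 0}} : Finset (Finset (Fin 4)))
      (polygon v 4) := by
    have := sameSpace_image (fun i : Fin 4 => v i)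
      (fun i j h => Fin.ext (hv (lt_of_lt_of_le i.2 hN) (lt_of_lt_of_le j.2 hN) h))
      ({{0, 1}, {1, 2}, {2, 3}, {3, 0}} : Finset (Finset (Fin 4)))
    convert this using 1
    ext e
    simp [polygon, Finset.image_insert, Finset.range_add_one]
    tauto
  obtain ⟨f⟩ := h4.trans (polygon_four hN hv)
  obtain ⟨g⟩ := square_homeomorph_circle
  exact ⟨f.symm.trans g⟩

/-- Sources of the edges of the bipartite cycle with vertices `(i, true)`, `(i, false)`. -/
def cycSource {k : ℕ} [NeZero k] (i : Fin k × Bool) : Fin k × Bool :=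
  (if i.2 then i.1 + 1 else i.1, true)

/-- Targets of the edges of the bipartite cycle with vertices `(i, true)`, `(i, false)`. -/
def cycTarget {k : ℕ} (i : Fin k × Bool) : Fin k × Bool := (i.1, false)

theorem cycle_homeomorph_circle {k : ℕ} [NeZero k] (hk : 2 ≤ k) :
    Nonempty (geometricRealization (edgeFamily (cycSource (k := k)) cycTarget) ≃ₜ Circle) := by
  -- The bipartite cycle traversed as (0, true), (0, false), (1, true), (1, false), …: the step from
  -- an even index is the edge with flag `false`, the step from an odd index the one with flag
  -- `true`.
  set v : ℕ → Fin k × Bool := fun n => (Fin.ofNat k (n / 2), n % 2 == 0) with hv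
  have hinj : Set.InjOn v (Set.Iio (2 * k)) := by
    intro m hm n hn h
    simp only [Set.mem_Iio] at hm hn
    simp only [hv, Prod.mk.injEq, Fin.ext_iff, Fin.val_ofNat] at h
    rw [Nat.mod_eq_of_lt (by omega), Nat.mod_eq_of_lt (by omega)] at h
    have h2 := h.2
    have : m % 2 = 0 ↔ n % 2 = 0 := by
      rw [← beq_iff_eq, h2, beq_iff_eq]
    omega
  have heven : ∀ i, v (2 * i) = (Fin.ofNat k i, true) := fun i => by
    simp [hv]
  have hodd : ∀ i, v (2 * i + 1) = (Fin.ofNat k i, false) := fun i => by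
    simp only [hv]
    rw [show (2 * i + 1) / 2 = i by omega, show (2 * i + 1) % 2 = 1 by omega]
    rfl
  have hfin : ∀ i : Fin k, Fin.ofNat k i = i := fun i => Fin.ofNat_val_eq_self i
  have hsucc : ∀ i : ℕ, Fin.ofNat k (i + 1) = Fin.ofNat k i + 1 := fun i => by
    ext; simp [Fin.val_add]
  have hper : v (2 * k) = v 0 := by
    rw [heven, show (0 : ℕ) = 2 * 0 from rfl, heven]
    simp
  have : edgeFamily (cycSource (k := k)) cycTarget = polygon v (2 * k) := by
    have hpoly : polygon v (2 * k) = (Finset.range (2 * k)).image fun i => {v i, v (i + 1)} := by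
      obtain ⟨M, hM⟩ : ∃ M, 2 * k = M + 1 := ⟨2 * k - 1, by omega⟩
      rw [polygon, hM, Finset.range_add_one, Finset.image_insert, Nat.add_sub_cancel, ← hper, hM]
    rw [hpoly]
    ext e
    simp only [edgeFamily, Finset.mem_image, Finset.mem_univ, true_and, Finset.mem_range]
    constructor
    · rintro ⟨⟨i, b⟩, rfl⟩
      cases b
      · refine ⟨2 * i, by omega, ?_⟩
        rw [heven, hodd, hfin]; rfl
      · refine ⟨2 * i + 1, by omega, ?_⟩
        rw [hodd, show 2 * (i : ℕ) + 1 + 1 = 2 * (i + 1) by ring, heven, hsucc, hfin,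
          Finset.pair_comm]
        rfl
    · rintro ⟨n, hn, rfl⟩
      rcases Nat.even_or_odd' n with ⟨i, rfl | rfl⟩
      · refine ⟨(Fin.ofNat k i, false), ?_⟩
        rw [heven, hodd]; rfl
      · refine ⟨(Fin.ofNat k i, true), ?_⟩
        rw [hodd, show 2 * (i : ℕ) + 1 + 1 = 2 * (i + 1) by ring, heven, hsucc,
          Finset.pair_comm]
        rfl
  rw [this]
  exact polygon_homeomorph_circle (by omega) hinj

/-- The triangulated product of two bipartite cycles is a torus. -/
theorem torus_product {k l : ℕ} [NeZero k] [NeZero l] (hk : 2 ≤ k) (hl : 2 ≤ l) :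
    Nonempty (geometricRealization (productFamily (cycSource (k := k)) cycTarget
      (cycSource (k := l)) cycTarget) ≃ₜ Circle × Circle) := by
  obtain ⟨f⟩ := productFamily_homeomorph (cycSource (k := k)) cycTarget
    (cycSource (k := l)) cycTarget Prod.snd Prod.snd (fun _ => rfl) (fun _ => rfl) (fun _ => rfl)
    (fun _ => rfl)
  obtain ⟨g⟩ := cycle_homeomorph_circle hk
  obtain ⟨h⟩ := cycle_homeomorph_circle hl
  exact ⟨f.trans (g.prodCongr h)⟩

/-! ### Discs filling a 4-cycle. -/

section discs

variable {V : Type*} [DecidableEq V]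

/-- The disc with boundary the 4-cycle `p x p' y` and one inner vertex `m`. -/
def fan (m p x p' y : V) : Finset (Finset V) := {{p, x, m}, {p', x, m}, {p', y, m}, {p, y, m}}

/-- `D` fills the 4-cycle `p x q y` using the inner vertices `I`: in any complex avoiding `I` it can
be exchanged for a fan with centre in `I`. -/
def IsDisc [Fintype V] (D : Finset (Finset V)) (p x q y : V) (I : Finset V) : Prop :=
  (∀ e ∈ D, e.card = 3 ∧ e ⊆ I ∪ {p, x, q, y}) ∧
  ∃ m ∈ I, ∀ S : Finset (Finset V), (∀ e ∈ S, Disjoint e I) → SameSpace (S ∪ D) (S ∪ fan m p x q y)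

/-- The join of `{p, p'}` with a path. -/
def pathDisc (p p' : V) : List V → Finset (Finset V)
  | [] => ∅
  | [_] => ∅
  | x :: y :: l => {{p, x, y}, {p', x, y}} ∪ pathDisc p p' (y :: l)

theorem subset_of_mem_pathDisc {p p' : V} : ∀ {l : List V} {e : Finset V}, e ∈ pathDisc p p' l →
    e ⊆ insert p (insert p' l.toFinset)
  | [], e, h => by simp [pathDisc] at h
  | [_], e, h => by simp [pathDisc] at h
  | x :: y :: l, e, h => by
    rw [pathDisc, Finset.mem_union] at h
    rcases h with h | h
    · simp only [Finset.mem_insert, Finset.mem_singleton] at h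
      rcases h with rfl | rfl <;> intro v hv <;>
        simp only [Finset.mem_insert, Finset.mem_singleton, List.toFinset_cons] at hv ⊢ <;> tauto
    · intro v hv
      have := subset_of_mem_pathDisc h hv
      simp only [Finset.mem_insert, List.toFinset_cons] at this ⊢
      tauto

theorem card_of_mem_pathDisc {p p' : V} : ∀ {l : List V} {e : Finset V}, l.Nodup → p ∉ l → p' ∉ l →
    e ∈ pathDisc p p' l → e.card = 3
  | [], e, _, _, _, h => by simp [pathDisc] at h
  | [_], e, _, _, _, h => by simp [pathDisc] at h
  | x :: y :: l, e, hn, hp, hp', h => by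
    rw [pathDisc, Finset.mem_union] at h
    rcases h with h | h
    · simp only [Finset.mem_insert, Finset.mem_singleton] at h
      simp only [List.nodup_cons, List.mem_cons, not_or] at hn hp hp'
      rcases h with rfl | rfl <;> rw [Finset.card_eq_three]
      · exact ⟨p, x, y, hp.1, hp.2.1, hn.1.1, rfl⟩
      · exact ⟨p', x, y, hp'.1, hp'.2.1, hn.1.1, rfl⟩
    · exact card_of_mem_pathDisc (List.nodup_cons.1 hn).2 (fun h => hp (List.mem_cons_of_mem _ h))
        (fun h => hp' (List.mem_cons_of_mem _ h)) h

/-- Shorten the path one inner vertex at a time: the first inner vertex v subdivides the edge from x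
to the next vertex w, and the faces at that edge are completed by p and p'. When a single inner
vertex is left, the join is a fan. -/
theorem pathDisc_sameSpace [Fintype V] {p p' x y : V} (hpp : p ≠ p') : ∀ {vs : List V}, vs ≠ [] →
    (x :: (vs ++ [y])).Nodup → p ∉ x :: (vs ++ [y]) → p' ∉ x :: (vs ++ [y]) →
    ∃ m ∈ vs, ∀ S : Finset (Finset V), (∀ e ∈ S, Disjoint e vs.toFinset) →
      SameSpace (S ∪ pathDisc p p' (x :: (vs ++ [y]))) (S ∪ fan m p x p' y)
  | [], h, _, _, _ => absurd rfl h
  | [m], _, _, _, _ => by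
    refine ⟨m, by simp, fun S _ => ?_⟩
    have : pathDisc p p' (x :: ([m] ++ [y])) = fan m p x p' y := by
      simp only [fan, pathDisc, List.singleton_append]
      rw [Finset.pair_comm m y]
      ext e
      simp only [Finset.mem_insert, Finset.mem_singleton, Finset.mem_union, Finset.notMem_empty]
      tauto
    rw [this]
    exact SameSpace.refl _
  | v :: w :: vs, _, hn, hp, hp' => by
    obtain ⟨m, hm, hS⟩ := pathDisc_sameSpace (p := p) (p' := p') (x := x) (y := y) hpp
      (vs := w :: vs) (by simp)
      (by simp only [List.cons_append, List.nodup_cons, List.mem_cons, not_or] at hn ⊢; tauto)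
      (by simp only [List.cons_append, List.mem_cons, not_or] at hp ⊢; tauto)
      (by simp only [List.cons_append, List.mem_cons, not_or] at hp' ⊢; tauto)
    refine ⟨m, List.mem_cons_of_mem _ hm, fun S hd => ?_⟩
    have hd' : ∀ e ∈ S, Disjoint e (w :: vs).toFinset := fun e he =>
      (hd e he).mono_right fun a ha => by
        rw [List.mem_toFinset] at ha ⊢; exact List.mem_cons_of_mem _ ha
    refine SameSpace.trans (SameSpace.symm ?_) (hS S hd')
    simp only [List.cons_append, List.nodup_cons, List.mem_cons, not_or] at hn hp hp'
    refine sameSpace_subdivide (u := x) (w := w) (m := v)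
      (S := S ∪ pathDisc p p' (w :: (vs ++ [y]))) (P := {{p}, {p'}}) hn.1.2.1 (Ne.symm hn.1.1)
      hn.2.1.1 ?_ ?_ ?_ ?_ ?_
    · intro e
      simp only [List.cons_append, pathDisc, Finset.mem_union, Finset.mem_insert,
        Finset.mem_singleton, exists_eq_or_imp, exists_eq_left]
      have : ∀ q : V, ({q, x, w} : Finset V) = {x, w, q} := fun q => by
        ext; simp only [Finset.mem_insert, Finset.mem_singleton]; tauto
      simp only [this]
      tauto
    · intro e
      simp only [List.cons_append, pathDisc, Finset.mem_union, Finset.mem_insert,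
        Finset.mem_singleton, exists_eq_or_imp, exists_eq_left]
      have h1 : ∀ q : V, ({q, x, v} : Finset V) = {v, x, q} := fun q => by
        ext; simp only [Finset.mem_insert, Finset.mem_singleton]; tauto
      have h2 : ∀ q : V, ({q, v, w} : Finset V) = {v, w, q} := fun q => by
        ext; simp only [Finset.mem_insert, Finset.mem_singleton]; tauto
      simp only [h1, h2]
      tauto
    · intro e he hv
      rcases Finset.mem_union.1 he with he | he
      · exact Finset.disjoint_left.1 (hd e he) hv (by simp)
      · have := subset_of_mem_pathDisc he hv
        simp only [Finset.mem_insert, List.mem_toFinset, List.mem_cons] at this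
        tauto
    · intro e he hx hw
      rcases Finset.mem_union.1 he with he | he
      · exact Finset.disjoint_left.1 (hd e he) hw (by simp)
      · have := subset_of_mem_pathDisc he hx
        simp only [Finset.mem_insert, List.mem_toFinset, List.mem_cons] at this
        tauto
    · intro l hl
      simp only [Finset.mem_insert, Finset.mem_singleton] at hl
      rcases hl with rfl | rfl <;> simp only [Finset.mem_singleton]
      · tauto
      · tauto

theorem isDisc_pathDisc [Fintype V] {p p' x y : V} (hpp : p ≠ p') {vs : List V} (hvs : vs ≠ [])
    (hn : (x :: (vs ++ [y])).Nodup) (hp : p ∉ x :: (vs ++ [y])) (hp' : p' ∉ x :: (vs ++ [y])) :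
    IsDisc (pathDisc p p' (x :: (vs ++ [y]))) p x p' y vs.toFinset := by
  refine ⟨fun e he => ⟨card_of_mem_pathDisc hn hp hp' he, fun v hv => ?_⟩, ?_⟩
  · have := subset_of_mem_pathDisc he hv
    simp only [Finset.mem_insert, List.mem_toFinset, List.mem_cons, List.mem_append, List.not_mem_nil,
      Finset.mem_union, Finset.mem_singleton] at this ⊢
    tauto
  · obtain ⟨m, hm, h⟩ := pathDisc_sameSpace hpp hvs hn hp hp'
    exact ⟨m, List.mem_toFinset.2 hm, h⟩

theorem subset_of_mem_fan {m p x p' y : V} {e : Finset V} (he : e ∈ fan m p x p' y) :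
    e ⊆ {m, p, x, p', y} := by
  simp only [fan, Finset.mem_insert, Finset.mem_singleton] at he
  intro v hv
  rcases he with rfl | rfl | rfl | rfl <;>
    simp only [Finset.mem_insert, Finset.mem_singleton] at hv ⊢ <;> tauto

/-- Two discs sharing the path `x p'' y` unite to a disc. -/
theorem IsDisc.glue [Fintype V] {D D' : Finset (Finset V)} {p p' p'' x y : V} {I I' : Finset V}
    (h : IsDisc D p x p'' y I) (h' : IsDisc D' p'' x p' y I') (hII : Disjoint I I')
    (hnd : [p, p', p'', x, y].Nodup) (hI : ∀ v ∈ [p, p', p'', x, y], v ∉ I ∧ v ∉ I') :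
    IsDisc (D ∪ D') p x p' y (insert p'' (I ∪ I')) := by
  obtain ⟨hD, m, hm, hS⟩ := h
  obtain ⟨hD', m', hm', hS'⟩ := h'
  have hmI : m ∉ I' := fun h => Finset.disjoint_left.1 hII hm h
  have hmI' : m' ∉ I := fun h => Finset.disjoint_left.1 hII h hm'
  simp only [List.mem_cons, List.not_mem_nil, or_false, forall_eq_or_imp, forall_eq] at hI
  obtain ⟨⟨hp1, hp2⟩, ⟨hp'1, hp'2⟩, ⟨hp''1, hp''2⟩, ⟨hx1, hx2⟩, ⟨hy1, hy2⟩⟩ := hI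
  simp only [List.nodup_cons, List.mem_cons, List.not_mem_nil, or_false, not_or,
    not_false_eq_true, List.nodup_nil, and_true] at hnd
  obtain ⟨⟨h1, h2, h3, h4⟩, ⟨h5, h6, h7⟩, ⟨h8, h9⟩, h10⟩ := hnd
  have hne : ∀ {a : V} {J : Finset V} {b : V}, a ∈ J → b ∉ J → a ≠ b := fun ha hb h => hb (h ▸ ha)
  have m1 := hne hm hp1
  have m2 := hne hm hp'1
  have m3 := hne hm hp''1
  have m4 := hne hm hx1
  have m5 := hne hm hy1
  have m6 := hne hm hmI'
  have n1 := hne hm' hp2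
  have n2 := hne hm' hp'2
  have n3 := hne hm' hp''2
  have n4 := hne hm' hx2
  have n5 := hne hm' hy2
  refine ⟨fun e he => ?_, m', by simp [hm'], fun S hSd => ?_⟩
  · rcases Finset.mem_union.1 he with he | he
    · refine ⟨(hD e he).1, fun v hv => ?_⟩
      have := (hD e he).2 hv
      simp only [Finset.mem_union, Finset.mem_insert, Finset.mem_singleton] at this ⊢
      tauto
    · refine ⟨(hD' e he).1, fun v hv => ?_⟩
      have := (hD' e he).2 hv
      simp only [Finset.mem_union, Finset.mem_insert, Finset.mem_singleton] at this ⊢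
      tauto
  have hSI : ∀ e ∈ S, Disjoint e I := fun e he => (hSd e he).mono_right fun v hv => by simp [hv]
  have hSI' : ∀ e ∈ S, Disjoint e I' := fun e he => (hSd e he).mono_right fun v hv => by simp [hv]
  have hSm : ∀ e ∈ S, m ∉ e := fun e he hv => Finset.disjoint_left.1 (hSI e he) hv hm
  have hSm' : ∀ e ∈ S, m' ∉ e := fun e he hv => Finset.disjoint_left.1 (hSI' e he) hv hm'
  have hSp : ∀ e ∈ S, p'' ∉ e := fun e he hv => Finset.disjoint_left.1 (hSd e he) hv (by simp)
  -- Each disc is exchanged for its fan with the other one regarded as part of the surrounding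
  -- complex.
  have step1 := hS (S ∪ D') fun e he => by
    rcases Finset.mem_union.1 he with he | he
    · exact hSI e he
    · refine Finset.disjoint_left.2 fun v hv hvI => ?_
      have := (hD' e he).2 hv
      simp only [Finset.mem_union, Finset.mem_insert, Finset.mem_singleton] at this
      rcases this with h | rfl | rfl | rfl | rfl
      · exact Finset.disjoint_left.1 hII hvI h
      all_goals contradiction
  have step2 := hS' (S ∪ fan m p x p'' y) fun e he => by
    rcases Finset.mem_union.1 he with he | he
    · exact hSI' e he
    · refine Finset.disjoint_left.2 fun v hv hvI => ?_
      have := subset_of_mem_fan he hv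
      simp only [Finset.mem_insert, Finset.mem_singleton] at this
      rcases this with rfl | rfl | rfl | rfl | rfl
      all_goals contradiction
  rw [Finset.union_right_comm] at step2
  rw [Finset.union_assoc, Finset.union_comm D' D] at step1
  refine (step1.trans step2).trans ?_
  -- Between the fans with centres m and m', the vertex p'' only meets m, m', x, y, so it is the
  -- midpoint of an edge m m' whose faces are completed by x and y; it can be removed.
  have step3 : SameSpace (S ∪ {{p, x, m}, {p, y, m}, {p', x, m'}, {p', y, m'}, {m, m', x}, {m, m', y}})
      (S ∪ fan m p x p'' y ∪ fan m' p'' x p' y) := by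
    refine sameSpace_subdivide (u := m) (w := m') (m := p'')
      (S := S ∪ {{p, x, m}, {p, y, m}, {p', x, m'}, {p', y, m'}}) (P := {{x}, {y}})
      m6 m3.symm n3.symm ?_ ?_ ?_ ?_ ?_
    · intro e
      simp only [Finset.mem_union, Finset.mem_insert, Finset.mem_singleton, exists_eq_or_imp,
        exists_eq_left, or_assoc]
    · intro e
      simp only [fan, Finset.mem_union, Finset.mem_insert, Finset.mem_singleton, exists_eq_or_imp,
        exists_eq_left]
      rw [Finset.pair_comm x m, Finset.pair_comm y m, Finset.pair_comm x m', Finset.pair_comm y m']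
      exact iff_of_eq (by ac_rfl)
    · intro e he
      simp only [Finset.mem_union, Finset.mem_insert, Finset.mem_singleton] at he
      rcases he with he | rfl | rfl | rfl | rfl
      · exact hSp e he
      all_goals grind
    · intro e he hm1 hm2
      simp only [Finset.mem_union, Finset.mem_insert, Finset.mem_singleton] at he
      rcases he with he | rfl | rfl | rfl | rfl
      · exact hSm e he hm1
      all_goals grind
    · intro l hl
      simp only [Finset.mem_insert, Finset.mem_singleton] at hl
      rcases hl with rfl | rfl <;> grind
  refine step3.symm.trans (SameSpace.symm ?_)
  -- Now m is in turn the midpoint of the edge from p to m'. Removing it leaves the fan with centre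
  -- m'.
  refine sameSpace_subdivide (u := p) (w := m') (m := m)
      (S := S ∪ {{p', x, m'}, {p', y, m'}}) (P := {{x}, {y}})
      n1.symm m1 m6 ?_ ?_ ?_ ?_ ?_
  · intro e
    simp only [fan, Finset.mem_union, Finset.mem_insert, Finset.mem_singleton, exists_eq_or_imp,
      exists_eq_left]
    rw [Finset.pair_comm x m', Finset.pair_comm y m']
    exact iff_of_eq (by ac_rfl)
  · intro e
    simp only [Finset.mem_union, Finset.mem_insert, Finset.mem_singleton, exists_eq_or_imp,
      exists_eq_left]
    have : ∀ z : V, ({p, z, m} : Finset V) = {m, p, z} := fun z => by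
      rw [Finset.insert_comm m p, Finset.pair_comm z m]
    simp only [this]
    exact iff_of_eq (by ac_rfl)
  · intro e he
    simp only [Finset.mem_union, Finset.mem_insert, Finset.mem_singleton] at he
    rcases he with he | rfl | rfl
    · exact hSm e he
    all_goals grind
  · intro e he hm1 hm2
    simp only [Finset.mem_union, Finset.mem_insert, Finset.mem_singleton] at he
    rcases he with he | rfl | rfl
    · exact hSm' e he hm2
    all_goals grind
  · intro l hl
    simp only [Finset.mem_insert, Finset.mem_singleton] at hl
    rcases hl with rfl | rfl <;> grind

end discs

/-! ### Toroidal grids of quadrilaterals. -/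

section grid

variable {V : Type*} {k l : ℕ} [NeZero k] [NeZero l]

/-- Second corner of the quadrilateral `q`. -/
def quadX (X : Fin k × Fin l → V) (q : (Fin k × Fin l) × Bool) : V :=
  if q.2 then X (q.1.1, q.1.2 + 1) else X (q.1.1 + 1, q.1.2)

/-- Third corner of the quadrilateral `q`. -/
def quadP' (A : Fin k × Fin l → V) (q : (Fin k × Fin l) × Bool) : V :=
  if q.2 then A (q.1.1, q.1.2 + 1) else A (q.1.1 + 1, q.1.2)

/-- Fourth corner of the quadrilateral `q`. -/
def quadY (X : Fin k × Fin l → V) (q : (Fin k × Fin l) × Bool) : V := X (q.1.1 + 1, q.1.2 + 1)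

/-- The vertices of the product of two bipartite cycles, as corners and centres of
quadrilaterals. -/
def gridVertex (X A : Fin k × Fin l → V) (m : (Fin k × Fin l) × Bool → V) :
    (Fin k × Bool) × (Fin l × Bool) → V
  | ((i, true), (j, true)) => X (i, j)
  | ((i, false), (j, false)) => A (i, j)
  -- In a bipartite cycle the vertex (j, true) is adjacent to (j, false) and (j - 1, false), while
  -- (i, false) is adjacent to (i, true) and (i + 1, true). So this mixed vertex is surrounded by A
  -- (i, j - 1), X (i, j), A (i, j), X (i + 1, j), which explains the shifted index; the last case
  -- is symmetric.
  | ((i, false), (j, true)) => m ((i, j - 1), true)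
  | ((i, true), (j, false)) => m ((i - 1, j), false)

theorem gridVertex_injective {X A : Fin k × Fin l → V} {m : (Fin k × Fin l) × Bool → V}
    (hX : Function.Injective X) (hA : Function.Injective A) (hm : Function.Injective m)
    (hXA : ∀ r r', X r ≠ A r') (hXm : ∀ r q, X r ≠ m q) (hAm : ∀ r q, A r ≠ m q) :
    Function.Injective (gridVertex X A m) := by
  rintro ⟨⟨i, ε⟩, ⟨j, δ⟩⟩ ⟨⟨i', ε'⟩, ⟨j', δ'⟩⟩ h
  cases ε <;> cases δ <;> cases ε' <;> cases δ' <;> simp only [gridVertex] at h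
  all_goals first
    | exact absurd h (hXA _ _)
    | exact absurd h (hXm _ _)
    | exact absurd h (hAm _ _)
    | exact absurd h.symm (hXA _ _)
    | exact absurd h.symm (hXm _ _)
    | exact absurd h.symm (hAm _ _)
    | (have := hX h; simp_all)
    | (have := hA h; simp_all)
    | (have := hm h; simp_all)

end grid

section torus

variable {V : Type*} [DecidableEq V]

/-- Pairwise independent discs can be exchanged for fans simultaneously. -/
theorem sameSpace_biUnion_fan [Fintype V] {ι : Type*} [DecidableEq ι] {D : ι → Finset (Finset V)}
    {p x p' y : ι → V} {I : ι → Finset V} {m : ι → V} (hm : ∀ q, m q ∈ I q)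
    (hDI : ∀ q, ∀ e ∈ D q, e ⊆ I q ∪ {p q, x q, p' q, y q})
    (hD : ∀ q, ∀ S : Finset (Finset V), (∀ e ∈ S, Disjoint e (I q)) →
      SameSpace (S ∪ D q) (S ∪ fan (m q) (p q) (x q) (p' q) (y q)))
    (hI : ∀ q q', q ≠ q' → Disjoint (I q) (I q'))
    (hc : ∀ q q', p q ∉ I q' ∧ x q ∉ I q' ∧ p' q ∉ I q' ∧ y q ∉ I q') (s : Finset ι) :
    ∀ S : Finset (Finset V), (∀ e ∈ S, ∀ q ∈ s, Disjoint e (I q)) →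
      SameSpace (S ∪ s.biUnion D) (S ∪ s.biUnion fun q => fan (m q) (p q) (x q) (p' q) (y q)) := by
  induction s using Finset.induction_on with
  | empty => intro S _; exact SameSpace.refl _
  | insert q s hq ih =>
    intro S hS
    -- Exchange one disc while the remaining ones count as surrounding complex. They avoid its inner
    -- vertices because their vertices are corners or inner vertices of other discs.
    have h1 := hD q (S ∪ s.biUnion D) fun e he => by
      rcases Finset.mem_union.1 he with he | he
      · exact hS e he q (Finset.mem_insert_self _ _)
      · obtain ⟨r, hr, her⟩ := Finset.mem_biUnion.1 he
        have hrq : r ≠ q := fun h => hq (h ▸ hr)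
        refine Finset.disjoint_left.2 fun v hv hvq => ?_
        have hv' := hDI r e her hv
        simp only [Finset.mem_union, Finset.mem_insert, Finset.mem_singleton] at hv'
        obtain ⟨c1, c2, c3, c4⟩ := hc r q
        rcases hv' with h | rfl | rfl | rfl | rfl
        · exact Finset.disjoint_left.1 (hI r q hrq) h hvq
        all_goals contradiction
    have h2 := ih (S ∪ fan (m q) (p q) (x q) (p' q) (y q)) fun e he r hr => by
      have hrq : r ≠ q := fun h => hq (h ▸ hr)
      rcases Finset.mem_union.1 he with he | he
      · exact hS e he r (Finset.mem_insert_of_mem hr)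
      · refine Finset.disjoint_left.2 fun v hv hvq => ?_
        have hv' := subset_of_mem_fan he hv
        simp only [Finset.mem_insert, Finset.mem_singleton] at hv'
        obtain ⟨c1, c2, c3, c4⟩ := hc q r
        rcases hv' with rfl | rfl | rfl | rfl | rfl
        · exact Finset.disjoint_left.1 (hI r q hrq) hvq (hm q)
        all_goals contradiction
    rw [Finset.union_right_comm] at h2
    rw [Finset.biUnion_insert, Finset.biUnion_insert, Finset.union_comm (D q), ← Finset.union_assoc,
      ← Finset.union_assoc]
    exact h1.trans ((Finset.union_right_comm S _ _) ▸ h2)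

variable {k l : ℕ} [NeZero k] [NeZero l]

/-- Every triangle of the product has one vertex of type (true, true), one of type (false, false)
and one mixed vertex, because the diagonals join sources to targets in both factors. The four
triangles at a mixed vertex are the fan of the quadrilateral centred there. -/
theorem biUnion_fan_eq (X A : Fin k × Fin l → V) (m : (Fin k × Fin l) × Bool → V) :
    (Finset.univ.biUnion fun q => fan (m q) (A q.1) (quadX X q) (quadP' A q) (quadY X q)) =
    (productFamily (cycSource (k := k)) cycTarget (cycSource (k := l)) cycTarget).image
      fun e => e.image (gridVertex X A m) := by
  have key : ∀ i j ε δ, (({(cycSource (i, ε), cycSource (j, δ)), (cycTarget (i, ε), cycSource (j, δ)),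
      (cycTarget (i, ε), cycTarget (j, δ))} : Finset ((Fin k × Bool) × (Fin l × Bool))).image
      (gridVertex X A m) =
        {A (i, j), X (if ε then i + 1 else i, if δ then j + 1 else j),
          m ((i, if δ then j else j - 1), true)}) ∧
      (({(cycSource (i, ε), cycSource (j, δ)), (cycSource (i, ε), cycTarget (j, δ)),
      (cycTarget (i, ε), cycTarget (j, δ))} : Finset ((Fin k × Bool) × (Fin l × Bool))).image
      (gridVertex X A m) =
        {A (i, j), X (if ε then i + 1 else i, if δ then j + 1 else j),
          m ((if ε then i else i - 1, j), false)}) := by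
    intro i j ε δ
    have hrot : ∀ a b c : V, ({a, b, c} : Finset V) = {c, a, b} := fun a b c => by
      rw [Finset.insert_comm c a, Finset.pair_comm c b]
    constructor
    · rw [Finset.image_insert, Finset.image_insert, Finset.image_singleton, hrot]
      cases ε <;> cases δ <;> simp [cycSource, cycTarget, gridVertex]
    · rw [Finset.image_insert, Finset.image_insert, Finset.image_singleton, hrot]
      cases ε <;> cases δ <;> simp [cycSource, cycTarget, gridVertex]
  ext e
  simp only [productFamily, Finset.image_union, Finset.image_image, Finset.mem_union,
    Finset.mem_image, Finset.mem_univ, true_and, Finset.mem_biUnion, Function.comp_apply,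
    Prod.exists, (key _ _ _ _).1, (key _ _ _ _).2]
  simp only [fan, Finset.mem_insert, Finset.mem_singleton]
  constructor
  · rintro ⟨i, j, b, h⟩
    cases b
    · right
      rcases h with rfl | rfl | rfl | rfl
      · exact ⟨i, true, j, false, by simp [quadX]⟩
      · exact ⟨i + 1, false, j, false, by simp [quadX, quadP']⟩
      · exact ⟨i + 1, false, j, true, by simp [quadP', quadY]⟩
      · exact ⟨i, true, j, true, by simp [quadY]⟩
    · left
      rcases h with rfl | rfl | rfl | rfl
      · exact ⟨i, false, j, true, by simp [quadX]⟩
      · exact ⟨i, false, j + 1, false, by simp [quadX, quadP']⟩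
      · exact ⟨i, true, j + 1, false, by simp [quadP', quadY]⟩
      · exact ⟨i, true, j, true, by simp [quadY]⟩
  · rintro (⟨i, ε, j, δ, rfl⟩ | ⟨i, ε, j, δ, rfl⟩)
    · refine ⟨i, if δ then j else j - 1, true, ?_⟩
      cases ε <;> cases δ <;> simp [quadX, quadP', quadY]
    · refine ⟨if ε then i else i - 1, j, false, ?_⟩
      cases ε <;> cases δ <;> simp [quadX, quadP', quadY]

/-- A toroidal grid of quadrilaterals filled by independent discs is a torus. -/
theorem isTorusTriangulation_of_discs [Fintype V] (hk : 2 ≤ k) (hl : 2 ≤ l) {X A : Fin k × Fin l → V}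
    (hX : Function.Injective X) (hA : Function.Injective A) (hXA : ∀ r r', X r ≠ A r')
    {D : (Fin k × Fin l) × Bool → Finset (Finset V)} {I : (Fin k × Fin l) × Bool → Finset V}
    (hD : ∀ q, IsDisc (D q) (A q.1) (quadX X q) (quadP' A q) (quadY X q) (I q))
    (hI : ∀ q q', q ≠ q' → Disjoint (I q) (I q')) (hIX : ∀ r q, X r ∉ I q)
    (hIA : ∀ r q, A r ∉ I q) : IsTorusTriangulation (Finset.univ.biUnion D) := by
  refine ⟨fun e he => ?_, ?_⟩
  · obtain ⟨q, -, he⟩ := Finset.mem_biUnion.1 he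
    exact ((hD q).1 e he).1
  · choose hD1 m hm hD2 using hD
    have h1 := sameSpace_biUnion_fan hm (fun q e he => (hD1 q e he).2) hD2 hI
      (fun q q' => ⟨hIA _ _, by unfold quadX; split_ifs <;> exact hIX _ _,
        by unfold quadP'; split_ifs <;> exact hIA _ _, hIX _ _⟩) Finset.univ ∅ (by simp)
    rw [Finset.empty_union, Finset.empty_union, biUnion_fan_eq] at h1
    have hminj : Function.Injective m := fun q q' h => by
      by_contra hne
      exact Finset.disjoint_left.1 (hI q q' hne) (hm q) (h ▸ hm q')
    have h2 := sameSpace_image _ (gridVertex_injective hX hA hminj hXA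
      (fun r q h => hIX r q (h ▸ hm q)) (fun r q h => hIA r q (h ▸ hm q)))
      (productFamily (cycSource (k := k)) cycTarget (cycSource (k := l)) cycTarget)
    obtain ⟨f⟩ := h1.trans h2.symm
    obtain ⟨g⟩ := torus_product hk hl
    exact ⟨f.trans g⟩

/-- A toroidal grid of quadrilaterals each of which can be filled in any two prescribed colours
yields a torus, if there are sufficiently many colours. -/
theorem containsTorus_of_quads [Fintype V] {H : Finset (Finset V)} (hk : 2 ≤ k) (hl : 2 ≤ l)
    {X A : Fin k × Fin l → V} (hX : Function.Injective X) (hA : Function.Injective A)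
    (hXA : ∀ r r', X r ≠ A r') {R : ℕ} (χ : V → Fin R) (E : (Fin k × Fin l) × Bool → Finset V)
    (hE : ∀ q q', q ≠ q' → Disjoint (E q) (E q')) (hEX : ∀ r q, X r ∉ E q)
    (hEA : ∀ r q, A r ∉ E q) {N : ℕ} (hEN : ∀ q, (E q).card ≤ N) (hR : (6 + 2 * N) * (k * l) ≤ R)
    (hq : ∀ q s₀ s₁, s₀ ≠ s₁ → (∀ r, χ (X r) ≠ s₀ ∧ χ (X r) ≠ s₁) → 
      (∀ r, χ (A r) ≠ s₀ ∧ χ (A r) ≠ s₁) → (∀ q, ∀ v ∈ E q, χ v ≠ s₀ ∧ χ v ≠ s₁) →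
      ∃ D I, D ⊆ H ∧ (∀ v ∈ I, χ v = s₀ ∨ χ v = s₁ ∨ v ∈ E q) ∧
        IsDisc D (A q.1) (quadX X q) (quadP' A q) (quadY X q) I) : ContainsTorus H := by
  set Y : Finset (Fin R) := (Finset.univ.image fun r => χ (X r)) ∪ (Finset.univ.image fun r => χ (A r))
    ∪ (Finset.univ.biUnion E).image χ with hY
  have hYc : Y.card ≤ k * l + k * l + (k * l * 2) * N := by
    refine (Finset.card_union_le _ _).trans (add_le_add ((Finset.card_union_le _ _).trans
      (add_le_add ?_ ?_)) ?_)
    · exact Finset.card_image_le.trans (by simp)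
    · exact Finset.card_image_le.trans (by simp)
    · refine Finset.card_image_le.trans (Finset.card_biUnion_le.trans ?_)
      refine (Finset.sum_le_card_nsmul _ _ N fun q _ => hEN q).trans (by simp)
  -- Two private colours for each of the 2kl quadrilaterals, none of them used on the corners (2kl
  -- vertices) or on the exceptional sets (2klN vertices); this is the bound (6 + 2N)kl.
  have hemb : Nonempty ((((Fin k × Fin l) × Bool) × Bool) ↪ {s : Fin R // s ∉ Y}) := by
    rw [Function.Embedding.nonempty_iff_card_le]
    have : Fintype.card {s : Fin R // s ∉ Y} = R - Y.card := by
      rw [Fintype.card_subtype_compl]; simp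
    rw [this]
    simp only [Fintype.card_prod, Fintype.card_fin, Fintype.card_bool]
    have : (6 + 2 * N) * (k * l) = k * l * 2 * 2 + (k * l + k * l + (k * l * 2) * N) := by ring
    omega
  obtain ⟨f⟩ := hemb
  have hYX : ∀ r t, χ (X r) ≠ (f t).1 := fun r t h => (f t).2 (by rw [← h]; simp [hY])
  have hYA : ∀ r t, χ (A r) ≠ (f t).1 := fun r t h => (f t).2 (by rw [← h]; simp [hY])
  have hYE : ∀ q t, ∀ v ∈ E q, χ v ≠ (f t).1 := fun q t v hv h => (f t).2 (by
    rw [← h, hY]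
    exact Finset.mem_union_right _ (Finset.mem_image_of_mem _
      (Finset.mem_biUnion.2 ⟨q, Finset.mem_univ _, hv⟩)))
  have hfne : ∀ t t', t ≠ t' → (f t).1 ≠ (f t').1 := fun t t' h h' => h (f.injective (Subtype.ext h'))
  have hq' := fun q => hq q (f (q, true)) (f (q, false)) (hfne _ _ (by simp))
    (fun r => ⟨hYX _ _, hYX _ _⟩) (fun r => ⟨hYA _ _, hYA _ _⟩)
    (fun q v hv => ⟨hYE q _ v hv, hYE q _ v hv⟩)
  choose D I hDH hI hD using hq'
  refine ⟨Finset.univ.biUnion D, Finset.biUnion_subset.2 fun q _ => hDH q,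
    isTorusTriangulation_of_discs hk hl hX hA hXA hD ?_ ?_ ?_⟩
  · intro q q' hne
    refine Finset.disjoint_left.2 fun v hv hv' => ?_
    rcases hI q v hv with h | h | h <;> rcases hI q' v hv' with h' | h' | h'
    · exact hfne (q, true) (q', true) (by simp [hne]) (h.symm.trans h')
    · exact hfne (q, true) (q', false) (by simp) (h.symm.trans h')
    · exact hYE _ _ v h' h
    · exact hfne (q, false) (q', true) (by simp) (h.symm.trans h')
    · exact hfne (q, false) (q', false) (by simp [hne]) (h.symm.trans h')
    · exact hYE _ _ v h' h
    · exact hYE _ _ v h h'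
    · exact hYE _ _ v h h'
    · exact Finset.disjoint_left.1 (hE q q' hne) h h'
  · intro r q h
    rcases hI q _ h with h | h | h
    · exact hYX _ _ h
    · exact hYX _ _ h
    · exact hEX _ _ h
  · intro r q h
    rcases hI q _ h with h | h | h
    · exact hYA _ _ h
    · exact hYA _ _ h
    · exact hEA _ _ h

end torus

/-! ### Robust connections through colour classes, and the discs they give. -/

section via

variable {V : Type*}

/-- The edges of `G` inside `W ∪ {x, y}`, except those inside `{x, y}`. -/
def viaGraph (G : SimpleGraph V) (W : V → Prop) (x y : V) : SimpleGraph V where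
  Adj u v := G.Adj u v ∧ (W u ∨ u = x ∨ u = y) ∧ (W v ∨ v = x ∨ v = y) ∧ (W u ∨ W v)
  symm := ⟨fun _ _ h => ⟨h.1.symm, h.2.2.1, h.2.1, h.2.2.2.symm⟩⟩
  loopless := ⟨fun _ h => G.irrefl h.1⟩

/-- Since x and y lie outside W, the last clause of `viaGraph` excludes the edge from x to y itself.
This is what guarantees that the path has an inner vertex, so that its join is a disc. -/
theorem exists_path_of_viaGraph {G : SimpleGraph V} {W : V → Prop} {x y : V} (hxy : x ≠ y)
    (hx : ¬ W x) (hy : ¬ W y) (h : (viaGraph G W x y).Reachable x y) :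
    ∃ vs : List V, vs ≠ [] ∧ (x :: (vs ++ [y])).Nodup ∧ (∀ v ∈ vs, W v) ∧
      List.IsChain G.Adj (x :: (vs ++ [y])) := by
  obtain ⟨p, hp⟩ := h.exists_isPath
  have hc := p.isChain_adj_support
  have hn := hp.support_nodup
  have hlast : p.support.getLast? = some y := by
    rw [List.getLast?_eq_some_getLast p.support_ne_nil, p.getLast_support]
  have hcons := p.cons_tail_support.symm
  generalize p.support = l at hc hn hlast hcons
  obtain ⟨tl, rfl⟩ : ∃ tl, l = x :: tl := ⟨_, hcons⟩
  have htl : tl ≠ [] := by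
    rintro rfl
    exact hxy (by simpa using hlast)
  obtain ⟨vs, z, rfl⟩ : ∃ vs z, tl = vs ++ [z] :=
    ⟨tl.dropLast, tl.getLast htl, (List.dropLast_append_getLast htl).symm⟩
  obtain rfl : z = y := by
    rw [← List.cons_append, List.getLast?_concat] at hlast
    exact Option.some.inj hlast
  have hmem : ∀ {l : List V}, List.IsChain (viaGraph G W x z).Adj l → 2 ≤ l.length → ∀ v ∈ l,
      W v ∨ v = x ∨ v = z := by
    intro l
    induction l with
    | nil => simp
    | cons a l ih =>
      intro hl h2 v hv
      cases l with
      | nil => simp at h2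
      | cons b l =>
        rw [List.isChain_cons_cons] at hl
        rcases List.mem_cons.1 hv with rfl | hv
        · exact hl.1.2.1
        · cases l with
          | nil =>
            rw [List.mem_singleton] at hv
            subst hv
            exact hl.1.2.2.1
          | cons c l => exact ih hl.2 (by simp) v hv
  refine ⟨vs, ?_, hn, fun v hv => ?_, hc.imp fun a b h => h.1⟩
  · rintro rfl
    simp only [List.nil_append, List.isChain_cons_cons] at hc
    rcases hc.1.2.2.2 with h | h
    · exact hx h
    · exact hy h
  · have h1 := hmem hc (by simp) v (by simp [hv])
    simp only [List.nodup_cons, List.mem_append, List.mem_singleton, not_or,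
      List.nodup_append] at hn
    rcases h1 with h1 | rfl | rfl
    · exact h1
    · exact absurd hv hn.1.1
    · exact absurd rfl (hn.2.2.2 v hv v rfl)

/-- `x` and `y` are joined in `G` through any colour class containing neither of them. -/
def Robust {C : Type*} (χ : V → C) (G : SimpleGraph V) (x y : V) : Prop :=
  ∀ s, s ≠ χ x → s ≠ χ y → (viaGraph G (fun v => χ v = s) x y).Reachable x y

theorem viaGraph_mono {G G' : SimpleGraph V} (h : G ≤ G') (W : V → Prop) (x y : V) :
    viaGraph G W x y ≤ viaGraph G' W x y := fun _ _ h' => ⟨h h'.1, h'.2⟩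

theorem Robust.mono {C : Type*} {χ : V → C} {G G' : SimpleGraph V} {x y : V} (h : G ≤ G')
    (hr : Robust χ G x y) : Robust χ G' x y := fun s h1 h2 => (hr s h1 h2).mono (viaGraph_mono h _ _ _)

theorem Robust.symm {C : Type*} {χ : V → C} {G : SimpleGraph V} {x y : V} (hr : Robust χ G x y) :
    Robust χ G y x := fun s h1 h2 => by
  have : viaGraph G (fun v => χ v = s) x y ≤ viaGraph G (fun v => χ v = s) y x := fun u v h =>
    ⟨h.1, by have := h.2.1; tauto, by have := h.2.2.1; tauto, h.2.2.2⟩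
  exact (hr s h2 h1).symm.mono this

variable [DecidableEq V]

/-- The common link of `p` and `p'` in `H`. -/
def linkGraph (H : Finset (Finset V)) (p p' : V) : SimpleGraph V where
  Adj u v := u ≠ v ∧ (u ≠ p ∧ u ≠ p' ∧ v ≠ p ∧ v ≠ p') ∧ ({p, u, v} : Finset V) ∈ H ∧
    ({p', u, v} : Finset V) ∈ H
  symm := ⟨fun u v h => ⟨h.1.symm, ⟨h.2.1.2.2.1, h.2.1.2.2.2, h.2.1.1, h.2.1.2.1⟩,
    by rw [Finset.pair_comm]; exact h.2.2.1, by rw [Finset.pair_comm]; exact h.2.2.2⟩⟩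
  loopless := ⟨fun _ h => h.1 rfl⟩

theorem linkGraph_comm (H : Finset (Finset V)) (p p' : V) : linkGraph H p p' = linkGraph H p' p := by
  ext u v
  simp only [linkGraph]
  tauto

theorem pathDisc_subset_of_isChain {H : Finset (Finset V)} {p p' : V} : ∀ {l : List V},
    List.IsChain (linkGraph H p p').Adj l → pathDisc p p' l ⊆ H
  | [], _ => by simp [pathDisc]
  | [_], _ => by simp [pathDisc]
  | x :: y :: l, h => by
    rw [List.isChain_cons_cons] at h
    rw [pathDisc, Finset.union_subset_iff]
    refine ⟨?_, pathDisc_subset_of_isChain h.2⟩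
    intro e he
    simp only [Finset.mem_insert, Finset.mem_singleton] at he
    rcases he with rfl | rfl
    · exact h.1.2.2.1
    · exact h.1.2.2.2

theorem notMem_of_isChain {H : Finset (Finset V)} {p p' : V} : ∀ {l : List V},
    List.IsChain (linkGraph H p p').Adj l → 2 ≤ l.length → p ∉ l ∧ p' ∉ l
  | [], _, h => by simp at h
  | [_], _, h => by simp at h
  | [x, y], h, _ => by
    rw [List.isChain_cons_cons] at h
    obtain ⟨_, ⟨h1, h2, h3, h4⟩, _⟩ := h.1
    simp [h1.symm, h2.symm, h3.symm, h4.symm]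
  | x :: y :: z :: l, h, _ => by
    rw [List.isChain_cons_cons] at h
    obtain ⟨_, ⟨h1, h2, h3, h4⟩, _⟩ := h.1
    have := notMem_of_isChain h.2 (by simp)
    exact ⟨fun hm => (List.mem_cons.1 hm).elim (fun h => h1 h.symm) this.1,
      fun hm => (List.mem_cons.1 hm).elim (fun h => h2 h.symm) this.2⟩

/-- A robust pair in a common link spans a disc in any admissible colour. -/
theorem Robust.exists_disc [Fintype V] {C : Type*} {χ : V → C} {H : Finset (Finset V)}
    {p p' x y : V} (hpp : p ≠ p') (hxy : x ≠ y) (hr : Robust χ (linkGraph H p p') x y) {s : C}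
    (hx : χ x ≠ s) (hy : χ y ≠ s) : ∃ D I, D ⊆ H ∧ (∀ v ∈ I, χ v = s) ∧ (p ∉ I ∧ p' ∉ I) ∧
      IsDisc D p x p' y I := by
  obtain ⟨vs, h1, h2, h3, h4⟩ := exists_path_of_viaGraph hxy hx hy (hr s hx.symm hy.symm)
  have hp := notMem_of_isChain h4 (by simp)
  exact ⟨_, _, pathDisc_subset_of_isChain h4, fun v hv => h3 v (List.mem_toFinset.1 hv),
    ⟨fun h => hp.1 (by simp [List.mem_toFinset.1 h]), fun h => hp.2 (by simp [List.mem_toFinset.1 h])⟩,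
    isDisc_pathDisc hpp h1 h2 hp.1 hp.2⟩

/-- Two robust pairs over the apices `p, p''` and `p'', p'` span a composite disc. -/
theorem Robust.exists_disc_glue [Fintype V] {C : Type*} {χ : V → C} {H : Finset (Finset V)}
    {p p' p'' x y : V} (hnd : [p, p', p'', x, y].Nodup) (hr : Robust χ (linkGraph H p p'') x y)
    (hr' : Robust χ (linkGraph H p'' p') x y) {s s' : C} (hs : s ≠ s')
    (hc : ∀ v ∈ [p, p', p'', x, y], χ v ≠ s ∧ χ v ≠ s') :
    ∃ D I, D ⊆ H ∧ (∀ v ∈ I, χ v = s ∨ χ v = s' ∨ v = p'') ∧ IsDisc D p x p' y I := by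
  have hnd' := hnd
  simp only [List.nodup_cons, List.mem_cons, List.not_mem_nil, or_false, not_or,
    not_false_eq_true, List.nodup_nil, and_true] at hnd'
  obtain ⟨⟨h1, h2, h3, h4⟩, ⟨h5, h6, h7⟩, ⟨h8, h9⟩, h10⟩ := hnd'
  obtain ⟨D, I, hDH, hI, -, hD⟩ := hr.exists_disc h2 h10 (hc x (by simp)).1 (hc y (by simp)).1
  obtain ⟨D', I', hDH', hI', -, hD'⟩ := hr'.exists_disc (Ne.symm h5) h10 (hc x (by simp)).2
    (hc y (by simp)).2
  refine ⟨_, _, Finset.union_subset hDH hDH', ?_, hD.glue hD' ?_ hnd fun v hv => ⟨fun h => ?_, fun h => ?_⟩⟩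
  · intro v hv
    simp only [Finset.mem_insert, Finset.mem_union] at hv
    rcases hv with rfl | hv | hv
    · exact Or.inr (Or.inr rfl)
    · exact Or.inl (hI v hv)
    · exact Or.inr (Or.inl (hI' v hv))
  · exact Finset.disjoint_left.2 fun v hv hv' => hs ((hI v hv).symm.trans (hI' v hv'))
  · exact (hc v hv).1 (hI v h)
  · exact (hc v hv).2 (hI' v h)

end via

/-! ### Lonely leaves and labels in a randomly coloured bipartite graph. -/

section labels

open scoped Classical

variable {V : Type*}

/-- The graph of a set of (leaf, hub) pairs. -/
def bipGraph (Gr : Finset (V × V)) : SimpleGraph V where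
  Adj u v := u ≠ v ∧ ((u, v) ∈ Gr ∨ (v, u) ∈ Gr)
  symm := ⟨fun _ _ h => ⟨h.1.symm, h.2.symm⟩⟩
  loopless := ⟨fun _ h => h.1 rfl⟩

/-- The part of `bipGraph Gr` inside `W` that uses only hubs ranked above `c`. -/
def upGraph (Gr : Finset (V × V)) (rk : V → ℕ) (c : V) (W : V → Prop) : SimpleGraph V where
  Adj u v := u ≠ v ∧ W u ∧ W v ∧ ((u, v) ∈ Gr ∧ rk c < rk v ∨ (v, u) ∈ Gr ∧ rk c < rk u)
  symm := ⟨fun _ _ h => ⟨h.1.symm, h.2.2.1, h.2.1, h.2.2.2.symm⟩⟩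
  loopless := ⟨fun _ h => h.1 rfl⟩

variable {R : ℕ} {Gr : Finset (V × V)} {rk : V → ℕ}

/-- From the leaf `b` no further leaf of `c` of colour `s` is reached above `c` in colour `s`. -/
def Lonely (Gr : Finset (V × V)) (rk : V → ℕ) (χ : V → Fin R) (s : Fin R) (c b : V) : Prop :=
  ∀ x, (x, c) ∈ Gr → x ≠ b → χ x = s →
    ¬ (upGraph Gr rk c fun v => χ v = s ∨ v = b).Reachable b x

/-- The leaf `b` has no neighbour of colour `s` ranked above `c`. -/
def TopLeaf (Gr : Finset (V × V)) (rk : V → ℕ) (χ : V → Fin R) (s : Fin R) (c b : V) : Prop :=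
  ∀ g, (b, g) ∈ Gr → χ g = s → ¬ rk c < rk g

/-- `h` is the lowest hub reached from `b` above `c` in colour `s`. -/
def IsLabel (Gr : Finset (V × V)) (rk : V → ℕ) (χ : V → Fin R) (s : Fin R) (c b h : V) : Prop :=
  ((∃ x, (x, h) ∈ Gr) ∧ rk c < rk h ∧ χ h = s ∧ (upGraph Gr rk c fun v => χ v = s).Reachable b h) ∧
  ∀ g, (∃ x, (x, g) ∈ Gr) → rk c < rk g → χ g = s →
    (upGraph Gr rk c fun v => χ v = s).Reachable b g → rk h ≤ rk g

/-- All labels at the hub `c` in colour `s`. -/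
noncomputable def labels [Fintype V] (Gr : Finset (V × V)) (rk : V → ℕ) (χ : V → Fin R) (s : Fin R)
    (c : V) : Finset V :=
  Finset.univ.filter fun h => ∃ b, (b, c) ∈ Gr ∧ χ b = s ∧ IsLabel Gr rk χ s c b h

/-- Number of leaves of a hub. -/
noncomputable def hubDegree (Gr : Finset (V × V)) (c : V) : ℕ := (Gr.filter fun p => p.2 = c).card

theorem sum_hub [Fintype V] (Gr : Finset (V × V)) (f : V → ℕ) :
    ∑ p ∈ Gr, f p.2 = ∑ c, hubDegree Gr c * f c := by
  rw [← Finset.sum_fiberwise_of_maps_to (s := Gr) (t := Finset.univ) (g := Prod.snd)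
    (fun _ _ => Finset.mem_univ _)]
  refine Finset.sum_congr rfl fun c _ => ?_
  rw [hubDegree, ← smul_eq_mul, ← Finset.sum_const]
  exact Finset.sum_congr rfl fun p hp => by rw [(Finset.mem_filter.1 hp).2]

theorem exists_rank [Fintype V] (d : V → ℕ) :
    ∃ rk : V → ℕ, Function.Injective rk ∧ ∀ c c', d c < d c' → rk c < rk c' := by
  let e := Fintype.equivFin V
  refine ⟨fun c => d c * Fintype.card V + e c, fun c c' h => ?_, fun c c' h => ?_⟩
  · have h1 := congrArg (· % Fintype.card V) h
    simp only [Nat.mul_add_mod_self_right, Nat.mod_eq_of_lt (e _).2] at h1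
    exact e.injective (Fin.ext h1)
  · change d c * Fintype.card V + e c < d c' * Fintype.card V + e c'
    calc d c * Fintype.card V + e c < d c * Fintype.card V + Fintype.card V :=
          Nat.add_lt_add_left (e c).2 _
      _ = (d c + 1) * Fintype.card V := by ring
      _ ≤ d c' * Fintype.card V := Nat.mul_le_mul_right _ h
      _ ≤ _ := Nat.le_add_right _ _

/-- Independence: the colour of v is uniform and f does not depend on it, so restricting to χ v = s
keeps exactly a proportion 1 / R of the sum. -/
theorem sum_resample [Fintype V] (v : V) (s : Fin R) (f : (V → Fin R) → ℕ)
    (hf : ∀ χ t, f (Function.update χ v t) = f χ) :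
    R * ∑ χ, (if χ v = s then f χ else 0) = ∑ χ, f χ := by
  have h1 : ∀ t, ∑ χ, (if χ v = t then f χ else 0) = ∑ χ, (if χ v = s then f χ else 0) := by
    intro t
    have hinv : Function.Involutive
        fun χ : V → Fin R => Function.update χ v (Equiv.swap s t (χ v)) := by
      intro χ
      simp
    refine Fintype.sum_equiv hinv.toPerm _ _ fun χ => ?_
    simp only [Function.Involutive.coe_toPerm, Function.update_self, hf]
    congr 1
    rw [eq_iff_iff, Equiv.swap_apply_eq_iff, Equiv.swap_apply_left]
  calc R * ∑ χ, (if χ v = s then f χ else 0)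
      = ∑ t : Fin R, ∑ χ, (if χ v = t then f χ else 0) := by simp [h1]
    _ = ∑ χ, f χ := by rw [Finset.sum_comm]; simp

/-- The vertex c is isolated in the graph above c: it is not a leaf, and as a hub it does not rank
above itself. So its own colour is irrelevant there, which is why events at the hub c can be
resampled at c. -/
theorem upGraph_congr {c : V} (hc : ∀ v, (c, v) ∉ Gr) {W W' : V → Prop}
    (h : ∀ v, v ≠ c → (W v ↔ W' v)) : upGraph Gr rk c W = upGraph Gr rk c W' := by
  ext u v
  simp only [upGraph]
  by_cases hu : u = c
  · subst hu; simp [hc]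
  by_cases hv : v = c
  · subst hv; simp [hc]
  rw [h u hu, h v hv]

theorem upGraph_mono_rank {c c' : V} (h : rk c ≤ rk c') (W : V → Prop) :
    upGraph Gr rk c' W ≤ upGraph Gr rk c W := fun _ _ hab =>
  ⟨hab.1, hab.2.1, hab.2.2.1, hab.2.2.2.imp (fun h' => ⟨h'.1, h.trans_lt h'.2⟩)
    fun h' => ⟨h'.1, h.trans_lt h'.2⟩⟩

theorem lonely_update_hub (hbip : ∀ p ∈ Gr, ∀ q ∈ Gr, p.1 ≠ q.2) {c b : V} (hbc : (b, c) ∈ Gr)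
    (χ : V → Fin R) (s t : Fin R) :
    Lonely Gr rk (Function.update χ c t) s c b ↔ Lonely Gr rk χ s c b := by
  have hc : ∀ v, (c, v) ∉ Gr := fun v hv => hbip _ hv _ hbc rfl
  have hU : upGraph Gr rk c (fun v => Function.update χ c t v = s ∨ v = b) =
      upGraph Gr rk c (fun v => χ v = s ∨ v = b) := upGraph_congr hc fun v hv => by
    rw [Function.update_of_ne hv]
  unfold Lonely
  rw [hU]
  refine forall_congr' fun b' => forall_congr' fun hb' => ?_
  rw [Function.update_of_ne (hbip _ hb' _ hbc)]

/-- The vertex b is admitted to the search whatever its colour, and is excluded as a target; hence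
loneliness may also be resampled at the leaf. -/
theorem lonely_update_leaf (c b : V) (χ : V → Fin R) (s t : Fin R) :
    Lonely Gr rk (Function.update χ b t) s c b ↔ Lonely Gr rk χ s c b := by
  have hU : (fun v => Function.update χ b t v = s ∨ v = b) = (fun v => χ v = s ∨ v = b) := by
    funext v
    by_cases hv : v = b
    · simp [hv]
    · rw [Function.update_of_ne hv]
  unfold Lonely
  rw [hU]
  refine forall_congr' fun b' => forall_congr' fun _ => forall_congr' fun hne => ?_
  rw [Function.update_of_ne hne]

theorem topLeaf_update_hub (c b : V) (χ : V → Fin R) (s t : Fin R) :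
    TopLeaf Gr rk (Function.update χ c t) s c b ↔ TopLeaf Gr rk χ s c b := by
  refine forall_congr' fun g => forall_congr' fun _ => ?_
  by_cases hg : g = c
  · simp [hg]
  · rw [Function.update_of_ne hg]

theorem topLeaf_update_leaf (hbip : ∀ p ∈ Gr, ∀ q ∈ Gr, p.1 ≠ q.2) (c b : V) (χ : V → Fin R)
    (s t : Fin R) : TopLeaf Gr rk (Function.update χ b t) s c b ↔ TopLeaf Gr rk χ s c b := by
  refine forall_congr' fun g => forall_congr' fun hg => ?_
  rw [Function.update_of_ne (hbip _ hg _ hg).symm]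

theorem isLabel_update_hub (hbip : ∀ p ∈ Gr, ∀ q ∈ Gr, p.1 ≠ q.2) {c b : V} (hbc : (b, c) ∈ Gr)
    (h : V) (χ : V → Fin R) (s t : Fin R) :
    IsLabel Gr rk (Function.update χ c t) s c b h ↔ IsLabel Gr rk χ s c b h := by
  have hc : ∀ v, (c, v) ∉ Gr := fun v hv => hbip _ hv _ hbc rfl
  have hU : upGraph Gr rk c (fun v => Function.update χ c t v = s) =
      upGraph Gr rk c (fun v => χ v = s) := upGraph_congr hc fun v hv => by
    rw [Function.update_of_ne hv]
  have hup : ∀ g, rk c < rk g → Function.update χ c t g = χ g := fun g hg =>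
    Function.update_of_ne (fun h => by simp [h] at hg) _ _
  unfold IsLabel
  rw [hU]
  refine and_congr (and_congr_right fun _ => and_congr_right fun hg => ?_)
    (forall_congr' fun h' => forall_congr' fun _ => forall_congr' fun hg => ?_)
  · rw [hup _ hg]
  · rw [hup _ hg]

theorem labels_update_hub [Fintype V] (hbip : ∀ p ∈ Gr, ∀ q ∈ Gr, p.1 ≠ q.2) (c : V)
    (χ : V → Fin R) (s t : Fin R) :
    labels Gr rk (Function.update χ c t) s c = labels Gr rk χ s c := by
  ext h
  simp only [labels, Finset.mem_filter, Finset.mem_univ, true_and]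
  refine exists_congr fun b => and_congr_right fun hb => ?_
  rw [isLabel_update_hub hbip hb, Function.update_of_ne (hbip _ hb _ hb)]

theorem exists_isLabel [Fintype V] (hbip : ∀ p ∈ Gr, ∀ q ∈ Gr, p.1 ≠ q.2) {χ : V → Fin R}
    {s : Fin R} {c b : V} (hb : χ b = s) (hi : ¬ TopLeaf Gr rk χ s c b) :
    ∃ h, IsLabel Gr rk χ s c b h := by
  simp only [TopLeaf, not_forall, not_not] at hi
  obtain ⟨g, hbg, hg, hrk⟩ := hi
  obtain ⟨h, hh, hmin⟩ := Finset.exists_min_image (Finset.univ.filter fun h =>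
    (∃ x, (x, h) ∈ Gr) ∧ rk c < rk h ∧ χ h = s ∧ (upGraph Gr rk c fun v => χ v = s).Reachable b h)
    rk ⟨g, by
      simp only [Finset.mem_filter, Finset.mem_univ, true_and]
      exact ⟨⟨b, hbg⟩, hrk, hg, SimpleGraph.Adj.reachable
        ⟨hbip _ hbg _ hbg, hb, hg, Or.inl ⟨hbg, hrk⟩⟩⟩⟩
  simp only [Finset.mem_filter, Finset.mem_univ, true_and] at hh hmin
  exact ⟨h, hh, fun h' h1 h2 h3 h4 => hmin h' ⟨h1, h2, h3, h4⟩⟩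

/-- A label determines the hub at which it occurs, among hubs of its colour. -/
theorem hub_eq_of_label (hbip : ∀ p ∈ Gr, ∀ q ∈ Gr, p.1 ≠ q.2) (hrk : Function.Injective rk)
    {χ : V → Fin R} {s : Fin R} {c c' b b' h : V} (hbc' : (b', c') ∈ Gr)
    (hbc : (b, c) ∈ Gr)
    (hc : χ c = s) (hc' : χ c' = s) (hb : χ b = s) (hb' : χ b' = s)
    (h1 : IsLabel Gr rk χ s c b h) (h2 : IsLabel Gr rk χ s c' b' h) : c = c' := by
  by_contra hne
  wlog hlt : rk c < rk c' generalizing c c' b b'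
  · exact this hbc hbc' hc' hc hb' hb h2 h1 (Ne.symm hne)
      (lt_of_le_of_ne (not_lt.1 hlt) fun h => hne (hrk h.symm))
  -- With c below c', everything reached above c' is reached above c. So b reaches h, then b', then
  -- the hub c' itself, and c' ranks below h; this contradicts that h is the lowest hub reached from
  -- b.
  have hreach : (upGraph Gr rk c fun v => χ v = s).Reachable b c' := by
    refine h1.1.2.2.2.trans (SimpleGraph.Reachable.trans
      (h2.1.2.2.2.mono (upGraph_mono_rank hlt.le _)).symm (SimpleGraph.Adj.reachable ?_))
    exact ⟨hbip _ hbc' _ hbc', hb', hc', Or.inl ⟨hbc', hlt⟩⟩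
  exact absurd (h1.2 c' ⟨b', hbc'⟩ hlt hc' hreach) (not_le.2 h2.1.2.1)

/-- Charge each label to the vertex h it names. Among hubs of colour s only one has the label h, and
its degree is at most that of h because h ranks higher and the ranking respects degrees. -/
theorem sum_labels_le [Fintype V] (hbip : ∀ p ∈ Gr, ∀ q ∈ Gr, p.1 ≠ q.2)
    (hrk : Function.Injective rk)
    (hd : ∀ c c', hubDegree Gr c < hubDegree Gr c' → rk c < rk c') (χ : V → Fin R) (s : Fin R) :
    ∑ c, (if χ c = s then hubDegree Gr c * (labels Gr rk χ s c).card else 0) ≤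
      ∑ h, (if χ h = s then hubDegree Gr h else 0) := by
  have h1 : ∀ c, (if χ c = s then hubDegree Gr c * (labels Gr rk χ s c).card else 0) =
      ∑ h, (if χ c = s ∧ h ∈ labels Gr rk χ s c then hubDegree Gr c else 0) := by
    intro c
    by_cases hc : χ c = s
    · simp [hc, mul_comm]
    · simp [hc]
  simp only [h1]
  rw [Finset.sum_comm]
  refine Finset.sum_le_sum fun h _ => ?_
  by_cases hex : ∃ c, χ c = s ∧ h ∈ labels Gr rk χ s c
  · obtain ⟨c, hc, hh⟩ := hex
    have hh' := hh
    simp only [labels, Finset.mem_filter, Finset.mem_univ, true_and] at hh'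
    obtain ⟨b, hbc, hb, hl⟩ := hh'
    rw [Finset.sum_eq_single c, if_pos ⟨hc, hh⟩, if_pos hl.1.2.2.1]
    · by_contra hlt
      exact absurd (hd h c (not_le.1 hlt)) (not_lt.2 hl.1.2.1.le)
    · intro c' _ hne
      rw [if_neg]
      rintro ⟨hc', hh'⟩
      simp only [labels, Finset.mem_filter, Finset.mem_univ, true_and] at hh'
      obtain ⟨b', hbc', hb', hl'⟩ := hh'
      exact hne (hub_eq_of_label hbip hrk hbc hbc' hc' hc hb' hb hl' hl)
    · simp
  · rw [Finset.sum_eq_zero fun c _ => if_neg fun h' => hex ⟨c, h'⟩]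
    exact Nat.zero_le _

/-- The labels at c do not depend on the colour of c, so requiring χ c = s costs a factor R. The
charging of `sum_labels_le` leads to vertices h of colour s, and averaging over χ h regains that
factor. On average a pair thus sees at most one label at its hub in each colour. -/
theorem sum_sum_labels_le [Fintype V] (hbip : ∀ p ∈ Gr, ∀ q ∈ Gr, p.1 ≠ q.2)
    (hrk : Function.Injective rk)
    (hd : ∀ c c', hubDegree Gr c < hubDegree Gr c' → rk c < rk c') (s : Fin R) :
    ∑ χ, ∑ p ∈ Gr, (labels Gr rk χ s p.2).card ≤ Fintype.card (V → Fin R) * Gr.card := by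
  calc ∑ χ, ∑ p ∈ Gr, (labels Gr rk χ s p.2).card
      = ∑ c, ∑ χ, hubDegree Gr c * (labels Gr rk χ s c).card := by
        rw [Finset.sum_comm (s := Finset.univ) (t := Finset.univ)]
        exact Finset.sum_congr rfl fun χ _ => sum_hub Gr fun c => (labels Gr rk χ s c).card
    _ = ∑ c, R * ∑ χ, (if χ c = s then hubDegree Gr c * (labels Gr rk χ s c).card else 0) := by
        refine Finset.sum_congr rfl fun c _ => (sum_resample c s _ fun χ t => ?_).symm
        rw [labels_update_hub hbip]
    _ = R * ∑ χ, ∑ c, (if χ c = s then hubDegree Gr c * (labels Gr rk χ s c).card else 0) := by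
        rw [← Finset.mul_sum, Finset.sum_comm]
    _ ≤ R * ∑ χ : V → Fin R, ∑ h, (if χ h = s then hubDegree Gr h else 0) :=
        Nat.mul_le_mul_left _ (Finset.sum_le_sum fun χ _ => sum_labels_le hbip hrk hd χ s)
    _ = ∑ h, R * ∑ χ : V → Fin R, (if χ h = s then hubDegree Gr h else 0) := by
        rw [← Finset.mul_sum, Finset.sum_comm]
    _ = ∑ h, ∑ χ : V → Fin R, hubDegree Gr h :=
        Finset.sum_congr rfl fun h _ => sum_resample h s _ fun _ _ => rfl
    _ = Fintype.card (V → Fin R) * Gr.card := by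
        have := sum_hub Gr fun _ => 1
        simp only [Finset.sum_const, smul_eq_mul, mul_one, Finset.card_univ] at this ⊢
        rw [← Finset.mul_sum, this]

/-- Send such a pair to its label. The label determines the hub, and two leaves of that hub with a
common label would reach each other above it, so neither would be lonely. -/
theorem card_lonely_le [Fintype V] (hbip : ∀ p ∈ Gr, ∀ q ∈ Gr, p.1 ≠ q.2)
    (hrk : Function.Injective rk) (χ : V → Fin R) (s : Fin R) :
    (Gr.filter fun p => χ p.2 = s ∧ χ p.1 = s ∧ Lonely Gr rk χ s p.2 p.1 ∧
      ¬ TopLeaf Gr rk χ s p.2 p.1).card ≤ Fintype.card V := by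
  have hlab : ∀ p : V × V, ∃ h, (χ p.1 = s ∧ ¬ TopLeaf Gr rk χ s p.2 p.1) →
      IsLabel Gr rk χ s p.2 p.1 h := by
    intro p
    by_cases hp : χ p.1 = s ∧ ¬ TopLeaf Gr rk χ s p.2 p.1
    · obtain ⟨h, hh⟩ := exists_isLabel hbip hp.1 hp.2
      exact ⟨h, fun _ => hh⟩
    · exact ⟨p.1, fun h => absurd h hp⟩
  choose f hf using hlab
  refine Finset.card_le_card_of_injOn f (fun _ _ => Finset.mem_univ _) ?_
  rintro ⟨b, c⟩ hp ⟨b', c'⟩ hp' heq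
  simp only [Finset.coe_filter, Set.mem_ofPred_eq] at hp hp'
  obtain ⟨hbc, hc, hb, hl, ht⟩ := hp
  obtain ⟨hbc', hc', hb', hl', ht'⟩ := hp'
  have e1 := hf (b, c) ⟨hb, ht⟩
  have e2 := hf (b', c') ⟨hb', ht'⟩
  rw [← heq] at e2
  obtain rfl : c = c' := hub_eq_of_label hbip hrk hbc' hbc hc hc' hb hb' e1 e2
  by_contra hne
  have hbb : b' ≠ b := fun h => hne (by rw [h])
  refine hl b' hbc' hbb hb' ?_
  refine (e1.1.2.2.2.trans e2.1.2.2.2.symm).mono ?_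
  exact fun u v h => ⟨h.1, Or.inl h.2.1, Or.inl h.2.2.1, h.2.2.2⟩

/-- For each leaf b, at most one such hub exists, namely its highest neighbour of colour s. -/
theorem card_topLeaf_le [Fintype V] (hrk : Function.Injective rk) (χ : V → Fin R) (s : Fin R) :
    (Gr.filter fun p => χ p.2 = s ∧ TopLeaf Gr rk χ s p.2 p.1).card ≤ Fintype.card V := by
  refine Finset.card_le_card_of_injOn Prod.fst (fun _ _ => Finset.mem_univ _) ?_
  rintro ⟨b, c⟩ hp ⟨b', c'⟩ hp' (rfl : b = b')
  simp only [Finset.coe_filter, Set.mem_ofPred_eq] at hp hp'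
  have := hrk (le_antisymm (not_lt.1 (hp'.2.2 c hp.1 hp.2.1)) (not_lt.1 (hp.2.2 c' hp'.1 hp'.2.1)))
  rw [this]

/-- Lonely pairs that are not top leaves are counted after resampling both ends to colour s, which
costs R²; for top leaves only the hub is resampled, which costs R. -/
theorem sum_card_lonely_le [Fintype V] (hbip : ∀ p ∈ Gr, ∀ q ∈ Gr, p.1 ≠ q.2)
    (hrk : Function.Injective rk) (s : Fin R) :
    ∑ χ, (Gr.filter fun p => Lonely Gr rk χ s p.2 p.1).card ≤
      Fintype.card (V → Fin R) * ((R * R + R) * Fintype.card V) := by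
  have h1 : ∀ χ : V → Fin R, (Gr.filter fun p => Lonely Gr rk χ s p.2 p.1).card ≤
      (∑ p ∈ Gr, if Lonely Gr rk χ s p.2 p.1 ∧ ¬ TopLeaf Gr rk χ s p.2 p.1 then 1 else 0) +
      ∑ p ∈ Gr, if TopLeaf Gr rk χ s p.2 p.1 then 1 else 0 := by
    intro χ
    rw [Finset.card_filter, ← Finset.sum_add_distrib]
    refine Finset.sum_le_sum fun p _ => ?_
    by_cases hl : Lonely Gr rk χ s p.2 p.1 <;> by_cases ht : TopLeaf Gr rk χ s p.2 p.1 <;>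
      simp [hl, ht]
  have h2 : ∑ χ : V → Fin R, ∑ p ∈ Gr,
      (if Lonely Gr rk χ s p.2 p.1 ∧ ¬ TopLeaf Gr rk χ s p.2 p.1 then 1 else 0) ≤
      Fintype.card (V → Fin R) * (R * R * Fintype.card V) := by
    calc _ = ∑ p ∈ Gr, ∑ χ : V → Fin R,
          (if Lonely Gr rk χ s p.2 p.1 ∧ ¬ TopLeaf Gr rk χ s p.2 p.1 then 1 else 0) :=
          Finset.sum_comm
      _ = ∑ p ∈ Gr, R * (R * ∑ χ : V → Fin R, (if χ p.2 = s then if χ p.1 = s then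
          (if Lonely Gr rk χ s p.2 p.1 ∧ ¬ TopLeaf Gr rk χ s p.2 p.1 then 1 else 0) else 0 else 0)) := by
          refine Finset.sum_congr rfl fun p hp => ?_
          rw [sum_resample p.2 s, sum_resample p.1 s]
          · intro χ t
            rw [lonely_update_leaf, topLeaf_update_leaf hbip]
          · intro χ t
            rw [lonely_update_hub hbip hp, topLeaf_update_hub,
              Function.update_of_ne (hbip p hp p hp)]
      _ = R * R * ∑ χ : V → Fin R, ∑ p ∈ Gr, (if χ p.2 = s then if χ p.1 = s then
          (if Lonely Gr rk χ s p.2 p.1 ∧ ¬ TopLeaf Gr rk χ s p.2 p.1 then 1 else 0) else 0 else 0) := by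
          rw [Finset.sum_comm, Finset.mul_sum]
          simp only [mul_assoc]
      _ ≤ R * R * ∑ χ : V → Fin R, Fintype.card V := by
          refine Nat.mul_le_mul_left _ (Finset.sum_le_sum fun χ _ => ?_)
          refine le_trans (le_of_eq ?_) (card_lonely_le hbip hrk χ s)
          rw [Finset.card_filter]
          refine Finset.sum_congr rfl fun p _ => ?_
          simp only [ite_and]
      _ = _ := by rw [Finset.sum_const, Finset.card_univ, smul_eq_mul]; ring
  have h3 : ∑ χ : V → Fin R, ∑ p ∈ Gr, (if TopLeaf Gr rk χ s p.2 p.1 then 1 else 0) ≤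
      Fintype.card (V → Fin R) * (R * Fintype.card V) := by
    calc _ = ∑ p ∈ Gr, ∑ χ : V → Fin R, (if TopLeaf Gr rk χ s p.2 p.1 then 1 else 0) :=
          Finset.sum_comm
      _ = ∑ p ∈ Gr, R * ∑ χ : V → Fin R, (if χ p.2 = s then
          (if TopLeaf Gr rk χ s p.2 p.1 then 1 else 0) else 0) := by
          refine Finset.sum_congr rfl fun p hp => ?_
          rw [sum_resample p.2 s]
          intro χ t
          rw [topLeaf_update_hub]
      _ = R * ∑ χ : V → Fin R, ∑ p ∈ Gr, (if χ p.2 = s then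
          (if TopLeaf Gr rk χ s p.2 p.1 then 1 else 0) else 0) := by
          rw [Finset.sum_comm, Finset.mul_sum]
      _ ≤ R * ∑ χ : V → Fin R, Fintype.card V := by
          refine Nat.mul_le_mul_left _ (Finset.sum_le_sum fun χ _ => ?_)
          refine le_trans (le_of_eq ?_) (card_topLeaf_le (Gr := Gr) hrk χ s)
          rw [Finset.card_filter]
          refine Finset.sum_congr rfl fun p _ => ?_
          simp only [ite_and]
      _ = _ := by rw [Finset.sum_const, Finset.card_univ, smul_eq_mul]; ring
  refine (Finset.sum_le_sum fun χ _ => h1 χ).trans ?_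
  rw [Finset.sum_add_distrib]
  exact (add_le_add h2 h3).trans (le_of_eq (by ring))

end labels

/-! ### Large classes of mutually robust pairs. -/

section core

open scoped Classical

variable {V : Type*} {R : ℕ} {Gr : Finset (V × V)} {rk : V → ℕ}

/-- `h` is a label seen from the leaf `b` through colour `s`. -/
def SeesLabel (Gr : Finset (V × V)) (rk : V → ℕ) (χ : V → Fin R) (s : Fin R) (c b h : V) : Prop :=
  ∃ b', (b', c) ∈ Gr ∧ χ b' = s ∧
    (upGraph Gr rk c fun v => χ v = s ∨ v = b).Reachable b b' ∧ IsLabel Gr rk χ s c b' h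

/-- A witness b' against loneliness is not a top leaf: the first step of the walk from b' back to b
leads to a hub of colour s above c. So b' has a label, and b sees it. -/
theorem exists_seesLabel [Fintype V] (hbip : ∀ p ∈ Gr, ∀ q ∈ Gr, p.1 ≠ q.2) {χ : V → Fin R}
    {s : Fin R} {c b : V} (hbc : (b, c) ∈ Gr) (hl : ¬ Lonely Gr rk χ s c b) :
    ∃ h, SeesLabel Gr rk χ s c b h := by
  simp only [Lonely, not_forall, not_not] at hl
  obtain ⟨b', hb'c, hne, hs, hr⟩ := hl
  obtain ⟨h, hh⟩ := exists_isLabel (c := c) (rk := rk) hbip hs fun ht => by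
    obtain ⟨w⟩ := hr.symm
    cases w with
    | nil => exact hne rfl
    | @cons _ g _ hadj _ =>
      obtain ⟨-, -, hg, hg' | hg'⟩ := hadj
      · rcases hg with hg | rfl
        · exact ht g hg'.1 hg hg'.2
        · exact hbip _ hbc _ hg'.1 rfl
      · exact hbip _ hb'c _ hg'.1 rfl
  exact ⟨h, b', hb'c, hs, hr, hh⟩

/-- The label seen through colour `s`, if any. -/
noncomputable def seenLabel (Gr : Finset (V × V)) (rk : V → ℕ) (χ : V → Fin R) (s : Fin R)
    (c b : V) : Option V :=
  if h : ∃ g, SeesLabel Gr rk χ s c b g then some h.choose else none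

theorem seesLabel_of_seenLabel {χ : V → Fin R} {s : Fin R} {c b h : V}
    (hs : seenLabel Gr rk χ s c b = some h) : SeesLabel Gr rk χ s c b h := by
  unfold seenLabel at hs
  split_ifs at hs with hex
  rw [← Option.some.inj hs]
  exact hex.choose_spec

/-- The hub, the colour of the leaf, and the labels seen from the leaf. -/
noncomputable def edgeKey (Gr : Finset (V × V)) (rk : V → ℕ) (χ : V → Fin R) (p : V × V) :
    V × Fin R × (Fin R → Option V) :=
  (p.2, χ p.1, fun s => seenLabel Gr rk χ s p.2 p.1)

/-- The pair is not lonely in any colour and its hub has few labels. -/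
def IsFine [Fintype V] (Gr : Finset (V × V)) (rk : V → ℕ) (κ : ℕ) (χ : V → Fin R) (p : V × V) :
    Prop :=
  (∀ s, ¬ Lonely Gr rk χ s p.2 p.1) ∧ ∀ s, (labels Gr rk χ s p.2).card ≤ κ

/-- In each colour, failure of loneliness takes the leaf to another leaf of the same hub of that
colour, from which one step leads to the hub. -/
theorem IsFine.robust [Fintype V] (hbip : ∀ p ∈ Gr, ∀ q ∈ Gr, p.1 ≠ q.2) {κ : ℕ} {χ : V → Fin R}
    {p : V × V} (hf : IsFine Gr rk κ χ p) : Robust χ (bipGraph Gr) p.1 p.2 := by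
  intro s _ _
  have := hf.1 s
  simp only [Lonely, not_forall, not_not] at this
  obtain ⟨b', hb'c, hne, hb', hr⟩ := this
  refine (hr.mono fun u v h => ?_).trans (SimpleGraph.Adj.reachable ?_)
  · exact ⟨⟨h.1, h.2.2.2.imp (fun h => h.1) fun h => h.1⟩, by have := h.2.1; tauto,
      by have := h.2.2.1; tauto, by
        have h1 := h.2.1
        have h2 := h.2.2.1
        by_contra hc
        rw [not_or] at hc
        exact h.1 ((h1.resolve_left hc.1).trans (h2.resolve_left hc.2).symm)⟩
  · exact ⟨⟨hbip (b', p.2) hb'c (b', p.2) hb'c, Or.inl hb'c⟩, Or.inl hb', Or.inr (Or.inr rfl), Or.inl hb'⟩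

/-- In every colour s both leaves see the same label, that is, both reach the same hub through
colour s. -/
theorem IsFine.robust_of_key [Fintype V] (hbip : ∀ p ∈ Gr, ∀ q ∈ Gr, p.1 ≠ q.2) {κ : ℕ}
    {χ : V → Fin R} {p q : V × V} (hp : p ∈ Gr) (hfp : IsFine Gr rk κ χ p)
    (hk : edgeKey Gr rk χ p = edgeKey Gr rk χ q) :
    Robust χ (bipGraph Gr) p.1 q.1 := by
  obtain ⟨b, c⟩ := p
  obtain ⟨b', c'⟩ := q
  simp only [edgeKey, Prod.mk.injEq] at hk
  obtain ⟨rfl, -, hk⟩ := hk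
  intro s _ _
  obtain ⟨h, hh⟩ : ∃ h, seenLabel Gr rk χ s c b = some h := by
    unfold seenLabel
    rw [dif_pos (exists_seesLabel hbip hp (hfp.1 s))]
    exact ⟨_, rfl⟩
  have hh' := (congrFun hk s).symm.trans hh
  obtain ⟨b₁, -, -, hr1, hl1⟩ := seesLabel_of_seenLabel hh
  obtain ⟨b₂, -, -, hr2, hl2⟩ := seesLabel_of_seenLabel hh'
  have hle : ∀ z, z = b ∨ z = b' → upGraph Gr rk c (fun v => χ v = s ∨ v = z) ≤
      viaGraph (bipGraph Gr) (fun v => χ v = s) b b' := by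
    intro z hz u v h
    refine ⟨⟨h.1, h.2.2.2.imp (fun h => h.1) fun h => h.1⟩, ?_, ?_, ?_⟩
    · rcases h.2.1 with h | rfl
      · exact Or.inl h
      · exact Or.inr hz
    · rcases h.2.2.1 with h | rfl
      · exact Or.inl h
      · exact Or.inr hz
    · by_contra hc
      rw [not_or] at hc
      exact h.1 ((h.2.1.resolve_left hc.1).trans (h.2.2.1.resolve_left hc.2).symm)
  have hle' : upGraph Gr rk c (fun v => χ v = s) ≤
      viaGraph (bipGraph Gr) (fun v => χ v = s) b b' := fun u v h =>
    ⟨⟨h.1, h.2.2.2.imp (fun h => h.1) fun h => h.1⟩, Or.inl h.2.1, Or.inl h.2.2.1, Or.inl h.2.1⟩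
  exact (hr1.mono (hle b (Or.inl rfl))).trans ((hl1.1.2.2.2.mono hle').trans
    ((hl2.1.2.2.2.mono hle').symm.trans (hr2.mono (hle b' (Or.inr rfl))).symm))

/-- Markov's inequality: a pair that is not fine is lonely in some colour or has more than κ labels
in some colour. The averages of the two quantities over all colourings are already known. -/
theorem sum_card_not_fine_le [Fintype V] (hbip : ∀ p ∈ Gr, ∀ q ∈ Gr, p.1 ≠ q.2)
    (hrk : Function.Injective rk)
    (hd : ∀ c c', hubDegree Gr c < hubDegree Gr c' → rk c < rk c') (κ : ℕ) :
    κ * ∑ χ : V → Fin R, (Gr.filter fun p => ¬ IsFine Gr rk κ χ p).card ≤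
      Fintype.card (V → Fin R) * (κ * (R * (R * R + R) * Fintype.card V) + R * Gr.card) := by
  have h1 : ∀ χ : V → Fin R, κ * (Gr.filter fun p => ¬ IsFine Gr rk κ χ p).card ≤
      ∑ s, (κ * (Gr.filter fun p => Lonely Gr rk χ s p.2 p.1).card +
        ∑ p ∈ Gr, (labels Gr rk χ s p.2).card) := by
    intro χ
    simp only [Finset.card_filter, Finset.mul_sum, ← Finset.sum_add_distrib]
    rw [Finset.sum_comm]
    refine Finset.sum_le_sum fun p _ => ?_
    by_cases hf : IsFine Gr rk κ χ p
    · simp [hf]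
    · simp only [hf, not_false_eq_true, if_true, mul_one]
      simp only [IsFine, not_and_or, not_forall, not_not, not_le] at hf
      rcases hf with ⟨s, hs⟩ | ⟨s, hs⟩
      · refine le_trans ?_ (Finset.single_le_sum (f := fun s =>
          κ * (if Lonely Gr rk χ s p.2 p.1 then 1 else 0) + (labels Gr rk χ s p.2).card)
          (fun _ _ => Nat.zero_le _) (Finset.mem_univ s))
        simp [hs]
      · refine le_trans ?_ (Finset.single_le_sum (f := fun s =>
          κ * (if Lonely Gr rk χ s p.2 p.1 then 1 else 0) + (labels Gr rk χ s p.2).card)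
          (fun _ _ => Nat.zero_le _) (Finset.mem_univ s))
        exact hs.le.trans (Nat.le_add_left _ _)
  calc _ ≤ ∑ χ : V → Fin R, ∑ s, (κ * (Gr.filter fun p => Lonely Gr rk χ s p.2 p.1).card +
        ∑ p ∈ Gr, (labels Gr rk χ s p.2).card) := by
        rw [Finset.mul_sum]; exact Finset.sum_le_sum fun χ _ => h1 χ
    _ = ∑ s : Fin R, (κ * ∑ χ : V → Fin R, (Gr.filter fun p => Lonely Gr rk χ s p.2 p.1).card +
        ∑ χ : V → Fin R, ∑ p ∈ Gr, (labels Gr rk χ s p.2).card) := by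
        rw [Finset.sum_comm]
        refine Finset.sum_congr rfl fun s _ => ?_
        rw [Finset.sum_add_distrib, Finset.mul_sum]
    _ ≤ ∑ s : Fin R, (κ * (Fintype.card (V → Fin R) * ((R * R + R) * Fintype.card V)) +
        Fintype.card (V → Fin R) * Gr.card) :=
        Finset.sum_le_sum fun s _ => add_le_add
          (Nat.mul_le_mul_left _ (sum_card_lonely_le hbip hrk s)) (sum_sum_labels_le hbip hrk hd s)
    _ = _ := by
        rw [Finset.sum_const, Finset.card_univ, Fintype.card_fin, smul_eq_mul]; ring

/-- The fine pairs of the same key. -/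
noncomputable def fineClass [Fintype V] (Gr : Finset (V × V)) (rk : V → ℕ) (κ : ℕ) (χ : V → Fin R)
    (p : V × V) : Finset (V × V) :=
  Gr.filter fun q => IsFine Gr rk κ χ q ∧ edgeKey Gr rk χ q = edgeKey Gr rk χ p

/-- For a hub with at most κ labels in each colour there are at most R (κ + 1)^R keys, and each key
of a small class accounts for fewer than t pairs. -/
theorem card_small_le [Fintype V] (κ t : ℕ) (χ : V → Fin R) :
    (Gr.filter fun p => IsFine Gr rk κ χ p ∧ (fineClass Gr rk κ χ p).card < t).card ≤
      t * (Fintype.card V * (R * (κ + 1) ^ R)) := by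
  set S := Gr.filter fun p => IsFine Gr rk κ χ p ∧ (fineClass Gr rk κ χ p).card < t with hS
  refine (Finset.card_le_mul_card_image (f := edgeKey Gr rk χ) S t fun a ha => ?_).trans
    (Nat.mul_le_mul_left _ ?_)
  · obtain ⟨p, hp, rfl⟩ := Finset.mem_image.1 ha
    simp only [hS, Finset.mem_filter] at hp
    refine (Finset.card_le_card ?_).trans hp.2.2.le
    intro q hq
    simp only [hS, Finset.mem_filter] at hq
    exact Finset.mem_filter.2 ⟨hq.1.1, hq.1.2.1, hq.2⟩
  · set K : V → Finset (V × Fin R × (Fin R → Option V)) := fun c =>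
      if ∀ s, (labels Gr rk χ s c).card ≤ κ then
        {c} ×ˢ (Finset.univ ×ˢ Fintype.piFinset fun s => insert none ((labels Gr rk χ s c).image some))
      else ∅ with hK
    have hsub : S.image (edgeKey Gr rk χ) ⊆ Finset.univ.biUnion K := by
      intro a ha
      obtain ⟨p, hp, rfl⟩ := Finset.mem_image.1 ha
      simp only [hS, Finset.mem_filter] at hp
      refine Finset.mem_biUnion.2 ⟨p.2, Finset.mem_univ _, ?_⟩
      rw [hK]
      simp only [hp.2.1.2, implies_true, if_true, edgeKey, Finset.mem_product, Finset.mem_singleton,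
        Finset.mem_univ, true_and, Fintype.mem_piFinset]
      intro s
      cases hs : seenLabel Gr rk χ s p.2 p.1 with
      | none => exact Finset.mem_insert_self _ _
      | some h =>
        obtain ⟨b', h1, h2, -, h3⟩ := seesLabel_of_seenLabel hs
        refine Finset.mem_insert_of_mem (Finset.mem_image_of_mem _ ?_)
        exact Finset.mem_filter.2 ⟨Finset.mem_univ _, b', h1, h2, h3⟩
    refine (Finset.card_le_card hsub).trans (Finset.card_biUnion_le.trans ?_)
    rw [← smul_eq_mul, ← Finset.card_univ]
    refine Finset.sum_le_card_nsmul _ _ _ fun c _ => ?_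
    rw [hK]
    dsimp only
    split_ifs with hc
    · rw [Finset.card_product, Finset.card_singleton, one_mul, Finset.card_product, Finset.card_univ,
        Fintype.card_fin, Fintype.card_piFinset]
      refine Nat.mul_le_mul_left _ ?_
      refine (Finset.prod_le_pow_card _ _ (κ + 1) fun s _ => ?_).trans (by simp)
      exact (Finset.card_insert_le _ _).trans
        (Nat.add_le_add_right (Finset.card_image_le.trans (hc s)) 1)
    · simp

/-- On average over the colourings, all but few of the pairs split into large classes whose members
are robustly joined to each other and to their common hub. -/
theorem exists_core [Fintype V] (hbip : ∀ p ∈ Gr, ∀ q ∈ Gr, p.1 ≠ q.2) (R κ t : ℕ) :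
    ∃ (core : (V → Fin R) → Finset (V × V))
      (key : (V → Fin R) → V × V → V × Fin R × (Fin R → Option V)),
      (∀ χ, core χ ⊆ Gr) ∧
      (∀ χ, ∀ p ∈ core χ, Robust χ (bipGraph Gr) p.1 p.2) ∧
      (∀ χ, ∀ p ∈ core χ, ∀ q ∈ core χ, key χ p = key χ q →
        p.2 = q.2 ∧ Robust χ (bipGraph Gr) p.1 q.1) ∧
      (∀ χ, ∀ p ∈ core χ, t ≤ ((core χ).filter fun q => key χ q = key χ p).card) ∧
      κ * ∑ χ, (Gr \ core χ).card ≤ Fintype.card (V → Fin R) *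
        (κ * (R * (R * R + R) + t * (R * (κ + 1) ^ R)) * Fintype.card V + R * Gr.card) := by
  obtain ⟨rk, hrk, hd⟩ := exists_rank (hubDegree Gr)
  refine ⟨fun χ => Gr.filter fun p => IsFine Gr rk κ χ p ∧ t ≤ (fineClass Gr rk κ χ p).card,
    fun χ => edgeKey Gr rk χ, fun χ => Finset.filter_subset _ _, fun χ p hp => ?_,
    fun χ p hp q hq hk => ⟨congrArg Prod.fst hk, ?_⟩, fun χ p hp => ?_, ?_⟩
  · exact (Finset.mem_filter.1 hp).2.1.robust hbip
  · rw [Finset.mem_filter] at hp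
    exact hp.2.1.robust_of_key hbip hp.1 hk
  · rw [Finset.mem_filter] at hp
    refine hp.2.2.trans (Finset.card_le_card fun q hq => ?_)
    have hq' := hq
    rw [fineClass, Finset.mem_filter] at hq'
    have : fineClass Gr rk κ χ q = fineClass Gr rk κ χ p := by
      unfold fineClass; rw [hq'.2.2]
    exact Finset.mem_filter.2 ⟨Finset.mem_filter.2 ⟨hq'.1, hq'.2.1, this ▸ hp.2.2⟩, hq'.2.2⟩
  · have h1 : ∀ χ : V → Fin R, (Gr \ Gr.filter fun p => IsFine Gr rk κ χ p ∧
        t ≤ (fineClass Gr rk κ χ p).card).card ≤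
        (Gr.filter fun p => ¬ IsFine Gr rk κ χ p).card + t * (Fintype.card V * (R * (κ + 1) ^ R)) := by
      intro χ
      refine le_trans (Finset.card_le_card ?_) ((Finset.card_union_le _ _).trans
        (Nat.add_le_add_left (card_small_le (Gr := Gr) (rk := rk) κ t χ) _))
      intro p hp
      simp only [Finset.mem_sdiff, Finset.mem_filter, Finset.mem_union, not_and, not_le] at hp ⊢
      tauto
    calc _ ≤ κ * ∑ χ : V → Fin R, ((Gr.filter fun p => ¬ IsFine Gr rk κ χ p).card +
          t * (Fintype.card V * (R * (κ + 1) ^ R))) :=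
          Nat.mul_le_mul_left _ (Finset.sum_le_sum fun χ _ => h1 χ)
      _ = κ * ∑ χ : V → Fin R, (Gr.filter fun p => ¬ IsFine Gr rk κ χ p).card +
          κ * (Fintype.card (V → Fin R) * (t * (Fintype.card V * (R * (κ + 1) ^ R)))) := by
          rw [Finset.sum_add_distrib, mul_add, Finset.sum_const, Finset.card_univ, smul_eq_mul]
      _ ≤ _ := Nat.add_le_add_right (sum_card_not_fine_le hbip hrk hd κ) _
      _ = _ := by ring

end core

/-! ### Weighted walks and matrix products. -/

section walks

variable {E : Type*} [Fintype E] [DecidableEq E]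

/-- The product `F 0 * F 1 * ⋯ * F (n - 1)`. -/
def matProd (F : ℕ → Matrix E E ℝ) : ℕ → Matrix E E ℝ
  | 0 => 1
  | n + 1 => matProd F n * F n

theorem matProd_const {F : ℕ → Matrix E E ℝ} {M : Matrix E E ℝ} {a b : ℕ} (hab : a ≤ b)
    (h : ∀ n, a ≤ n → n < b → F n = M) : matProd F b = matProd F a * M ^ (b - a) := by
  induction b, hab using Nat.le_induction with
  | base => simp
  | succ b hab ih =>
    rw [matProd, ih fun n h1 h2 => h n h1 (h2.trans (Nat.lt_succ_self b)), h b hab (Nat.lt_succ_self b),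
      mul_assoc, ← pow_succ, Nat.succ_sub hab]

/-- A product of copies of `M` with two exceptional factors. -/
theorem matProd_two {M A B : Matrix E E ℝ} {k i j : ℕ} (hij : i < j) (hjk : j < k) :
    matProd (fun n => if n = i then A else if n = j then B else M) k =
      M ^ i * A * M ^ (j - i - 1) * B * M ^ (k - j - 1) := by
  set F : ℕ → Matrix E E ℝ := fun n => if n = i then A else if n = j then B else M with hF
  have h1 : matProd F i = M ^ i := by
    rw [matProd_const (Nat.zero_le i) (M := M) fun n _ h2 => ?_]
    · simp [matProd]
    · simp only [hF]; rw [if_neg (by omega), if_neg (by omega)]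
  have h2 : matProd F (i + 1) = M ^ i * A := by
    rw [matProd, h1]; simp [hF]
  have h3 : matProd F j = M ^ i * A * M ^ (j - i - 1) := by
    rw [matProd_const (show i + 1 ≤ j from hij) (M := M) fun n _ h2 => ?_, h2, Nat.sub_sub]
    simp only [hF]; rw [if_neg (by omega), if_neg (by omega)]
  have h4 : matProd F (j + 1) = M ^ i * A * M ^ (j - i - 1) * B := by
    rw [matProd, h3]; simp only [hF]; rw [if_neg (by omega), if_pos trivial]
  rw [matProd_const (show j + 1 ≤ k from hjk) (M := M) fun n _ h2 => ?_, h4, ← Nat.sub_sub k j 1]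
  simp only [hF]; rw [if_neg (by omega), if_neg (by omega)]

/-- The weight g on the two ends is there for the induction, which absorbs the last step into g;
afterwards it serves to close the walk. -/
theorem sum_open_walks (F : ℕ → Matrix E E ℝ) (n : ℕ) (g : E → E → ℝ) :
    ∑ x : Fin (n + 1) → E, g (x 0) (x (Fin.last n)) * ∏ i : Fin n, F i (x i.castSucc) (x i.succ) =
      ∑ a, ∑ b, g a b * matProd F n a b := by
  induction n generalizing g with
  | zero =>
    simp only [matProd, Matrix.one_apply, mul_ite, mul_one, mul_zero, Finset.sum_ite_eq,
      Finset.mem_univ, if_true, Finset.univ_eq_empty, Finset.prod_empty]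
    exact Fintype.sum_equiv (Equiv.funUnique (Fin 1) E) _ _ fun x => rfl
  | succ n ih =>
    have h1 : ∀ x : Fin (n + 1) → E, ∀ y : E,
        g ((Fin.snoc x y : Fin (n + 2) → E) 0) ((Fin.snoc x y : Fin (n + 2) → E) (Fin.last (n + 1))) *
          ∏ i : Fin (n + 1), F i ((Fin.snoc x y : Fin (n + 2) → E) i.castSucc)
            ((Fin.snoc x y : Fin (n + 2) → E) i.succ) =
        g (x 0) y * (∏ i : Fin n, F i (x i.castSucc) (x i.succ)) * F n (x (Fin.last n)) y := by
      intro x y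
      rw [Fin.prod_univ_castSucc]
      have e0 : (Fin.snoc x y : Fin (n + 2) → E) 0 = x 0 := by
        rw [← Fin.castSucc_zero, Fin.snoc_castSucc]
      have e1 : ∀ i : Fin n, (Fin.snoc x y : Fin (n + 2) → E) i.castSucc.succ = x i.succ := by
        intro i
        rw [Fin.succ_castSucc, Fin.snoc_castSucc]
      simp only [Fin.snoc_castSucc, Fin.snoc_last, e0, e1, Fin.succ_last, Fin.val_castSucc,
        Fin.val_last]
      ring
    rw [← (Fin.snocEquiv fun _ => E).sum_comp, Fintype.sum_prod_type]
    simp only [Fin.snocEquiv, Equiv.coe_fn_mk]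
    have h2 : ∑ y : E, ∑ x : Fin (n + 1) → E,
        g (x 0) y * (∏ i : Fin n, F i (x i.castSucc) (x i.succ)) * F n (x (Fin.last n)) y =
        ∑ x : Fin (n + 1) → E, (fun a b => ∑ y, g a y * F n b y) (x 0) (x (Fin.last n)) *
          ∏ i : Fin n, F i (x i.castSucc) (x i.succ) := by
      rw [Finset.sum_comm]
      refine Finset.sum_congr rfl fun x _ => ?_
      rw [Finset.sum_mul]
      exact Finset.sum_congr rfl fun y _ => by ring
    refine ((Finset.sum_congr rfl fun y _ => Finset.sum_congr rfl fun x _ => h1 x y).trans h2).trans ?_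
    refine (ih fun a b => ∑ y, g a y * F n b y).trans (Finset.sum_congr rfl fun a _ => ?_)
    simp only [matProd, Matrix.mul_apply, Finset.sum_mul, Finset.mul_sum]
    rw [Finset.sum_comm]
    exact Finset.sum_congr rfl fun y _ => Finset.sum_congr rfl fun b _ => by ring

/-- The total weight of the closed walks is a trace. -/
theorem sum_closed_walks (F : ℕ → Matrix E E ℝ) (k : ℕ) [NeZero k] :
    ∑ x : Fin k → E, ∏ i : Fin k, F i (x i) (x (i + 1)) = (matProd F k).trace := by
  obtain ⟨n, rfl⟩ : ∃ n, k = n + 1 := ⟨k - 1, by have := NeZero.pos k; omega⟩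
  have h1 : ∀ x : Fin (n + 1) → E, ∏ i : Fin (n + 1), F i (x i) (x (i + 1)) =
      (fun a b => F n b a) (x 0) (x (Fin.last n)) * ∏ i : Fin n, F i (x i.castSucc) (x i.succ) := by
    intro x
    rw [Fin.prod_univ_castSucc, mul_comm]
    simp
  rw [Finset.sum_congr rfl fun x _ => h1 x]
  refine (sum_open_walks F n fun a b => F n b a).trans ?_
  simp only [matProd, Matrix.trace, Matrix.diag, Matrix.mul_apply]
  exact Finset.sum_congr rfl fun a _ => Finset.sum_congr rfl fun b _ => by ring

variable {L : Type*} [Fintype L]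

/-- Closed walks with labelled steps. -/
theorem sum_labelled_walks (f : ℕ → E → L → E → ℝ) (k : ℕ) [NeZero k] :
    ∑ x : Fin k → E, ∑ l : Fin k → L, ∏ i : Fin k, f i (x i) (l i) (x (i + 1)) =
      (matProd (fun n => Matrix.of fun a b => ∑ s, f n a s b) k).trace := by
  rw [← sum_closed_walks]
  refine Finset.sum_congr rfl fun x _ => ?_
  simp only [Matrix.of_apply]
  rw [Finset.prod_univ_sum, Fintype.piFinset_univ]

end walks

/-! ### Trace inequalities for symmetric substochastic matrices. -/

section substochastic

variable {E : Type*} [Fintype E] [DecidableEq E]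

/-- Symmetric nonnegative matrices with row sums at most one. -/
structure Substochastic (M : Matrix E E ℝ) : Prop where
  symm : ∀ x y, M x y = M y x
  nonneg : ∀ x y, 0 ≤ M x y
  row : ∀ x, ∑ y, M x y ≤ 1

variable {M : Matrix E E ℝ}

theorem Substochastic.pow (hM : Substochastic M) (n : ℕ) : Substochastic (M ^ n) := by
  have hT : M.transpose = M := by ext x y; exact hM.symm y x
  induction n with
  | zero =>
    refine ⟨fun x y => ?_, fun x y => ?_, fun x => ?_⟩
    · simp [Matrix.one_apply, eq_comm]
    · rw [pow_zero, Matrix.one_apply]; split_ifs <;> norm_num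
    · simp [Matrix.one_apply]
  | succ n ih =>
    refine ⟨fun x y => ?_, fun x y => ?_, fun x => ?_⟩
    · have : (M ^ (n + 1)).transpose = M ^ (n + 1) := by rw [Matrix.transpose_pow, hT]
      exact congrFun (congrFun this y) x
    · rw [pow_succ, Matrix.mul_apply]
      exact Finset.sum_nonneg fun z _ => mul_nonneg (ih.nonneg _ _) (hM.nonneg _ _)
    · simp only [pow_succ, Matrix.mul_apply]
      rw [Finset.sum_comm]
      simp only [← Finset.mul_sum]
      exact (Finset.sum_le_sum fun z _ => mul_le_of_le_one_right (ih.nonneg _ _) (hM.row z)).trans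
        (ih.row x)

/-- An even power is the Gram matrix of the rows of M^h, so this is 2ab ≤ a² + b² applied termwise.
-/
theorem Substochastic.pow_two_mul_le (hM : Substochastic M) (h : ℕ) (u y : E) :
    (M ^ (2 * h)) u y ≤ ((M ^ (2 * h)) u u + (M ^ (2 * h)) y y) / 2 := by
  have hs := (hM.pow h).symm
  have hN : ∀ a b, (M ^ (2 * h)) a b = ∑ v, (M ^ h) a v * (M ^ h) b v := fun a b => by
    rw [two_mul, pow_add, Matrix.mul_apply]
    exact Finset.sum_congr rfl fun v _ => by rw [hs v b]
  rw [hN, hN, hN, ← Finset.sum_add_distrib, Finset.sum_div]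
  exact Finset.sum_le_sum fun v _ => by nlinarith [sq_nonneg ((M ^ h) u v - (M ^ h) y v)]

/-- Closed walks through a kernel with small row and column sums. -/
theorem Substochastic.sum_kernel_le (hM : Substochastic M) {K : E → E → ℝ} {η : ℝ}
    (hK : ∀ y z, 0 ≤ K y z) (hKs : ∀ y z, K y z = K z y) (hrow : ∀ y, ∑ z, K y z ≤ η) {h q : ℕ}
    (hq : 2 * h ≤ q) :
    ∑ y, ∑ z, K y z * (M ^ q) z y ≤ η * (M ^ (2 * h)).trace := by
  have hcol : ∀ z, ∑ y, K y z ≤ η := fun z => by simpa only [hKs _ z] using hrow z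
  set N := M ^ (2 * h) with hN
  set P := M ^ (q - 2 * h) with hP
  have hPs : Substochastic P := hM.pow _
  have hN0 : ∀ x, 0 ≤ N x x := fun x => (hM.pow _).nonneg x x
  have hcolP : ∀ u, ∑ z, P z u ≤ 1 := fun u => by simpa only [hPs.symm _ u] using hPs.row u
  have hMq : M ^ q = P * N := by rw [hN, hP, ← pow_add]; congr 1; omega
  -- Split off the even power N from M^q and bound its entry by the average of two diagonal entries.
  -- With N u u fixed the kernel is summed along columns, with N y y fixed along rows; both sums are
  -- at most η, and the diagonal of N adds up to the trace.
  have h1 : ∀ y z, K y z * (M ^ q) z y ≤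
      (∑ u, K y z * (P z u * N u u)) / 2 + (∑ u, K y z * (P z u * N y y)) / 2 := by
    intro y z
    rw [hMq, Matrix.mul_apply, Finset.mul_sum, ← add_div, ← Finset.sum_add_distrib, Finset.sum_div]
    refine Finset.sum_le_sum fun u _ => ?_
    have := mul_le_mul_of_nonneg_left (mul_le_mul_of_nonneg_left (hM.pow_two_mul_le h u y)
      (hPs.nonneg z u)) (hK y z)
    calc _ ≤ _ := this
      _ = _ := by ring
  have h2 : ∑ y, ∑ z, ∑ u, K y z * (P z u * N u u) ≤ η * N.trace := by
    calc ∑ y, ∑ z, ∑ u, K y z * (P z u * N u u) = ∑ u, N u u * ∑ z, P z u * ∑ y, K y z := by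
          simp only [Finset.mul_sum]
          rw [Finset.sum_comm' (t' := Finset.univ) (s' := fun _ => Finset.univ) (by simp)]
          rw [Finset.sum_congr rfl fun z _ => Finset.sum_comm]
          rw [Finset.sum_comm]
          exact Finset.sum_congr rfl fun u _ => Finset.sum_congr rfl fun z _ =>
            Finset.sum_congr rfl fun y _ => by ring
      _ ≤ ∑ u, N u u * η := by
          refine Finset.sum_le_sum fun u _ => mul_le_mul_of_nonneg_left ?_ (hN0 u)
          have hη : 0 ≤ η := (Finset.sum_nonneg fun z _ => hK u z).trans (hrow u)
          calc _ ≤ ∑ z, P z u * η := Finset.sum_le_sum fun z _ =>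
                mul_le_mul_of_nonneg_left (hcol z) (hPs.nonneg _ _)
            _ ≤ η := by
              rw [← Finset.sum_mul]; exact mul_le_of_le_one_left hη (hcolP u)
      _ = η * N.trace := by rw [← Finset.sum_mul, mul_comm]; rfl
  have h3 : ∑ y, ∑ z, ∑ u, K y z * (P z u * N y y) ≤ η * N.trace := by
    calc ∑ y, ∑ z, ∑ u, K y z * (P z u * N y y) = ∑ y, N y y * ∑ z, K y z * ∑ u, P z u := by
          simp only [Finset.mul_sum]
          exact Finset.sum_congr rfl fun u _ => Finset.sum_congr rfl fun z _ =>
            Finset.sum_congr rfl fun y _ => by ring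
      _ ≤ ∑ u, N u u * η := by
          refine Finset.sum_le_sum fun u _ => mul_le_mul_of_nonneg_left ?_ (hN0 u)
          exact (Finset.sum_le_sum fun z _ => mul_le_of_le_one_right (hK _ _) (hPs.row z)).trans
            (hrow u)
      _ = η * N.trace := by rw [← Finset.sum_mul, mul_comm]; rfl
  calc _ ≤ ∑ y, ∑ z, ((∑ u, K y z * (P z u * N u u)) / 2 + (∑ u, K y z * (P z u * N y y)) / 2) :=
        Finset.sum_le_sum fun y _ => Finset.sum_le_sum fun z _ => h1 y z
    _ = (∑ y, ∑ z, ∑ u, K y z * (P z u * N u u)) / 2 +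
        (∑ y, ∑ z, ∑ u, K y z * (P z u * N y y)) / 2 := by
        simp only [Finset.sum_add_distrib, Finset.sum_div]
    _ ≤ _ := by linarith

theorem Substochastic.trace_sq_le (hM : Substochastic M) : (M ^ 2).trace ≤ Fintype.card E := by
  have : ∀ x, (M ^ 2) x x ≤ 1 := fun x =>
    (Finset.single_le_sum (fun y _ => (hM.pow 2).nonneg x y) (Finset.mem_univ x)).trans
      ((hM.pow 2).row x)
  calc (M ^ 2).trace ≤ ∑ _x : E, (1 : ℝ) := Finset.sum_le_sum fun x _ => this x
    _ = _ := by simp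

/-- By Cauchy–Schwarz each squaring of M at least squares the average row sum, so the entries of
M^(2^(i+1)) add up to at least ρ^(2^(i+1)) |E|. One further Cauchy–Schwarz bounds the sum of the
entries of a squared symmetric matrix by |E| times its trace. -/
theorem Substochastic.le_trace (hM : Substochastic M) [Nonempty E] {ρ : ℝ} (hρ : 0 ≤ ρ)
    (hmass : ρ * Fintype.card E ≤ ∑ x, ∑ y, M x y) (i : ℕ) :
    ρ ^ (2 ^ (i + 1)) ≤ (M ^ (2 ^ (i + 1))).trace := by
  have hc : (0 : ℝ) < Fintype.card E := by exact_mod_cast Fintype.card_pos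
  have hsq : ∀ n x y, (M ^ (2 * n)) x y = ∑ v, (M ^ n) v x * (M ^ n) v y := fun n x y => by
    rw [two_mul, pow_add, Matrix.mul_apply]
    exact Finset.sum_congr rfl fun v _ => by rw [(hM.pow n).symm x v]
  have hquad : ∀ n, ∑ x, ∑ y, (M ^ (2 * n)) x y = ∑ v, (∑ x, (M ^ n) v x) ^ 2 := by
    intro n
    simp only [hsq, sq, Finset.sum_mul_sum]
    rw [Finset.sum_congr rfl fun x _ => Finset.sum_comm]
    rw [Finset.sum_comm]
  have hlow : ∀ i : ℕ, ρ ^ (2 ^ i) * Fintype.card E ≤ ∑ x, ∑ y, (M ^ (2 ^ i)) x y := by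
    intro i
    induction i with
    | zero => simpa using hmass
    | succ i ih =>
      rw [pow_succ 2 i, mul_comm (2 ^ i) 2, hquad]
      have hcs := sq_sum_le_card_mul_sum_sq (s := (Finset.univ : Finset E))
        (f := fun v => ∑ x, (M ^ (2 ^ i)) v x)
      rw [Finset.card_univ] at hcs
      have h1 : (ρ ^ 2 ^ i * Fintype.card E) ^ 2 ≤ (∑ x, ∑ y, (M ^ (2 ^ i)) x y) ^ 2 :=
        pow_le_pow_left₀ (by positivity) ih 2
      have h2 : (ρ ^ (2 * 2 ^ i) * Fintype.card E) * Fintype.card E ≤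
          (∑ v, (∑ x, (M ^ (2 ^ i)) v x) ^ 2) * Fintype.card E := by
        calc _ = (ρ ^ 2 ^ i * Fintype.card E) ^ 2 := by rw [mul_comm 2, pow_mul]; ring
          _ ≤ _ := h1
          _ ≤ _ := hcs
          _ = _ := mul_comm _ _
      exact le_of_mul_le_mul_right h2 hc
  have h1 := hlow (i + 1)
  rw [pow_succ 2 i, mul_comm (2 ^ i) 2] at h1 ⊢
  rw [hquad] at h1
  have h2 : ∑ v, (∑ x, (M ^ (2 ^ i)) v x) ^ 2 ≤
      Fintype.card E * (M ^ (2 * 2 ^ i)).trace := by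
    calc _ ≤ ∑ v, (Fintype.card E : ℝ) * ∑ x, ((M ^ (2 ^ i)) v x) ^ 2 := by
          refine Finset.sum_le_sum fun v _ => ?_
          have := sq_sum_le_card_mul_sum_sq (s := (Finset.univ : Finset E))
            (f := fun x => (M ^ (2 ^ i)) v x)
          rwa [Finset.card_univ] at this
      _ = _ := by
          rw [← Finset.mul_sum, Finset.sum_comm]
          simp only [Matrix.trace, Matrix.diag, hsq, sq]
  exact le_of_mul_le_mul_right (h1.trans (h2.trans (le_of_eq (mul_comm _ _)))) hc

end substochastic

/-! ### Closed walks without conflicts. -/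

section closedWalk

open scoped Classical

variable {E L : Type*} [Fintype E] [Fintype L]

/-- The matrix of the steps satisfying `p`. -/
noncomputable def stepMatrix (w : E → L → E → ℝ) (p : E → L → E → Prop) : Matrix E E ℝ :=
  Matrix.of fun a b => ∑ s, if p a s b then w a s b else 0

theorem sum_marked_walks (w : E → L → E → ℝ) (p q : E → L → E → Prop) {k : ℕ} [NeZero k]
    {i j : Fin k} (hij : i < j) :
    ∑ x : Fin k → E, ∑ l : Fin k → L, (if p (x i) (l i) (x (i + 1)) ∧ q (x j) (l j) (x (j + 1)) then
      ∏ n : Fin k, w (x n) (l n) (x (n + 1)) else 0) =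
    (stepMatrix w (fun _ _ _ => True) ^ (i : ℕ) * stepMatrix w p *
      stepMatrix w (fun _ _ _ => True) ^ (j - i - 1 : ℕ) * stepMatrix w q *
      stepMatrix w (fun _ _ _ => True) ^ (k - j - 1 : ℕ)).trace := by
  set P : ℕ → E → L → E → Prop := fun n => if n = i then p else if n = j then q else fun _ _ _ => True
    with hP
  have hPi : P i = p := by simp [hP]
  have hPj : P j = q := by
    have : (j : ℕ) ≠ i := fun h => by have := Fin.lt_def.1 hij; omega
    simp [hP, this]
  have h1 : ∀ (x : Fin k → E) (l : Fin k → L),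
      (if p (x i) (l i) (x (i + 1)) ∧ q (x j) (l j) (x (j + 1)) then
        ∏ n : Fin k, w (x n) (l n) (x (n + 1)) else 0) =
      ∏ n : Fin k, (fun (n : ℕ) a s b => if P n a s b then w a s b else 0) n (x n) (l n) (x (n + 1)) := by
    intro x l
    split_ifs with hc
    · refine Finset.prod_congr rfl fun n _ => (if_pos ?_).symm
      by_cases hni : n = i
      · subst hni; rw [hPi]; exact hc.1
      by_cases hnj : n = j
      · subst hnj; rw [hPj]; exact hc.2
      · have e1 : (n : ℕ) ≠ i := fun h => hni (Fin.ext h)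
        have e2 : (n : ℕ) ≠ j := fun h => hnj (Fin.ext h)
        simp [hP, e1, e2]
    · rcases not_and_or.1 hc with hc | hc
      · exact (Finset.prod_eq_zero (Finset.mem_univ i) (if_neg (by rwa [hPi]))).symm
      · exact (Finset.prod_eq_zero (Finset.mem_univ j) (if_neg (by rwa [hPj]))).symm
  rw [Finset.sum_congr rfl fun x _ => Finset.sum_congr rfl fun l _ => h1 x l]
  rw [sum_labelled_walks (fun (n : ℕ) a s b => if P n a s b then w a s b else 0) k,
    ← matProd_two (Fin.lt_def.1 hij) j.2]
  congr 2
  funext n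
  by_cases hni : n = i
  · subst hni; simp only [hPi, if_true]; rfl
  by_cases hnj : n = j
  · subst hnj; simp only [hPj, hni, if_true, if_false]; rfl
  · simp [hP, hni, hnj, stepMatrix]

variable {w : E → L → E → ℝ} {CE : E → E → Prop} {CL : L → L → Prop} {η : ℝ}

/-- Two conflicting states cut the closed walk into two arcs. The shorter arc restricted to
conflicting ends is a symmetric kernel, and its row sums are at most η because its last step must
hit a conflict. The longer arc has length at least 4h, so `Substochastic.sum_kernel_le` applies. -/
theorem state_conflict_le {M : Matrix E E ℝ} (hM : Substochastic M) (hCEs : ∀ x y, CE x y → CE y x)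
    (hCE : ∀ u y, ∑ z, (if CE y z then M u z else 0) ≤ η) {h p q : ℕ} (hp : 1 ≤ p) (hq : 1 ≤ q)
    (hpq : p + q = 8 * h) :
    ∑ y, ∑ z, (if CE y z then (M ^ p) y z * (M ^ q) z y else 0) ≤ η * (M ^ (2 * h)).trace := by
  wlog hle : p ≤ q generalizing p q
  · refine le_trans (le_of_eq ?_) (this hq hp (by omega) (by omega))
    rw [Finset.sum_comm]
    refine Finset.sum_congr rfl fun z _ => Finset.sum_congr rfl fun y _ => ?_
    rw [show CE y z ↔ CE z y from ⟨hCEs _ _, hCEs _ _⟩, mul_comm]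
  have hKrow : ∀ y, ∑ z, (if CE y z then (M ^ p) y z else 0) ≤ η := by
    intro y
    obtain ⟨p, rfl⟩ : ∃ p', p = p' + 1 := ⟨p - 1, by omega⟩
    have hη : 0 ≤ η := (Finset.sum_nonneg fun z _ => by
      split_ifs
      · exact hM.nonneg _ _
      · exact le_rfl).trans (hCE y y)
    calc ∑ z, (if CE y z then (M ^ (p + 1)) y z else 0)
        = ∑ u, (M ^ p) y u * ∑ z, (if CE y z then M u z else 0) := by
          simp only [Finset.mul_sum]
          rw [Finset.sum_comm]
          refine Finset.sum_congr rfl fun z _ => ?_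
          rw [pow_succ, Matrix.mul_apply]
          split_ifs <;> simp
      _ ≤ ∑ u, (M ^ p) y u * η := Finset.sum_le_sum fun u _ =>
          mul_le_mul_of_nonneg_left (hCE u y) ((hM.pow p).nonneg _ _)
      _ ≤ η := by rw [← Finset.sum_mul]; exact mul_le_of_le_one_left hη ((hM.pow p).row y)
  have hK0 : ∀ y z, 0 ≤ (if CE y z then (M ^ p) y z else 0) := fun y z => by
    split_ifs
    · exact (hM.pow p).nonneg _ _
    · exact le_rfl
  have hKs : ∀ y z, (if CE y z then (M ^ p) y z else 0) = if CE z y then (M ^ p) z y else 0 :=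
    fun y z => by rw [show CE y z ↔ CE z y from ⟨hCEs _ _, hCEs _ _⟩, (hM.pow p).symm]
  refine le_trans (le_of_eq ?_) (hM.sum_kernel_le hK0 hKs hKrow (h := h) (q := q) (by omega))
  refine Finset.sum_congr rfl fun z _ => Finset.sum_congr rfl fun y _ => ?_
  rw [ite_mul, zero_mul]

/-- As for states, but the kernel consists of the shorter arc together with the two labelled steps
at its ends. Given the first label, the conflicting last step costs η. The remaining arc still has
length at least 4h - 1 ≥ 2h. -/
theorem label_conflict_le {M : Matrix E E ℝ} (hM : Substochastic M) {W : L → Matrix E E ℝ}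
    (hW0 : ∀ s x y, 0 ≤ W s x y) (hWs : ∀ s x y, W s x y = W s y x)
    (hWrow : ∀ x, ∑ s, ∑ y, W s x y ≤ 1) (hη : 0 ≤ η) (hCLs : ∀ s t, CL s t → CL t s)
    (hCL : ∀ u s, ∑ t, (if CL s t then ∑ z, W t u z else 0) ≤ η) {h p q : ℕ} (hh : 1 ≤ h)
    (hpq : p + q + 2 = 8 * h) :
    ∑ s, ∑ t, (if CL s t then (W s * M ^ p * W t * M ^ q).trace else 0) ≤
      η * (M ^ (2 * h)).trace := by
  wlog hle : p ≤ q generalizing p q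
  · refine le_trans (le_of_eq ?_) (this (p := q) (q := p) (by omega) (by omega))
    rw [Finset.sum_comm]
    refine Finset.sum_congr rfl fun z _ => Finset.sum_congr rfl fun y _ => ?_
    rw [show CL y z ↔ CL z y from ⟨hCLs _ _, hCLs _ _⟩, mul_assoc (W y * M ^ p),
      Matrix.trace_mul_comm, ← mul_assoc]
  set K : Matrix E E ℝ := ∑ s, ∑ t, (if CL s t then W s * M ^ p * W t else 0) with hK
  have hKapp : ∀ x u, K x u = ∑ s, ∑ t, (if CL s t then (W s * M ^ p * W t) x u else 0) := by
    intro x u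
    simp only [hK, Matrix.sum_apply]
    refine Finset.sum_congr rfl fun z _ => Finset.sum_congr rfl fun y _ => ?_
    split_ifs <;> rfl
  have hMp := hM.pow p
  have htrans : ∀ s, (W s).transpose = W s := fun s => by ext x y; exact hWs s y x
  have hMpt : (M ^ p).transpose = M ^ p := by ext x y; exact hMp.symm y x
  have hsymm : ∀ s t x u, (W s * M ^ p * W t) x u = (W t * M ^ p * W s) u x := by
    intro s t x u
    have : (W t * M ^ p * W s).transpose = W s * M ^ p * W t := by
      rw [Matrix.transpose_mul, Matrix.transpose_mul, htrans, htrans, hMpt, mul_assoc]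
    rw [← this]; rfl
  have hWM0 : ∀ s x z, 0 ≤ (W s * M ^ p) x z := fun s x z => by
    rw [Matrix.mul_apply]
    exact Finset.sum_nonneg fun y _ => mul_nonneg (hW0 _ _ _) (hMp.nonneg _ _)
  have hK0 : ∀ x u, 0 ≤ K x u := fun x u => by
    rw [hKapp]
    refine Finset.sum_nonneg fun s _ => Finset.sum_nonneg fun t _ => ?_
    split_ifs
    · rw [Matrix.mul_apply]
      exact Finset.sum_nonneg fun y _ => mul_nonneg (hWM0 _ _ _) (hW0 _ _ _)
    · exact le_rfl
  have hKs : ∀ x u, K x u = K u x := fun x u => by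
    rw [hKapp, hKapp, Finset.sum_comm]
    refine Finset.sum_congr rfl fun s _ => Finset.sum_congr rfl fun t _ => ?_
    rw [show CL t s ↔ CL s t from ⟨hCLs _ _, hCLs _ _⟩, hsymm]
  have hKrow : ∀ x, ∑ u, K x u ≤ η := fun x => by
    calc ∑ u, K x u
        = ∑ s, ∑ z, (W s * M ^ p) x z * ∑ t, (if CL s t then ∑ u, W t z u else 0) := by
          simp only [hKapp]
          rw [Finset.sum_comm]
          refine Finset.sum_congr rfl fun s _ => ?_
          simp only [Finset.mul_sum]
          rw [Finset.sum_comm, Finset.sum_comm (s := Finset.univ (α := E)) (t := Finset.univ (α := L))]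
          refine Finset.sum_congr rfl fun t _ => ?_
          split_ifs
          · simp only [Finset.mul_sum]
            rw [Finset.sum_comm]
            exact Finset.sum_congr rfl fun u _ => Matrix.mul_apply
          · simp
      _ ≤ ∑ s, ∑ z, (W s * M ^ p) x z * η := Finset.sum_le_sum fun s _ => Finset.sum_le_sum fun z _ =>
          mul_le_mul_of_nonneg_left (hCL z s) (hWM0 s x z)
      _ = (∑ s, ∑ y, W s x y * ∑ z, (M ^ p) y z) * η := by
          simp only [Finset.sum_mul, Finset.mul_sum, Matrix.mul_apply]
          refine Finset.sum_congr rfl fun s _ => Finset.sum_comm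
      _ ≤ 1 * η := by
          refine mul_le_mul_of_nonneg_right ((Finset.sum_le_sum fun s _ => Finset.sum_le_sum fun y _ =>
            ?_).trans (hWrow x)) hη
          exact mul_le_of_le_one_right (hW0 _ _ _) (hMp.row y)
      _ = η := one_mul η
  refine le_trans (le_of_eq ?_) (hM.sum_kernel_le hK0 hKs hKrow (h := h) (q := q) (by omega))
  calc ∑ s, ∑ t, (if CL s t then (W s * M ^ p * W t * M ^ q).trace else 0)
      = (K * M ^ q).trace := by
        simp only [hK, Matrix.sum_mul, Matrix.trace_sum]
        refine Finset.sum_congr rfl fun s _ => Finset.sum_congr rfl fun t _ => ?_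
        split_ifs <;> simp
    _ = _ := by simp only [Matrix.trace, Matrix.diag, Matrix.mul_apply]

theorem trace_rotate (M A X B : Matrix E E ℝ) (i q : ℕ) :
    (M ^ i * A * X * B * M ^ q).trace = (A * X * B * M ^ (q + i)).trace := by
  rw [mul_assoc, mul_assoc, mul_assoc, Matrix.trace_mul_comm, pow_add]
  simp only [mul_assoc]

theorem trace_single_mul_single (A B : Matrix E E ℝ) (y z : E) :
    (Matrix.single y y 1 * A * Matrix.single z z 1 * B).trace = A y z * B z y := by
  rw [Matrix.single_mul_mul_single, one_mul, mul_one, Matrix.trace_single_mul]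
  simp

/-- Prescribing the state at a given time inserts a diagonal projector `Matrix.single y y 1` into
the trace; two projectors split it into a product of two matrix entries. -/
theorem sum_state_conflict (w : E → L → E → ℝ) (CE : E → E → Prop) {k : ℕ} [NeZero k] {i j : Fin k}
    (hij : i < j) :
    ∑ x : Fin k → E, ∑ l : Fin k → L, (if CE (x i) (x j) then
      ∏ n : Fin k, w (x n) (l n) (x (n + 1)) else 0) =
    ∑ y, ∑ z, (if CE y z then (stepMatrix w (fun _ _ _ => True) ^ (j - i : ℕ)) y z *
      (stepMatrix w (fun _ _ _ => True) ^ (k - j + i : ℕ)) z y else 0) := by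
  set M := stepMatrix w fun _ _ _ => True with hM
  have hD : ∀ y : E, stepMatrix w (fun a _ _ => a = y) = Matrix.single y y 1 * M := by
    intro y
    ext a b
    by_cases ha : a = y
    · subst ha; simp [stepMatrix, hM]
    · simp [stepMatrix, ha]
  have htr : ∀ y z, ∑ x : Fin k → E, ∑ l : Fin k → L, (if x i = y ∧ x j = z then
      ∏ n : Fin k, w (x n) (l n) (x (n + 1)) else 0) =
      (M ^ (j - i : ℕ)) y z * (M ^ (k - j + i : ℕ)) z y := by
    intro y z
    rw [sum_marked_walks w (fun a _ _ => a = y) (fun a _ _ => a = z) hij, trace_rotate, hD, hD, ← hM]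
    have e1 : M * M ^ (j - i - 1 : ℕ) = M ^ (j - i : ℕ) := by
      rw [← pow_succ']; congr 1; have := Fin.lt_def.1 hij; omega
    have e2 : M * M ^ (k - j - 1 + i : ℕ) = M ^ (k - j + i : ℕ) := by
      rw [← pow_succ']; congr 1; omega
    have e3 : Matrix.single y y 1 * M * M ^ (j - i - 1 : ℕ) * (Matrix.single z z 1 * M) *
        M ^ (k - j - 1 + i : ℕ) = Matrix.single y y 1 * M ^ (j - i : ℕ) * Matrix.single z z 1 *
        M ^ (k - j + i : ℕ) := by
      rw [← e1, ← e2]; simp only [mul_assoc]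
    rw [e3, trace_single_mul_single]
  simp only [← htr]
  have h1 : ∀ (x : Fin k → E) (l : Fin k → L), (if CE (x i) (x j) then
      ∏ n : Fin k, w (x n) (l n) (x (n + 1)) else 0) = ∑ y, ∑ z, (if CE y z then
      (if x i = y ∧ x j = z then ∏ n : Fin k, w (x n) (l n) (x (n + 1)) else 0) else 0) := by
    intro x l
    rw [Finset.sum_eq_single (x i), Finset.sum_eq_single (x j)]
    · simp
    · intro z _ hz; simp [Ne.symm hz]
    · simp
    · intro y _ hy; simp [Ne.symm hy]
    · simp
  simp only [h1]
  rw [Finset.sum_congr rfl fun x _ => Finset.sum_comm, Finset.sum_comm]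
  refine Finset.sum_congr rfl fun y _ => ?_
  rw [Finset.sum_congr rfl fun x _ => Finset.sum_comm, Finset.sum_comm]
  refine Finset.sum_congr rfl fun z _ => ?_
  split_ifs <;> simp

theorem sum_label_conflict (w : E → L → E → ℝ) (CL : L → L → Prop) {k : ℕ} [NeZero k] {i j : Fin k}
    (hij : i < j) :
    ∑ x : Fin k → E, ∑ l : Fin k → L, (if CL (l i) (l j) then
      ∏ n : Fin k, w (x n) (l n) (x (n + 1)) else 0) =
    ∑ s, ∑ t, (if CL s t then (Matrix.of (fun a b => w a s b) *
      stepMatrix w (fun _ _ _ => True) ^ (j - i - 1 : ℕ) * Matrix.of (fun a b => w a t b) *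
      stepMatrix w (fun _ _ _ => True) ^ (k - j - 1 + i : ℕ)).trace else 0) := by
  have hD : ∀ s : L, stepMatrix w (fun _ b _ => b = s) = Matrix.of (fun a b => w a s b) := by
    intro s
    ext a b
    simp [stepMatrix]
  simp only [← hD, ← trace_rotate]
  simp only [← sum_marked_walks w _ _ hij]
  have h1 : ∀ (x : Fin k → E) (l : Fin k → L), (if CL (l i) (l j) then
      ∏ n : Fin k, w (x n) (l n) (x (n + 1)) else 0) = ∑ s, ∑ t, (if CL s t then
      (if l i = s ∧ l j = t then ∏ n : Fin k, w (x n) (l n) (x (n + 1)) else 0) else 0) := by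
    intro x l
    rw [Finset.sum_eq_single (l i), Finset.sum_eq_single (l j)]
    · simp
    · intro z _ hz; simp [Ne.symm hz]
    · simp
    · intro y _ hy; simp [Ne.symm hy]
    · simp
  simp only [h1]
  rw [Finset.sum_congr rfl fun x _ => Finset.sum_comm, Finset.sum_comm]
  refine Finset.sum_congr rfl fun y _ => ?_
  rw [Finset.sum_congr rfl fun x _ => Finset.sum_comm, Finset.sum_comm]
  refine Finset.sum_congr rfl fun z _ => ?_
  split_ifs <;> simp

/-- A sequence starting at most at `c` and whose `r`-th term exceeds `c θ ^ r` does not shrink by the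
factor `θ` at some step. -/
theorem exists_lt_of_decay {T : ℕ → ℝ} {θ c : ℝ} (hθ : 0 ≤ θ) (h0 : T 0 ≤ c) {r : ℕ}
    (hr : c * θ ^ r < T r) : ∃ j < r, θ * T j < T (j + 1) := by
  by_contra hcon
  push Not at hcon
  have : ∀ j ≤ r, T j ≤ c * θ ^ j := by
    intro j
    induction j with
    | zero => intro _; simpa using h0
    | succ j ih =>
      intro hj
      calc T (j + 1) ≤ θ * T j := hcon j hj
        _ ≤ θ * (c * θ ^ j) := mul_le_mul_of_nonneg_left (ih (by omega)) hθ
        _ = c * θ ^ (j + 1) := by ring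
  exact absurd (this r le_rfl) (not_le.2 hr)

/-- The union bound for conflicts in closed walks. -/
theorem exists_walk_of_conflict_lt (hw0 : ∀ x s y, 0 ≤ w x s y)
    (hCEs : ∀ x y, CE x y → CE y x) (hCLs : ∀ s t, CL s t → CL t s) {k : ℕ} [NeZero k] {c : ℝ}
    (hc : 0 ≤ c)
    (hstate : ∀ i j : Fin k, i < j → ∑ x : Fin k → E, ∑ l : Fin k → L, (if CE (x i) (x j) then
      ∏ n : Fin k, w (x n) (l n) (x (n + 1)) else 0) ≤ c)
    (hlabel : ∀ i j : Fin k, i < j → ∑ x : Fin k → E, ∑ l : Fin k → L, (if CL (l i) (l j) then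
      ∏ n : Fin k, w (x n) (l n) (x (n + 1)) else 0) ≤ c)
    (htot : 2 * (k : ℝ) ^ 2 * c < ∑ x : Fin k → E, ∑ l : Fin k → L,
      ∏ n : Fin k, w (x n) (l n) (x (n + 1))) :
    ∃ (x : Fin k → E) (l : Fin k → L), (∀ i, 0 < w (x i) (l i) (x (i + 1))) ∧
      (∀ i j, i ≠ j → ¬ CE (x i) (x j)) ∧ ∀ i j, i ≠ j → ¬ CL (l i) (l j) := by
  set wt : (Fin k → E) → (Fin k → L) → ℝ := fun x l => ∏ n : Fin k, w (x n) (l n) (x (n + 1)) with hwt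
  have hwt0 : ∀ x l, 0 ≤ wt x l := fun x l => Finset.prod_nonneg fun n _ => hw0 _ _ _
  by_contra hcon
  have hbad : ∀ x l, wt x l ≤ ∑ i : Fin k, ∑ j : Fin k, if i < j then
      ((if CE (x i) (x j) then wt x l else 0) + if CL (l i) (l j) then wt x l else 0) else 0 := by
    intro x l
    have hterm0 : ∀ i j : Fin k, 0 ≤ if i < j then
      ((if CE (x i) (x j) then wt x l else 0) + if CL (l i) (l j) then wt x l else 0) else 0 := by
      intro i j
      have := hwt0 x l
      split_ifs <;> linarith
    by_cases hpos : 0 < wt x l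
    · have hstep : ∀ i, 0 < w (x i) (l i) (x (i + 1)) := by
        intro i
        refine lt_of_le_of_ne (hw0 _ _ _) fun h0 => hpos.ne' ?_
        exact Finset.prod_eq_zero (Finset.mem_univ i) h0.symm
      obtain ⟨i, j, hij, hc'⟩ : ∃ i j : Fin k, i < j ∧ (CE (x i) (x j) ∨ CL (l i) (l j)) := by
        by_contra hno
        push Not at hno
        refine hcon ⟨x, l, hstep, fun i j hij hce => ?_,
          fun i j hij hcl => ?_⟩
        · rcases lt_or_gt_of_ne hij with h | h
          · exact (hno i j h).1 hce
          · exact (hno j i h).1 (hCEs _ _ hce)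
        · rcases lt_or_gt_of_ne hij with h | h
          · exact (hno i j h).2 hcl
          · exact (hno j i h).2 (hCLs _ _ hcl)
      refine le_trans ?_ ((Finset.single_le_sum (fun j _ => hterm0 i j) (Finset.mem_univ j)).trans
        (Finset.single_le_sum (f := fun i => ∑ j : Fin k, if i < j then
          ((if CE (x i) (x j) then wt x l else 0) + if CL (l i) (l j) then wt x l else 0) else 0)
          (fun i _ => Finset.sum_nonneg fun j _ => hterm0 i j) (Finset.mem_univ i)))
      rw [if_pos hij]
      rcases hc' with hc | hc
      · rw [if_pos hc]
        split_ifs <;> linarith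
      · rw [if_pos hc]
        split_ifs <;> linarith
    · rw [le_antisymm (not_lt.1 hpos) (hwt0 x l)]
      simp
  have hsum : ∑ x, ∑ l, wt x l ≤ ∑ i : Fin k, ∑ j : Fin k,
      (c + c) := by
    calc _ ≤ ∑ x, ∑ l, ∑ i : Fin k, ∑ j : Fin k, (if i < j then
        ((if CE (x i) (x j) then wt x l else 0) + if CL (l i) (l j) then wt x l else 0) else 0) :=
          Finset.sum_le_sum fun x _ => Finset.sum_le_sum fun l _ => hbad x l
      _ = ∑ i : Fin k, ∑ j : Fin k, ∑ x, ∑ l, (if i < j then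
        ((if CE (x i) (x j) then wt x l else 0) + if CL (l i) (l j) then wt x l else 0) else 0) := by
          rw [Finset.sum_congr rfl fun x _ => Finset.sum_comm, Finset.sum_comm]
          refine Finset.sum_congr rfl fun i _ => ?_
          rw [Finset.sum_congr rfl fun x _ => Finset.sum_comm, Finset.sum_comm]
      _ ≤ _ := by
          refine Finset.sum_le_sum fun i _ => Finset.sum_le_sum fun j _ => ?_
          by_cases hij : i < j
          · simp only [hij, if_true, Finset.sum_add_distrib]
            exact add_le_add (hstate i j hij) (hlabel i j hij)
          · simp only [hij, if_false, Finset.sum_const_zero]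
            linarith
  simp only [Finset.sum_const, Finset.card_univ, Fintype.card_fin, nsmul_eq_mul] at hsum
  refine absurd htot (not_lt.2 (hsum.trans (le_of_eq (by ring))))

/-- A symmetric substochastic kernel of large mass in which every conflict is rare carries a
conflict-free closed walk of bounded length. -/
theorem exists_closed_walk [Nonempty E] (hw0 : ∀ x s y, 0 ≤ w x s y)
    (hws : ∀ x s y, w x s y = w y s x) (hrow : ∀ x, ∑ y, ∑ s, w x s y ≤ 1)
    (hCEs : ∀ x y, CE x y → CE y x) (hCLs : ∀ s t, CL s t → CL t s) (hη : 0 ≤ η)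
    (hCE : ∀ u y, ∑ z, (if CE y z then ∑ s, w u s z else 0) ≤ η)
    (hCL : ∀ u s, ∑ t, (if CL s t then ∑ z, w u t z else 0) ≤ η) {ρ : ℝ} (hρ : 0 ≤ ρ)
    (hmass : ρ * Fintype.card E ≤ ∑ x, ∑ y, ∑ s, w x s y) (r : ℕ)
    (hcount : Fintype.card E * (2 * (8 * 4 ^ r) ^ 2 * η) ^ r < ρ ^ (2 ^ (2 * r + 1))) :
    ∃ (k : ℕ) (_ : NeZero k) (x : Fin k → E) (l : Fin k → L), 2 ≤ k ∧ k ≤ 8 * 4 ^ r ∧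
      (∀ i, 0 < w (x i) (l i) (x (i + 1))) ∧ (∀ i j, i ≠ j → ¬ CE (x i) (x j)) ∧
      ∀ i j, i ≠ j → ¬ CL (l i) (l j) := by
  set M := stepMatrix w fun _ _ _ => True with hMdef
  have hMapp : ∀ x y, M x y = ∑ s, w x s y := fun x y => by simp [hMdef, stepMatrix]
  have hM : Substochastic M := by
    refine ⟨fun x y => ?_, fun x y => ?_, fun x => ?_⟩
    · rw [hMapp, hMapp]; exact Finset.sum_congr rfl fun s _ => hws x s y
    · rw [hMapp]; exact Finset.sum_nonneg fun s _ => hw0 _ _ _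
    · simp only [hMapp]; exact hrow x
  set θ : ℝ := 2 * (8 * 4 ^ r) ^ 2 * η with hθ
  have hθ0 : 0 ≤ θ := by positivity
  -- The traces of M^(2·4^j) start at most at |E| and, by the mass hypothesis, end above |E| θ^r. So
  -- at some scale h = 4^j the trace at 8h exceeds θ times the trace at 2h, where θ covers the union
  -- bound over all pairs of times.
  obtain ⟨j, hjr, hj⟩ := exists_lt_of_decay (T := fun j => (M ^ (2 * 4 ^ j)).trace) hθ0
    (by simpa using hM.trace_sq_le) (r := r) (by
      refine hcount.trans_le ?_
      have e : 2 * 4 ^ r = 2 ^ (2 * r + 1) := by rw [pow_succ, pow_mul, mul_comm]; norm_num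
      rw [e]
      exact hM.le_trace hρ (by simpa only [hMapp] using hmass) (2 * r))
  set h := 4 ^ j with hh
  have hh1 : 1 ≤ h := Nat.one_le_pow _ _ (by norm_num)
  have hkr : 8 * h ≤ 8 * 4 ^ r := Nat.mul_le_mul_left _ (Nat.pow_le_pow_right (by norm_num) hjr.le)
  have hk8 : 2 * 4 ^ (j + 1) = 8 * h := by rw [hh, pow_succ]; ring
  simp only [hk8] at hj
  generalize hk : 8 * h = k at hj hkr
  have : NeZero k := ⟨by omega⟩
  have htot : ∑ x : Fin k → E, ∑ l : Fin k → L, ∏ n : Fin k, w (x n) (l n) (x (n + 1)) =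
      (M ^ k).trace := by
    rw [sum_labelled_walks (fun _ => w) k, matProd_const (Nat.zero_le k) (M := M)]
    · simp [matProd]
    · intro n _ _; ext a b; simp [hMapp]
  have hstate : ∀ i j : Fin k, i < j →
      ∑ x : Fin k → E, ∑ l : Fin k → L, (if CE (x i) (x j) then
        ∏ n : Fin k, w (x n) (l n) (x (n + 1)) else 0) ≤ η * (M ^ (2 * h)).trace := by
    intro i j hij
    have := Fin.lt_def.1 hij
    rw [sum_state_conflict w CE hij, ← hMdef]
    refine state_conflict_le hM hCEs ?_ (by omega) (by omega) (by omega)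
    intro u y
    simpa only [hMapp] using hCE u y
  have hlabel : ∀ i j : Fin k, i < j →
      ∑ x : Fin k → E, ∑ l : Fin k → L, (if CL (l i) (l j) then
        ∏ n : Fin k, w (x n) (l n) (x (n + 1)) else 0) ≤ η * (M ^ (2 * h)).trace := by
    intro i j hij
    have := Fin.lt_def.1 hij
    rw [sum_label_conflict w CL hij, ← hMdef]
    refine label_conflict_le (W := fun s => Matrix.of fun a b => w a s b) hM
      (fun s x y => hw0 x s y) (fun s x y => hws x s y) (fun x => ?_) hη hCLs (fun u s => ?_) hh1
      (by omega)
    · rw [Finset.sum_comm]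
      simpa only [Matrix.of_apply] using hrow x
    · simpa only [Matrix.of_apply] using hCL u s
  have htr0 : 0 ≤ η * (M ^ (2 * h)).trace :=
    mul_nonneg hη (Finset.sum_nonneg fun x _ => (hM.pow _).nonneg x x)
  obtain ⟨x, l, h1, h2, h3⟩ := exists_walk_of_conflict_lt hw0 hCEs hCLs htr0 hstate hlabel (by
    rw [htot]
    refine lt_of_le_of_lt ?_ hj
    have hk2 : (k : ℝ) ≤ 8 * 4 ^ r := by exact_mod_cast hkr
    have : (k : ℝ) ^ 2 ≤ (8 * 4 ^ r) ^ 2 := pow_le_pow_left₀ (Nat.cast_nonneg k) hk2 2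
    calc 2 * (k : ℝ) ^ 2 * (η * (M ^ (2 * h)).trace)
        ≤ 2 * (8 * 4 ^ r) ^ 2 * (η * (M ^ (2 * h)).trace) := by gcongr
      _ = _ := by rw [hθ]; ring)
  exact ⟨k, inferInstance, x, l, by omega, hkr, h1, h2, h3⟩

end closedWalk

/-! ### Uniform steps inside classes. -/

section classKernel

open scoped Classical

variable {S K : Type*}

/-- The transition kernel that moves to a uniformly random member of the same class. -/
noncomputable def classKernel (F : Finset S) (k : S → K) (e g : S) : ℝ :=
  if e ∈ F ∧ g ∈ F ∧ k e = k g then ((F.filter fun x => k x = k e).card : ℝ)⁻¹ else 0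

variable {F : Finset S} {k : S → K}

theorem classKernel_nonneg (e g : S) : 0 ≤ classKernel F k e g := by
  unfold classKernel
  split_ifs
  · positivity
  · exact le_rfl

theorem classKernel_symm (e g : S) : classKernel F k e g = classKernel F k g e := by
  unfold classKernel
  by_cases h : e ∈ F ∧ g ∈ F ∧ k e = k g
  · rw [if_pos h, if_pos ⟨h.2.1, h.1, h.2.2.symm⟩, h.2.2]
  · rw [if_neg h, if_neg fun h' => h ⟨h'.2.1, h'.1, h'.2.2.symm⟩]

theorem mem_of_classKernel_pos {e g : S} (h : 0 < classKernel F k e g) :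
    e ∈ F ∧ g ∈ F ∧ k e = k g := by
  unfold classKernel at h
  split_ifs at h with h'
  · exact h'
  · exact absurd h (lt_irrefl _)

theorem classKernel_self_le {t : ℕ} (ht : 0 < t)
    (hsize : ∀ e ∈ F, t ≤ (F.filter fun x => k x = k e).card) (e : S) :
    classKernel F k e e ≤ if e ∈ F then (t : ℝ)⁻¹ else 0 := by
  unfold classKernel
  by_cases he : e ∈ F
  · rw [if_pos ⟨he, he, rfl⟩, if_pos he]
    exact inv_anti₀ (by exact_mod_cast ht) (by exact_mod_cast hsize e he)
  · simp [he]

variable [Fintype S]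

theorem sum_classKernel_if (e : S) (p : S → Prop) [DecidablePred p] :
    ∑ g, (if p g then classKernel F k e g else 0) = if e ∈ F then
      ((F.filter fun g => k g = k e ∧ p g).card : ℝ) * ((F.filter fun x => k x = k e).card : ℝ)⁻¹
      else 0 := by
  by_cases he : e ∈ F
  · rw [if_pos he, ← nsmul_eq_mul, ← Finset.sum_const, Finset.sum_filter]
    rw [← Finset.sum_filter_add_sum_filter_not Finset.univ (fun g => g ∈ F)]
    rw [Finset.sum_eq_zero (s := Finset.univ.filter fun g => g ∉ F), add_zero]
    · rw [Finset.filter_mem_eq_inter, Finset.univ_inter]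
      refine Finset.sum_congr rfl fun g hg => ?_
      unfold classKernel
      by_cases h1 : k e = k g <;> by_cases h2 : p g <;> simp [h1, h2, he, hg, eq_comm (a := k g)]
    · intro g hg
      have := (Finset.mem_filter.1 hg).2
      simp [classKernel, this]
  · rw [if_neg he]
    refine Finset.sum_eq_zero fun g _ => ?_
    simp [classKernel, he]

theorem sum_classKernel (e : S) : ∑ g, classKernel F k e g = if e ∈ F then 1 else 0 := by
  have h := sum_classKernel_if (F := F) (k := k) e fun _ => True
  simp only [if_true, and_true] at h
  rw [h]
  split_ifs with he
  · refine mul_inv_cancel₀ (Nat.cast_ne_zero.2 (Finset.card_pos.2 ⟨e, ?_⟩).ne')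
    exact Finset.mem_filter.2 ⟨he, rfl⟩
  · rfl

theorem sum_classKernel_le_one (e : S) : ∑ g, classKernel F k e g ≤ 1 := by
  rw [sum_classKernel]; split_ifs <;> norm_num

theorem sum_classKernel_if_le {t m : ℕ} (ht : 0 < t)
    (hsize : ∀ e ∈ F, t ≤ (F.filter fun x => k x = k e).card) {p : S → Prop} [DecidablePred p]
    (hm : ∀ e ∈ F, (F.filter fun g => k g = k e ∧ p g).card ≤ m) (e : S) :
    ∑ g, (if p g then classKernel F k e g else 0) ≤ m / t := by
  rw [sum_classKernel_if]
  split_ifs with he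
  · rw [← div_eq_mul_inv]
    have h1 : (t : ℝ) ≤ (F.filter fun x => k x = k e).card := by exact_mod_cast hsize e he
    have h2 : ((F.filter fun g => k g = k e ∧ p g).card : ℝ) ≤ m := by exact_mod_cast hm e he
    have ht' : (0 : ℝ) < t := by exact_mod_cast ht
    exact div_le_div₀ (Nat.cast_nonneg m) h2 ht' h1
  · positivity

end classKernel

/-! ### Link systems and the two-step walk on pairs. -/

section linkSystem

open scoped Classical

/-- Pairs `e = (fst e, snd e)` with apex sets `A e`, together with, for any two apices, large
classes of pairs that are robustly joined inside the common link of the apices. -/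
structure LinkSystem (S V K : Type*) (D t : ℕ) where
  /-- first vertex of a pair -/
  fst : S → V
  /-- second vertex of a pair -/
  snd : S → V
  /-- apices of a pair -/
  A : S → Finset V
  /-- the robust relation in the common link of two apices -/
  rob : V → V → V → V → Prop
  /-- pairs classified at their second vertex -/
  FC : V → V → Finset S
  /-- pairs classified at their first vertex -/
  FB : V → V → Finset S
  /-- classes at the second vertex -/
  kC : V → V → S → K
  /-- classes at the first vertex -/
  kB : V → V → S → K
  ext_pair : ∀ e e', fst e = fst e' → snd e = snd e' → e = e'
  card_A : ∀ e, (A e).card = D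
  mem_C : ∀ a a', ∀ e ∈ FC a a', a ∈ A e ∧ a' ∈ A e
  mem_B : ∀ a a', ∀ e ∈ FB a a', a ∈ A e ∧ a' ∈ A e
  rob_C : ∀ a a', ∀ e ∈ FC a a', ∀ e' ∈ FC a a', kC a a' e = kC a a' e' →
    snd e = snd e' ∧ rob a a' (fst e) (fst e')
  rob_B : ∀ a a', ∀ e ∈ FB a a', ∀ e' ∈ FB a a', kB a a' e = kB a a' e' →
    fst e = fst e' ∧ rob a a' (snd e) (snd e')
  rob_pair : ∀ a a', ∀ e ∈ FC a a', rob a a' (fst e) (snd e)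
  rob_symm : ∀ a a' x y, rob a a' x y → rob a a' y x
  rob_comm : ∀ a a' x y, rob a a' x y → rob a' a x y
  size_C : ∀ a a', ∀ e ∈ FC a a', t ≤ ((FC a a').filter fun e' => kC a a' e' = kC a a' e).card
  size_B : ∀ a a', ∀ e ∈ FB a a', t ≤ ((FB a a').filter fun e' => kB a a' e' = kB a a' e).card
  t_pos : 0 < t

variable {S V K : Type*} [Fintype S] {D t : ℕ} (Y : LinkSystem S V K D t)

namespace LinkSystem

/-- Both apices belong to the pair. -/
def Inn (a a' : V) (e : S) : Prop := a ∈ Y.A e ∧ a' ∈ Y.A e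

/-- Move first inside a class at the second vertex, then inside a class at the first vertex. -/
noncomputable def twoStep (a a' : V) (e e' : S) : ℝ :=
  ∑ g, classKernel (Y.FC a a') (Y.kC a a') e g * classKernel (Y.FB a a') (Y.kB a a') g e'

theorem twoStep_nonneg (a a' : V) (e e' : S) : 0 ≤ Y.twoStep a a' e e' :=
  Finset.sum_nonneg fun _ _ => mul_nonneg (classKernel_nonneg _ _) (classKernel_nonneg _ _)

/-- The walk is (b, c), (b', c), (b', c'): the first move keeps c and makes b, b' robust, the second
keeps b' and makes c, c' robust. -/
theorem rob_of_twoStep_pos {a a' : V} {e e' : S} (h : 0 < Y.twoStep a a' e e') :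
    Y.rob a a' (Y.fst e) (Y.fst e') ∧ Y.rob a a' (Y.snd e) (Y.snd e') := by
  obtain ⟨g, -, hg⟩ := Finset.exists_lt_of_sum_lt (s := Finset.univ) (f := fun _ : S => (0 : ℝ))
    (lt_of_eq_of_lt Finset.sum_const_zero h)
  have h1 := classKernel_nonneg (F := Y.FC a a') (k := Y.kC a a') e g
  have h2 := classKernel_nonneg (F := Y.FB a a') (k := Y.kB a a') g e'
  obtain ⟨c1, c2, c3⟩ := mem_of_classKernel_pos (pos_of_mul_pos_left hg h2)
  obtain ⟨b1, b2, b3⟩ := mem_of_classKernel_pos (pos_of_mul_pos_right hg h1)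
  obtain ⟨hc, hr⟩ := Y.rob_C a a' e c1 g c2 c3
  obtain ⟨hb, hr'⟩ := Y.rob_B a a' g b1 e' b2 b3
  exact ⟨hb ▸ hr, hc ▸ hr'⟩

theorem sum_twoStep_if (a a' : V) (e : S) (p : S → Prop) [DecidablePred p] :
    ∑ e', (if p e' then Y.twoStep a a' e e' else 0) =
      ∑ g, classKernel (Y.FC a a') (Y.kC a a') e g *
        ∑ e', (if p e' then classKernel (Y.FB a a') (Y.kB a a') g e' else 0) := by
  simp only [Finset.mul_sum]
  rw [Finset.sum_comm]
  refine Finset.sum_congr rfl fun e' _ => ?_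
  split_ifs
  · rfl
  · simp

theorem sum_twoStep_if' (a a' : V) (e' : S) (p : S → Prop) [DecidablePred p] :
    ∑ e, (if p e then Y.twoStep a a' e e' else 0) =
      ∑ g, classKernel (Y.FB a a') (Y.kB a a') e' g *
        ∑ e, (if p e then classKernel (Y.FC a a') (Y.kC a a') g e else 0) := by
  simp only [Finset.mul_sum]
  rw [Finset.sum_comm]
  refine Finset.sum_congr rfl fun e _ => ?_
  split_ifs
  · unfold twoStep
    refine Finset.sum_congr rfl fun g _ => ?_
    rw [classKernel_symm e g, classKernel_symm g e', mul_comm]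
  · simp

theorem sum_twoStep_le (a a' : V) (e : S) :
    ∑ e', Y.twoStep a a' e e' ≤ if Y.Inn a a' e then 1 else 0 := by
  have h := Y.sum_twoStep_if a a' e fun _ => True
  simp only [if_true] at h
  rw [h]
  refine (Finset.sum_le_sum fun g _ => mul_le_of_le_one_right (classKernel_nonneg _ _)
    (sum_classKernel_le_one g)).trans ?_
  rw [sum_classKernel]
  by_cases he : e ∈ Y.FC a a'
  · rw [if_pos he, if_pos (show Y.Inn a a' e from Y.mem_C a a' e he)]
  · rw [if_neg he]; split_ifs <;> norm_num

theorem sum_twoStep_le' (a a' : V) (e' : S) :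
    ∑ e, Y.twoStep a a' e e' ≤ if Y.Inn a a' e' then 1 else 0 := by
  have h := Y.sum_twoStep_if' a a' e' fun _ => True
  simp only [if_true] at h
  rw [h]
  refine (Finset.sum_le_sum fun g _ => mul_le_of_le_one_right (classKernel_nonneg _ _)
    (sum_classKernel_le_one g)).trans ?_
  rw [sum_classKernel]
  by_cases he : e' ∈ Y.FB a a'
  · rw [if_pos he, if_pos (show Y.Inn a a' e' from Y.mem_B a a' e' he)]
  · rw [if_neg he]; split_ifs <;> norm_num

/-- Count the mass at the middle pair g. By symmetry of the class kernels, g receives total mass 1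
and sends out total mass 1 exactly when it is classified at both ends. -/
theorem sum_sum_twoStep (a a' : V) :
    ∑ e, ∑ e', Y.twoStep a a' e e' = (Y.FC a a' ∩ Y.FB a a').card := by
  have h : ∀ e, ∑ e', Y.twoStep a a' e e' = ∑ g, classKernel (Y.FC a a') (Y.kC a a') e g *
      if g ∈ Y.FB a a' then 1 else 0 := fun e => by
    have h := Y.sum_twoStep_if a a' e fun _ => True
    simp only [if_true, sum_classKernel] at h
    exact h
  simp only [h]
  rw [Finset.sum_comm]
  have h2 : ∀ g, ∑ e, classKernel (Y.FC a a') (Y.kC a a') e g = if g ∈ Y.FC a a' then 1 else 0 :=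
    fun g => by simp only [classKernel_symm _ g, sum_classKernel]
  simp only [← Finset.sum_mul, h2]
  have h3 : ∀ g, ((if g ∈ Y.FC a a' then 1 else 0) * if g ∈ Y.FB a a' then 1 else 0 : ℝ) =
      if g ∈ Y.FC a a' ∩ Y.FB a a' then 1 else 0 := fun g => by
    by_cases h1 : g ∈ Y.FC a a' <;> by_cases h2 : g ∈ Y.FB a a' <;> simp [h1, h2]
  simp only [h3]
  rw [Finset.sum_boole, Finset.filter_mem_eq_inter, Finset.univ_inter]

/-- If the first vertex does not change, the middle pair agrees with e in both vertices. So the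
first move stayed at e, which happens with probability at most 1 / t. -/
theorem sum_twoStep_same_fst (a a' : V) :
    ∑ e, ∑ e', (if Y.fst e = Y.fst e' then Y.twoStep a a' e e' else 0) ≤
      ∑ e, if Y.Inn a a' e then (t : ℝ)⁻¹ else 0 := by
  have h1 : ∀ e e', (if Y.fst e = Y.fst e' then Y.twoStep a a' e e' else 0) ≤
      classKernel (Y.FC a a') (Y.kC a a') e e * classKernel (Y.FB a a') (Y.kB a a') e e' := by
    intro e e'
    split_ifs with hee
    · unfold twoStep
      rw [Finset.sum_eq_single e]
      · intro g _ hge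
        by_contra hne
        have h1 := classKernel_nonneg (F := Y.FC a a') (k := Y.kC a a') e g
        have h2 := classKernel_nonneg (F := Y.FB a a') (k := Y.kB a a') g e'
        have hpos := lt_of_le_of_ne (mul_nonneg h1 h2) (Ne.symm hne)
        obtain ⟨c1, c2, c3⟩ := mem_of_classKernel_pos (pos_of_mul_pos_left hpos h2)
        obtain ⟨b1, b2, b3⟩ := mem_of_classKernel_pos (pos_of_mul_pos_right hpos h1)
        exact hge (Y.ext_pair _ _ ((Y.rob_B a a' g b1 e' b2 b3).1.trans hee.symm)
          (Y.rob_C a a' e c1 g c2 c3).1.symm)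
      · simp
    · exact mul_nonneg (classKernel_nonneg _ _) (classKernel_nonneg _ _)
  refine Finset.sum_le_sum fun e _ => (Finset.sum_le_sum fun e' _ => h1 e e').trans ?_
  rw [← Finset.mul_sum]
  refine (mul_le_of_le_one_right (classKernel_nonneg _ _) (sum_classKernel_le_one _)).trans
    ((classKernel_self_le Y.t_pos (Y.size_C a a') e).trans ?_)
  by_cases he : e ∈ Y.FC a a'
  · rw [if_pos he, if_pos (show Y.Inn a a' e from Y.mem_C a a' e he)]
  · rw [if_neg he]; split_ifs <;> positivity

theorem sum_twoStep_same_snd (a a' : V) :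
    ∑ e, ∑ e', (if Y.snd e = Y.snd e' then Y.twoStep a a' e e' else 0) ≤
      ∑ e, if Y.Inn a a' e then (t : ℝ)⁻¹ else 0 := by
  have h1 : ∀ e e', (if Y.snd e = Y.snd e' then Y.twoStep a a' e e' else 0) ≤
      classKernel (Y.FB a a') (Y.kB a a') e' e' * classKernel (Y.FC a a') (Y.kC a a') e' e := by
    intro e e'
    split_ifs with hee
    · unfold twoStep
      rw [Finset.sum_eq_single e', classKernel_symm e e', mul_comm]
      · intro g _ hge
        by_contra hne
        have h1 := classKernel_nonneg (F := Y.FC a a') (k := Y.kC a a') e g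
        have h2 := classKernel_nonneg (F := Y.FB a a') (k := Y.kB a a') g e'
        have hpos := lt_of_le_of_ne (mul_nonneg h1 h2) (Ne.symm hne)
        obtain ⟨c1, c2, c3⟩ := mem_of_classKernel_pos (pos_of_mul_pos_left hpos h2)
        obtain ⟨b1, b2, b3⟩ := mem_of_classKernel_pos (pos_of_mul_pos_right hpos h1)
        exact hge (Y.ext_pair _ _ (Y.rob_B a a' g b1 e' b2 b3).1
          ((Y.rob_C a a' e c1 g c2 c3).1.symm.trans hee))
      · simp
    · exact mul_nonneg (classKernel_nonneg _ _) (classKernel_nonneg _ _)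
  rw [Finset.sum_comm]
  refine Finset.sum_le_sum fun e' _ => (Finset.sum_le_sum fun e _ => h1 e e').trans ?_
  rw [← Finset.mul_sum]
  refine (mul_le_of_le_one_right (classKernel_nonneg _ _) (sum_classKernel_le_one _)).trans
    ((classKernel_self_le Y.t_pos (Y.size_B a a') e').trans ?_)
  by_cases he : e' ∈ Y.FB a a'
  · rw [if_pos he, if_pos (show Y.Inn a a' e' from Y.mem_B a a' e' he)]
  · rw [if_neg he]; split_ifs <;> positivity

end LinkSystem

end linkSystem

/-! ### The symmetrised kernel and its total mass. -/

namespace LinkSystem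

open scoped Classical

variable {S V K : Type*} [Fintype S] [Fintype V] {D t : ℕ} (Y : LinkSystem S V K D t)

/-- Apices of `e` that see the pair `e` robustly together with most other apices. -/
noncomputable def goodApex (e : S) : Finset V :=
  (Y.A e).filter fun a => 8 * ((Y.A e).filter fun a' => e ∉ Y.FC a a').card ≤ D

/-- The steps from `e` to `e'` over the apices `a, a'` that are kept. -/
def Ok (a a' : V) (e e' : S) : Prop :=
  a ≠ a' ∧ Y.fst e ≠ Y.fst e' ∧ Y.snd e ≠ Y.snd e' ∧ (a ∈ Y.goodApex e ∧ a' ∈ Y.goodApex e) ∧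
    (a ∈ Y.goodApex e' ∧ a' ∈ Y.goodApex e')

theorem Ok.symm {a a' : V} {e e' : S} (h : Y.Ok a a' e e') : Y.Ok a a' e' e :=
  ⟨h.1, h.2.1.symm, h.2.2.1.symm, h.2.2.2.2, h.2.2.2.1⟩

/-- The symmetrised normalised kernel. -/
noncomputable def weight (e : S) (l : V × V) (e' : S) : ℝ :=
  if Y.Ok l.1 l.2 e e' then (Y.twoStep l.1 l.2 e e' + Y.twoStep l.1 l.2 e' e) / 2 / D ^ 2 else 0

theorem weight_nonneg (e : S) (l : V × V) (e' : S) : 0 ≤ Y.weight e l e' := by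
  unfold weight
  have h1 := Y.twoStep_nonneg l.1 l.2 e e'
  have h2 := Y.twoStep_nonneg l.1 l.2 e' e
  split_ifs
  · positivity
  · exact le_rfl

theorem weight_symm (e : S) (l : V × V) (e' : S) : Y.weight e l e' = Y.weight e' l e := by
  unfold weight
  rw [show Y.Ok l.1 l.2 e e' ↔ Y.Ok l.1 l.2 e' e from ⟨Ok.symm Y, Ok.symm Y⟩, add_comm]

theorem weight_pos {e : S} {l : V × V} {e' : S} (h : 0 < Y.weight e l e') : Y.Ok l.1 l.2 e e' ∧
    Y.rob l.1 l.2 (Y.fst e) (Y.fst e') ∧ Y.rob l.1 l.2 (Y.snd e) (Y.snd e') := by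
  unfold weight at h
  split_ifs at h with hok
  · refine ⟨hok, ?_⟩
    by_cases h1 : 0 < Y.twoStep l.1 l.2 e e'
    · exact Y.rob_of_twoStep_pos h1
    · have h2 : 0 < Y.twoStep l.1 l.2 e' e := by
        by_contra h2
        have : (Y.twoStep l.1 l.2 e e' + Y.twoStep l.1 l.2 e' e) / 2 / (D : ℝ) ^ 2 ≤ 0 :=
          div_nonpos_of_nonpos_of_nonneg (by linarith) (by positivity)
        linarith
      have := Y.rob_of_twoStep_pos h2
      exact ⟨Y.rob_symm _ _ _ _ this.1, Y.rob_symm _ _ _ _ this.2⟩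
  · exact absurd h (lt_irrefl _)

theorem weight_le (e : S) (l : V × V) (e' : S) :
    Y.weight e l e' ≤ (Y.twoStep l.1 l.2 e e' + Y.twoStep l.1 l.2 e' e) / 2 / D ^ 2 := by
  unfold weight
  have h1 := Y.twoStep_nonneg l.1 l.2 e e'
  have h2 := Y.twoStep_nonneg l.1 l.2 e' e
  split_ifs
  · exact le_rfl
  · positivity

theorem sum_weight_le (e : S) (l : V × V) :
    ∑ e', Y.weight e l e' ≤ if Y.Inn l.1 l.2 e then ((D : ℝ) ^ 2)⁻¹ else 0 := by
  calc ∑ e', Y.weight e l e'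
      ≤ ∑ e', (Y.twoStep l.1 l.2 e e' + Y.twoStep l.1 l.2 e' e) / 2 / D ^ 2 :=
        Finset.sum_le_sum fun e' _ => Y.weight_le e l e'
    _ = (∑ e', Y.twoStep l.1 l.2 e e' + ∑ e', Y.twoStep l.1 l.2 e' e) / 2 / D ^ 2 := by
        rw [← Finset.sum_add_distrib, Finset.sum_div, Finset.sum_div]
    _ ≤ ((if Y.Inn l.1 l.2 e then 1 else 0) + (if Y.Inn l.1 l.2 e then 1 else 0)) / 2 / D ^ 2 := by
        have h1 := Y.sum_twoStep_le l.1 l.2 e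
        have h2 := Y.sum_twoStep_le' l.1 l.2 e
        gcongr
    _ = _ := by split_ifs <;> norm_num

theorem sum_inn (e : S) (c : ℝ) : ∑ l : V × V, (if Y.Inn l.1 l.2 e then c else 0) = D ^ 2 * c := by
  rw [← Finset.sum_filter, Finset.sum_const, nsmul_eq_mul]
  congr 1
  have : (Finset.univ.filter fun l : V × V => Y.Inn l.1 l.2 e) = Y.A e ×ˢ Y.A e := by
    ext l; simp only [Finset.mem_filter, Finset.mem_univ, true_and, Finset.mem_product]; rfl
  rw [this, Finset.card_product, Y.card_A]
  push_cast
  ring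

theorem sum_sum_weight_le (hD : 0 < D) (e : S) : ∑ e', ∑ l, Y.weight e l e' ≤ 1 := by
  rw [Finset.sum_comm]
  refine (Finset.sum_le_sum fun l _ => Y.sum_weight_le e l).trans (le_of_eq ?_)
  rw [sum_inn, mul_inv_cancel₀ (by positivity)]

/-- Labels sharing an apex. -/
def LabelConflict (l m : V × V) : Prop := l.1 = m.1 ∨ l.1 = m.2 ∨ l.2 = m.1 ∨ l.2 = m.2

theorem LabelConflict.symm {l m : V × V} (h : LabelConflict l m) : LabelConflict m l := by
  rcases h with h | h | h | h
  · exact Or.inl h.symm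
  · exact Or.inr (Or.inr (Or.inl h.symm))
  · exact Or.inr (Or.inl h.symm)
  · exact Or.inr (Or.inr (Or.inr h.symm))

/-- At most 4D of the D² ordered pairs of apices of u meet a given pair of apices, and steps over
one pair of apices weigh at most 1 / D². -/
theorem sum_label_conflict_weight (hD : 0 < D) (u : S) (l : V × V) :
    ∑ m, (if LabelConflict l m then ∑ z, Y.weight u m z else 0) ≤ 4 / D := by
  have hsub : (Finset.univ.filter fun m : V × V => LabelConflict l m ∧ Y.Inn m.1 m.2 u) ⊆
      ({l.1, l.2} : Finset V) ×ˢ Y.A u ∪ Y.A u ×ˢ ({l.1, l.2} : Finset V) := by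
    intro m hm
    simp only [Finset.mem_filter, Finset.mem_univ, true_and] at hm
    simp only [Finset.mem_union, Finset.mem_product, Finset.mem_insert, Finset.mem_singleton]
    obtain ⟨h, h1, h2⟩ := hm
    rcases h with h | h | h | h
    · exact Or.inl ⟨Or.inl h.symm, h2⟩
    · exact Or.inr ⟨h1, Or.inl h.symm⟩
    · exact Or.inl ⟨Or.inr h.symm, h2⟩
    · exact Or.inr ⟨h1, Or.inr h.symm⟩
  have hcard : ((Finset.univ.filter fun m : V × V => LabelConflict l m ∧ Y.Inn m.1 m.2 u).card : ℝ) ≤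
      4 * D := by
    have h1 := (Finset.card_le_card hsub).trans (Finset.card_union_le _ _)
    rw [Finset.card_product, Finset.card_product, Y.card_A] at h1
    have h2 : ({l.1, l.2} : Finset V).card ≤ 2 := Finset.card_le_two
    have h3 : ({l.1, l.2} : Finset V).card * D ≤ 2 * D := Nat.mul_le_mul_right _ h2
    have h4 : D * ({l.1, l.2} : Finset V).card ≤ D * 2 := Nat.mul_le_mul_left _ h2
    have : (Finset.univ.filter fun m : V × V => LabelConflict l m ∧ Y.Inn m.1 m.2 u).card ≤ 4 * D := by
      omega
    exact_mod_cast this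
  calc ∑ m, (if LabelConflict l m then ∑ z, Y.weight u m z else 0)
      ≤ ∑ m : V × V, (if LabelConflict l m ∧ Y.Inn m.1 m.2 u then ((D : ℝ) ^ 2)⁻¹ else 0) := by
        refine Finset.sum_le_sum fun m _ => ?_
        by_cases hc : LabelConflict l m
        · simp only [hc, if_true, true_and]; exact Y.sum_weight_le u m
        · simp [hc]
    _ = ((Finset.univ.filter fun m : V × V => LabelConflict l m ∧ Y.Inn m.1 m.2 u).card : ℝ) *
        ((D : ℝ) ^ 2)⁻¹ := by rw [← Finset.sum_filter, Finset.sum_const, nsmul_eq_mul]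
    _ ≤ 4 * D * ((D : ℝ) ^ 2)⁻¹ := by gcongr
    _ = 4 / D := by
        have : (D : ℝ) ≠ 0 := by positivity
        field_simp

/-- The number of (apices, pair) incidences lost in the classifications at second vertices. -/
noncomputable def lossC : ℕ :=
  ∑ l : V × V, (Finset.univ.filter fun e => Y.Inn l.1 l.2 e ∧ e ∉ Y.FC l.1 l.2).card

/-- The number of (apices, pair) incidences lost in the classifications at first vertices. -/
noncomputable def lossB : ℕ :=
  ∑ l : V × V, (Finset.univ.filter fun e => Y.Inn l.1 l.2 e ∧ e ∉ Y.FB l.1 l.2).card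

/-- An apex that is not good is charged D incidences on the left but accounts for more than D / 8
lost ones on the right. -/
theorem sum_not_good_le (e : S) :
    ∑ l : V × V, (if Y.Inn l.1 l.2 e ∧ l.1 ∉ Y.goodApex e then (1 : ℝ) else 0) ≤
      8 * ∑ l : V × V, (if Y.Inn l.1 l.2 e ∧ e ∉ Y.FC l.1 l.2 then (1 : ℝ) else 0) := by
  simp only [Fintype.sum_prod_type, Finset.mul_sum (s := Finset.univ (α := V))]
  refine Finset.sum_le_sum fun a _ => ?_
  rw [← Finset.mul_sum]
  by_cases ha : a ∈ Y.A e
  · by_cases hg : a ∈ Y.goodApex e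
    · simp only [hg, not_true_eq_false, and_false, if_false, Finset.sum_const_zero]
      exact mul_nonneg (by norm_num) (Finset.sum_nonneg fun a' _ => by split_ifs <;> norm_num)
    · have h1 : D < 8 * ((Y.A e).filter fun a' => e ∉ Y.FC a a').card := by
        by_contra h
        exact hg (Finset.mem_filter.2 ⟨ha, not_lt.1 h⟩)
      have h2 : ∑ a' : V, (if Y.Inn a a' e ∧ a ∉ Y.goodApex e then (1 : ℝ) else 0) = D := by
        rw [Finset.sum_boole]
        have h : (Finset.univ.filter fun a' => Y.Inn a a' e ∧ a ∉ Y.goodApex e) = Y.A e := by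
          ext a'
          simp only [Finset.mem_filter, Finset.mem_univ, true_and]
          exact ⟨fun h => h.1.2, fun h => ⟨⟨ha, h⟩, hg⟩⟩
        rw [h, Y.card_A]
      have h3 : ∑ a' : V, (if Y.Inn a a' e ∧ e ∉ Y.FC a a' then (1 : ℝ) else 0) =
          ((Y.A e).filter fun a' => e ∉ Y.FC a a').card := by
        rw [Finset.sum_boole]
        congr 2
        ext a'
        simp only [Finset.mem_filter, Finset.mem_univ, true_and]
        exact ⟨fun h => ⟨h.1.2, h.2⟩, fun h => ⟨⟨ha, h.1⟩, h.2⟩⟩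
      rw [h2, h3]
      exact_mod_cast h1.le
  · simp [Inn, ha]

theorem sum_not_good_le' (e : S) :
    ∑ l : V × V, (if Y.Inn l.1 l.2 e ∧ l.2 ∉ Y.goodApex e then (1 : ℝ) else 0) ≤
      8 * ∑ l : V × V, (if Y.Inn l.1 l.2 e ∧ e ∉ Y.FC l.1 l.2 then (1 : ℝ) else 0) := by
  refine le_trans (le_of_eq ?_) (Y.sum_not_good_le e)
  refine Fintype.sum_equiv (Equiv.prodComm V V) _ _ fun l => ?_
  simp only [Equiv.prodComm_apply, Prod.fst_swap, Prod.snd_swap, Inn, and_comm]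

theorem sum_twoStep_of_start_le (p : V × V → S → Prop)
    [∀ l e, Decidable (p l e)] :
    ∑ l : V × V, ∑ e, ∑ e', (if p l e then Y.twoStep l.1 l.2 e e' else 0) ≤
      ∑ e, ∑ l : V × V, if Y.Inn l.1 l.2 e ∧ p l e then (1 : ℝ) else 0 := by
  rw [Finset.sum_comm]
  refine Finset.sum_le_sum fun e _ => Finset.sum_le_sum fun l _ => ?_
  by_cases h : p l e
  · simp only [h, if_true, and_true]
    exact Y.sum_twoStep_le l.1 l.2 e
  · simp [h]

theorem sum_twoStep_of_end_le (p : V × V → S → Prop)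
    [∀ l e, Decidable (p l e)] :
    ∑ l : V × V, ∑ e, ∑ e', (if p l e' then Y.twoStep l.1 l.2 e e' else 0) ≤
      ∑ e, ∑ l : V × V, if Y.Inn l.1 l.2 e ∧ p l e then (1 : ℝ) else 0 := by
  rw [Finset.sum_comm (s := (Finset.univ : Finset S))]
  refine Finset.sum_le_sum fun l _ => ?_
  rw [Finset.sum_comm]
  refine Finset.sum_le_sum fun e _ => ?_
  by_cases h : p l e
  · simp only [h, if_true, and_true]
    exact Y.sum_twoStep_le' l.1 l.2 e
  · simp [h]

theorem sum_lossC : ∑ e, ∑ l : V × V,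
    (if Y.Inn l.1 l.2 e ∧ e ∉ Y.FC l.1 l.2 then (1 : ℝ) else 0) = Y.lossC := by
  rw [Finset.sum_comm, lossC]
  push_cast
  exact Finset.sum_congr rfl fun l _ => Finset.sum_boole _ _

theorem sum_card_le : (Fintype.card S : ℝ) * D ^ 2 ≤
    ∑ l : V × V, ((Y.FC l.1 l.2 ∩ Y.FB l.1 l.2).card : ℝ) + Y.lossC + Y.lossB := by
  have h1 : (Fintype.card S : ℝ) * D ^ 2 =
      ∑ l : V × V, ((Finset.univ.filter fun e => Y.Inn l.1 l.2 e).card : ℝ) := by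
    simp only [← Finset.sum_boole]
    rw [Finset.sum_comm, Finset.sum_congr rfl fun e _ => Y.sum_inn e 1]
    simp
  rw [h1, lossC, lossB]
  push_cast
  rw [← Finset.sum_add_distrib, ← Finset.sum_add_distrib]
  refine Finset.sum_le_sum fun l _ => ?_
  have h2 : (Finset.univ.filter fun e => Y.Inn l.1 l.2 e) ⊆ (Y.FC l.1 l.2 ∩ Y.FB l.1 l.2 ∪
      Finset.univ.filter fun e => Y.Inn l.1 l.2 e ∧ e ∉ Y.FC l.1 l.2) ∪
      Finset.univ.filter fun e => Y.Inn l.1 l.2 e ∧ e ∉ Y.FB l.1 l.2 := by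
    intro e he
    simp only [Finset.mem_filter, Finset.mem_univ, true_and, Finset.mem_union,
      Finset.mem_inter] at he ⊢
    tauto
  have h3 := (Finset.card_le_card h2).trans ((Finset.card_union_le _ _).trans
    (Nat.add_le_add_right (Finset.card_union_le _ _) _))
  exact_mod_cast h3

theorem sum_inn_same (e : S) :
    ∑ l : V × V, (if Y.Inn l.1 l.2 e ∧ l.1 = l.2 then (1 : ℝ) else 0) = D := by
  have h : (Finset.univ.filter fun l : V × V => Y.Inn l.1 l.2 e ∧ l.1 = l.2) =
      (Y.A e).diag := by
    ext l
    simp only [Finset.mem_filter, Finset.mem_univ, true_and, Finset.mem_diag]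
    exact ⟨fun h => ⟨h.1.1, h.2⟩, fun h => ⟨⟨h.1, h.2 ▸ h.1⟩, h.2⟩⟩
  rw [Finset.sum_boole, h, Finset.diag_card, Y.card_A]

/-- In units of |S| D², the total mass is at least 1 minus the losses (1/100). Removed are steps
with equal apices (1/100), steps repeating the first or the second vertex (1/96 each), and steps
with an apex that is not good at one end, four cases of at most 8/100 each. More than one half
remains. -/
theorem le_sum_weight (ht : 96 ≤ t) (hD : 100 ≤ D)
    (hloss : 100 * (Y.lossC + Y.lossB) ≤ Fintype.card S * D ^ 2) :
    (Fintype.card S : ℝ) / 2 ≤ ∑ e, ∑ e', ∑ l, Y.weight e l e' := by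
  have hD' : (100 : ℝ) ≤ D := by exact_mod_cast hD
  have ht' : (t : ℝ)⁻¹ ≤ 1 / 96 := by
    rw [one_div]; exact inv_anti₀ (by norm_num) (by exact_mod_cast ht)
  have hl : 100 * ((Y.lossC : ℝ) + Y.lossB) ≤ Fintype.card S * D ^ 2 := by exact_mod_cast hloss
  have hB0 : (0 : ℝ) ≤ Y.lossB := Nat.cast_nonneg _
  have hsym : ∑ e, ∑ e', ∑ l, Y.weight e l e' = (∑ l : V × V, ∑ e, ∑ e',
      if Y.Ok l.1 l.2 e e' then Y.twoStep l.1 l.2 e e' else 0) / D ^ 2 := by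
    have h1 : ∑ e, ∑ e', ∑ l, Y.weight e l e' = ∑ l, ∑ e, ∑ e', Y.weight e l e' := by
      rw [Finset.sum_comm (s := (Finset.univ : Finset (V × V)))]
      exact Finset.sum_congr rfl fun e _ => Finset.sum_comm
    rw [h1, Finset.sum_div]
    refine Finset.sum_congr rfl fun l _ => ?_
    have h2 : ∑ e, ∑ e', (if Y.Ok l.1 l.2 e e' then Y.twoStep l.1 l.2 e' e else 0) =
        ∑ e, ∑ e', (if Y.Ok l.1 l.2 e e' then Y.twoStep l.1 l.2 e e' else 0) := by
      rw [Finset.sum_comm]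
      refine Finset.sum_congr rfl fun e _ => Finset.sum_congr rfl fun e' _ => ?_
      rw [show Y.Ok l.1 l.2 e e' ↔ Y.Ok l.1 l.2 e' e from ⟨Ok.symm Y, Ok.symm Y⟩]
    have h3 : ∀ e e', Y.weight e l e' = ((if Y.Ok l.1 l.2 e e' then Y.twoStep l.1 l.2 e e' else 0) +
        (if Y.Ok l.1 l.2 e e' then Y.twoStep l.1 l.2 e' e else 0)) / 2 / D ^ 2 := by
      intro e e'
      unfold weight
      split_ifs <;> simp
    simp only [h3, ← Finset.sum_div, Finset.sum_add_distrib]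
    rw [h2]
    ring
  have hpt : ∀ (l : V × V) (e e' : S), Y.twoStep l.1 l.2 e e' ≤
      (if Y.Ok l.1 l.2 e e' then Y.twoStep l.1 l.2 e e' else 0) +
      (if l.1 = l.2 then Y.twoStep l.1 l.2 e e' else 0) +
      (if Y.fst e = Y.fst e' then Y.twoStep l.1 l.2 e e' else 0) +
      (if Y.snd e = Y.snd e' then Y.twoStep l.1 l.2 e e' else 0) +
      (if l.1 ∉ Y.goodApex e then Y.twoStep l.1 l.2 e e' else 0) +
      (if l.2 ∉ Y.goodApex e then Y.twoStep l.1 l.2 e e' else 0) +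
      (if l.1 ∉ Y.goodApex e' then Y.twoStep l.1 l.2 e e' else 0) +
      (if l.2 ∉ Y.goodApex e' then Y.twoStep l.1 l.2 e e' else 0) := by
    intro l e e'
    have h0 := Y.twoStep_nonneg l.1 l.2 e e'
    have hi : ∀ (p : Prop) [Decidable p], 0 ≤ if p then Y.twoStep l.1 l.2 e e' else 0 := fun p _ => by
      split_ifs
      · exact h0
      · exact le_rfl
    have hi' : ∀ (p : Prop) [Decidable p], p →
        (if p then Y.twoStep l.1 l.2 e e' else 0) = Y.twoStep l.1 l.2 e e' :=
      fun p _ hp => if_pos hp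
    have g1 := hi (Y.Ok l.1 l.2 e e')
    have g2 := hi (l.1 = l.2)
    have g3 := hi (Y.fst e = Y.fst e')
    have g4 := hi (Y.snd e = Y.snd e')
    have g5 := hi (l.1 ∉ Y.goodApex e)
    have g6 := hi (l.2 ∉ Y.goodApex e)
    have g7 := hi (l.1 ∉ Y.goodApex e')
    have g8 := hi (l.2 ∉ Y.goodApex e')
    by_cases p1 : l.1 = l.2
    · have := hi' _ p1; linarith
    by_cases p2 : Y.fst e = Y.fst e'
    · have := hi' _ p2; linarith
    by_cases p3 : Y.snd e = Y.snd e'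
    · have := hi' _ p3; linarith
    by_cases p4 : l.1 ∉ Y.goodApex e
    · have := hi' _ p4; linarith
    by_cases p5 : l.2 ∉ Y.goodApex e
    · have := hi' _ p5; linarith
    by_cases p6 : l.1 ∉ Y.goodApex e'
    · have := hi' _ p6; linarith
    by_cases p7 : l.2 ∉ Y.goodApex e'
    · have := hi' _ p7; linarith
    have := hi' _ (show Y.Ok l.1 l.2 e e' from
      ⟨p1, p2, p3, ⟨not_not.1 p4, not_not.1 p5⟩, not_not.1 p6, not_not.1 p7⟩)
    linarith
  have hsum := Finset.sum_le_sum fun (l : V × V) (_ : l ∈ Finset.univ) =>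
    Finset.sum_le_sum fun (e : S) (_ : e ∈ Finset.univ) =>
      Finset.sum_le_sum fun (e' : S) (_ : e' ∈ Finset.univ) => hpt l e e'
  simp only [Finset.sum_add_distrib, sum_sum_twoStep] at hsum
  have a1 := Y.sum_card_le
  have a2 := (Y.sum_twoStep_of_start_le fun l _ => l.1 = l.2).trans
    (le_of_eq (Finset.sum_congr rfl fun e _ => Y.sum_inn_same e))
  rw [Finset.sum_const, Finset.card_univ, nsmul_eq_mul] at a2
  have hin : ∑ l : V × V, ∑ e, (if Y.Inn l.1 l.2 e then (t : ℝ)⁻¹ else 0) =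
      Fintype.card S * (D ^ 2 * (t : ℝ)⁻¹) := by
    rw [Finset.sum_comm]
    simp [sum_inn]
  have a3 := (Finset.sum_le_sum fun (l : V × V) (_ : l ∈ Finset.univ) =>
    Y.sum_twoStep_same_fst l.1 l.2).trans hin.le
  have a4 := (Finset.sum_le_sum fun (l : V × V) (_ : l ∈ Finset.univ) =>
    Y.sum_twoStep_same_snd l.1 l.2).trans hin.le
  have hC : ∑ e, 8 * ∑ l : V × V,
      (if Y.Inn l.1 l.2 e ∧ e ∉ Y.FC l.1 l.2 then (1 : ℝ) else 0) = 8 * Y.lossC := by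
    rw [← Finset.mul_sum, sum_lossC]
  have b1 := (Finset.sum_le_sum fun (e : S) (_ : e ∈ Finset.univ) => Y.sum_not_good_le e).trans hC.le
  have b2 := (Finset.sum_le_sum fun (e : S) (_ : e ∈ Finset.univ) => Y.sum_not_good_le' e).trans hC.le
  have a5 := (Y.sum_twoStep_of_start_le fun l e => l.1 ∉ Y.goodApex e).trans b1
  have a6 := (Y.sum_twoStep_of_start_le fun l e => l.2 ∉ Y.goodApex e).trans b2
  have a7 := (Y.sum_twoStep_of_end_le fun l e => l.1 ∉ Y.goodApex e).trans b1
  have a8 := (Y.sum_twoStep_of_end_le fun l e => l.2 ∉ Y.goodApex e).trans b2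
  have hS0 : (0 : ℝ) ≤ Fintype.card S := Nat.cast_nonneg _
  have c1 : (Fintype.card S : ℝ) * (D ^ 2 * (t : ℝ)⁻¹) ≤ Fintype.card S * D ^ 2 * (1 / 96) := by
    rw [mul_assoc]; gcongr
  have c2 : (Fintype.card S : ℝ) * D * 100 ≤ Fintype.card S * D ^ 2 := by
    rw [pow_two, ← mul_assoc]; gcongr
  rw [hsym, le_div_iff₀ (by positivity)]
  linarith

end LinkSystem

/-! ### Four-cycles in dense graphs. -/

section fourCycle

open scoped Classical

/-- Without a 4-cycle any two distinct vertices have at most one common neighbour, so the squares of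
the degrees add up to at most 2 |A|². Cauchy–Schwarz bounds the square of the number of ordered
adjacent pairs by 2 |A|³. -/
theorem exists_four_cycle {V : Type*} (A : Finset V) {r : V → V → Prop}
    [∀ a b, Decidable (r a b)] (hr : ∀ a b, r a b → a ≠ b)
    (hs : ∀ a b, r a b → r b a)
    (h : 2 * A.card ^ 3 < ((A ×ˢ A).filter fun l => r l.1 l.2).card ^ 2) :
    ∃ a b c d, [a, b, c, d].Nodup ∧ r a b ∧ r b c ∧ r c d ∧ r d a := by
  by_contra hno
  have hco : ∀ u v, u ≠ v → (A.filter fun a => r a u ∧ r a v).card ≤ 1 := by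
    intro u v huv
    refine Finset.card_le_one.2 fun a ha b hb => ?_
    simp only [Finset.mem_filter] at ha hb
    by_contra hab
    refine hno ⟨a, u, b, v, ?_, ha.2.1, hs _ _ hb.2.1, hb.2.2, hs _ _ ha.2.2⟩
    have h1 := hr _ _ ha.2.1
    have h2 := hr _ _ ha.2.2
    have h3 := hr _ _ hb.2.1
    have h4 := hr _ _ hb.2.2
    simp [h1, h2, hab, h3.symm, h4, huv]
  have hN : ((A ×ˢ A).filter fun l => r l.1 l.2).card = ∑ a ∈ A, (A.filter fun b => r a b).card := by
    rw [Finset.card_filter, Finset.sum_product]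
    exact Finset.sum_congr rfl fun a _ => (Finset.card_filter _ _).symm
  have hsq : ∑ a ∈ A, (A.filter fun b => r a b).card ^ 2 =
      ∑ l ∈ A ×ˢ A, (A.filter fun a => r a l.1 ∧ r a l.2).card := by
    simp only [Finset.card_filter (fun a => r a _ ∧ r a _)]
    rw [Finset.sum_comm]
    refine Finset.sum_congr rfl fun a _ => ?_
    rw [pow_two, ← Finset.card_product, ← Finset.card_filter]
    congr 1
    ext l
    simp only [Finset.mem_filter, Finset.mem_product]
    tauto
  have hle : ∑ l ∈ A ×ˢ A, (A.filter fun a => r a l.1 ∧ r a l.2).card ≤ 2 * A.card ^ 2 := by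
    calc ∑ l ∈ A ×ˢ A, (A.filter fun a => r a l.1 ∧ r a l.2).card
        ≤ ∑ l ∈ A ×ˢ A, (1 + if l.1 = l.2 then A.card else 0) := by
          refine Finset.sum_le_sum fun l _ => ?_
          split_ifs with hl
          · exact (Finset.card_le_card (Finset.filter_subset _ _)).trans (Nat.le_add_left _ _)
          · exact hco _ _ hl
      _ = 2 * A.card ^ 2 := by
          rw [Finset.sum_add_distrib, Finset.sum_product (f := fun l => if l.1 = l.2 then A.card else 0)]
          have : ∀ a ∈ A, ∑ b ∈ A, (if a = b then A.card else 0) = A.card := fun a ha => by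
            simp [ha]
          rw [Finset.sum_congr rfl this]
          simp
          ring
  have hcs : (∑ a ∈ A, (A.filter fun b => r a b).card) ^ 2 ≤
      A.card * ∑ a ∈ A, (A.filter fun b => r a b).card ^ 2 := sq_sum_le_card_mul_sum_sq
  rw [hN] at h
  rw [hsq] at hcs
  have := hcs.trans (Nat.mul_le_mul_left A.card hle)
  have e : A.card * (2 * A.card ^ 2) = 2 * A.card ^ 3 := by ring
  omega

end fourCycle

/-! ### Popular vertices: either they are negligible or four apices share a robust quadruple. -/

namespace LinkSystem

open scoped Classical

variable {S V K : Type*} [Fintype S] [Fintype V] {D t : ℕ} (Y : LinkSystem S V K D t) (m : ℕ)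

/-- The vertices that a random step from `e` meets with probability at least `1 / m`. -/
noncomputable def popular (e : S) : Finset V :=
  Finset.univ.filter fun v =>
    1 ≤ (m : ℝ) * ∑ e', if Y.fst e' = v ∨ Y.snd e' = v then ∑ l, Y.weight e l e' else 0

/-- The pair `e'` has a vertex that is popular for `e`. -/
def HitsPopular (e e' : S) : Prop := Y.fst e' ∈ Y.popular m e ∨ Y.snd e' ∈ Y.popular m e

theorem sum_weight_label_nonneg (e e' : S) : 0 ≤ ∑ l, Y.weight e l e' :=
  Finset.sum_nonneg fun l _ => Y.weight_nonneg e l e'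

/-- A step has total probability at most 1 and meets at most two vertices, so at most 2m vertices
can be met with probability 1 / m or more. -/
theorem card_popular_le (hD : 0 < D) (e : S) : (Y.popular m e).card ≤ 2 * m := by
  have h : ((Y.popular m e).card : ℝ) ≤ 2 * m := by
    calc ((Y.popular m e).card : ℝ) = ∑ v ∈ Y.popular m e, 1 := by simp
      _ ≤ ∑ v ∈ Y.popular m e, (m : ℝ) *
          ∑ e', (if Y.fst e' = v ∨ Y.snd e' = v then ∑ l, Y.weight e l e' else 0) :=
          Finset.sum_le_sum fun v hv => (Finset.mem_filter.1 hv).2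
      _ ≤ ∑ v, (m : ℝ) *
          ∑ e', (if Y.fst e' = v ∨ Y.snd e' = v then ∑ l, Y.weight e l e' else 0) := by
          refine Finset.sum_le_sum_of_subset_of_nonneg (Finset.subset_univ _) fun v _ _ => ?_
          refine mul_nonneg (Nat.cast_nonneg _) (Finset.sum_nonneg fun e' _ => ?_)
          split_ifs
          · exact Y.sum_weight_label_nonneg e e'
          · exact le_rfl
      _ = m * ∑ e', ∑ v, (if Y.fst e' = v ∨ Y.snd e' = v then ∑ l, Y.weight e l e' else 0) := by
          rw [← Finset.mul_sum, Finset.sum_comm]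
      _ ≤ m * ∑ e', 2 * ∑ l, Y.weight e l e' := by
          refine mul_le_mul_of_nonneg_left (Finset.sum_le_sum fun e' _ => ?_) (Nat.cast_nonneg _)
          have h0 := Y.sum_weight_label_nonneg e e'
          have h1 : ∀ v, (if Y.fst e' = v ∨ Y.snd e' = v then ∑ l, Y.weight e l e' else 0) ≤
              (if Y.fst e' = v then ∑ l, Y.weight e l e' else 0) +
              (if Y.snd e' = v then ∑ l, Y.weight e l e' else 0) := by
            intro v
            by_cases p : Y.fst e' = v <;> by_cases q : Y.snd e' = v <;> simp [p, q, h0]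
          refine (Finset.sum_le_sum fun v _ => h1 v).trans (le_of_eq ?_)
          rw [Finset.sum_add_distrib]
          simp
          ring
      _ ≤ m * (2 * 1) := by
          rw [← Finset.mul_sum]
          have := Y.sum_sum_weight_le hD e
          gcongr
      _ = 2 * m := by ring
  exact_mod_cast h

/-- The weight with all steps to popular vertices removed. -/
noncomputable def unpopularWeight (e : S) (l : V × V) (e' : S) : ℝ :=
  if Y.HitsPopular m e e' ∨ Y.HitsPopular m e' e then 0 else Y.weight e l e'

theorem unpopularWeight_nonneg (e : S) (l : V × V) (e' : S) : 0 ≤ Y.unpopularWeight m e l e' := by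
  unfold unpopularWeight
  split_ifs
  · exact le_rfl
  · exact Y.weight_nonneg _ _ _

theorem unpopularWeight_le (e : S) (l : V × V) (e' : S) :
    Y.unpopularWeight m e l e' ≤ Y.weight e l e' := by
  unfold unpopularWeight
  split_ifs
  · exact Y.weight_nonneg _ _ _
  · exact le_rfl

theorem unpopularWeight_symm (e : S) (l : V × V) (e' : S) :
    Y.unpopularWeight m e l e' = Y.unpopularWeight m e' l e := by
  unfold unpopularWeight
  rw [Y.weight_symm e l e']
  by_cases p : Y.HitsPopular m e e' <;> by_cases q : Y.HitsPopular m e' e <;> simp [p, q]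

/-- Pairs sharing a vertex. -/
def PairConflict (e e' : S) : Prop := Y.fst e = Y.fst e' ∨ Y.snd e = Y.snd e'

theorem PairConflict.symm {e e' : S} (h : Y.PairConflict e e') : Y.PairConflict e' e :=
  h.imp Eq.symm Eq.symm

/-- Either v is popular for u and all steps from u to v have been deleted, or v is met with
probability below 1 / m. -/
theorem sum_unpopular_at_le (hm : 0 < m) (u : S) (v : V) {p : S → Prop} [DecidablePred p]
    (hp : ∀ z, p z → Y.fst z = v ∨ Y.snd z = v) :
    ∑ z, (if p z then ∑ l, Y.unpopularWeight m u l z else 0) ≤ 1 / m := by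
  have hm' : (0 : ℝ) < m := by exact_mod_cast hm
  by_cases hv : v ∈ Y.popular m u
  · rw [Finset.sum_eq_zero]
    · positivity
    · intro z _
      split_ifs with hz
      · refine Finset.sum_eq_zero fun l _ => if_pos (Or.inl ?_)
        rcases hp z hz with h | h
        · exact Or.inl (h ▸ hv)
        · exact Or.inr (h ▸ hv)
      · rfl
  · have h1 : (m : ℝ) * ∑ e', (if Y.fst e' = v ∨ Y.snd e' = v then ∑ l, Y.weight u l e' else 0) < 1 := by
      by_contra h
      exact hv (Finset.mem_filter.2 ⟨Finset.mem_univ _, not_lt.1 h⟩)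
    have h2 : ∑ e', (if Y.fst e' = v ∨ Y.snd e' = v then ∑ l, Y.weight u l e' else 0) ≤ 1 / m := by
      rw [le_div_iff₀ hm']; linarith
    refine le_trans (Finset.sum_le_sum fun z _ => ?_) h2
    by_cases hz : p z
    · rw [if_pos hz, if_pos (hp z hz)]
      exact Finset.sum_le_sum fun l _ => Y.unpopularWeight_le m u l z
    · rw [if_neg hz]
      split_ifs
      · exact Y.sum_weight_label_nonneg u z
      · exact le_rfl

theorem sum_pair_conflict_le (hm : 0 < m) (u y : S) :
    ∑ z, (if Y.PairConflict y z then ∑ l, Y.unpopularWeight m u l z else 0) ≤ 2 / m := by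
  have h1 := Y.sum_unpopular_at_le m hm u (Y.fst y) (p := fun z => Y.fst y = Y.fst z)
    fun z hz => Or.inl hz.symm
  have h2 := Y.sum_unpopular_at_le m hm u (Y.snd y) (p := fun z => Y.snd y = Y.snd z)
    fun z hz => Or.inr hz.symm
  have h3 : ∀ z, (if Y.PairConflict y z then ∑ l, Y.unpopularWeight m u l z else 0) ≤
      (if Y.fst y = Y.fst z then ∑ l, Y.unpopularWeight m u l z else 0) +
      (if Y.snd y = Y.snd z then ∑ l, Y.unpopularWeight m u l z else 0) := by
    intro z
    have h0 : 0 ≤ ∑ l, Y.unpopularWeight m u l z :=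
      Finset.sum_nonneg fun l _ => Y.unpopularWeight_nonneg m u l z
    by_cases p : Y.fst y = Y.fst z <;> by_cases q : Y.snd y = Y.snd z <;>
      simp [PairConflict, p, q, h0]
  refine (Finset.sum_le_sum fun z _ => h3 z).trans ?_
  rw [Finset.sum_add_distrib]
  calc _ ≤ 1 / (m : ℝ) + 1 / m := add_le_add h1 h2
    _ = 2 / m := by ring

/-- The mass of the steps to popular vertices. -/
noncomputable def popularMass : ℝ :=
  ∑ e, ∑ e', if Y.HitsPopular m e e' then ∑ l, Y.weight e l e' else 0

theorem le_sum_unpopularWeight : ∑ e, ∑ e', ∑ l, Y.weight e l e' - 2 * Y.popularMass m ≤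
    ∑ e, ∑ e', ∑ l, Y.unpopularWeight m e l e' := by
  have h1 : Y.popularMass m = ∑ e, ∑ e', if Y.HitsPopular m e' e then ∑ l, Y.weight e l e' else 0 := by
    rw [popularMass, Finset.sum_comm]
    refine Finset.sum_congr rfl fun e _ => Finset.sum_congr rfl fun e' _ => ?_
    simp only [Y.weight_symm e]
  have h2 : ∀ e e', ∑ l, Y.weight e l e' ≤ ∑ l, Y.unpopularWeight m e l e' +
      (if Y.HitsPopular m e e' then ∑ l, Y.weight e l e' else 0) +
      (if Y.HitsPopular m e' e then ∑ l, Y.weight e l e' else 0) := by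
    intro e e'
    have h0 := Y.sum_weight_label_nonneg e e'
    by_cases p : Y.HitsPopular m e e' <;> by_cases q : Y.HitsPopular m e' e <;>
      simp [unpopularWeight, p, q, h0]
  have h3 := Finset.sum_le_sum fun (e : S) (_ : e ∈ Finset.univ) =>
    Finset.sum_le_sum fun (e' : S) (_ : e' ∈ Finset.univ) => h2 e e'
  simp only [Finset.sum_add_distrib] at h3
  rw [← h1] at h3
  have : Y.popularMass m = ∑ e, ∑ e', if Y.HitsPopular m e e' then ∑ l, Y.weight e l e' else 0 := rfl
  rw [← this] at h3
  linarith

/-- A walk through pairs without common vertices over label pairs without common apices. -/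
theorem exists_closed_walk_of_unpopular [Nonempty S] (hm : 0 < m) (hmD : 2 * m ≤ D)
    (hmass : (Fintype.card S : ℝ) / 2 ≤ ∑ e, ∑ e', ∑ l, Y.weight e l e')
    (hpop : Y.popularMass m ≤ Fintype.card S / 8) (r : ℕ)
    (hcount : Fintype.card S * (2 * (8 * 4 ^ r) ^ 2 * (2 / m : ℝ)) ^ r < (1 / 4) ^ 2 ^ (2 * r + 1)) :
    ∃ (k : ℕ) (_ : NeZero k) (x : Fin k → S) (l : Fin k → V × V), 2 ≤ k ∧ k ≤ 8 * 4 ^ r ∧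
      (∀ i, 0 < Y.weight (x i) (l i) (x (i + 1))) ∧
      (∀ i j, i ≠ j → ¬ Y.PairConflict (x i) (x j)) ∧
      (∀ i j, i ≠ j → ¬ LabelConflict (l i) (l j)) := by
  have hD : 0 < D := by omega
  have hm' : (0 : ℝ) < m := by exact_mod_cast hm
  -- The value ρ = 1/4 is the mass 1/2 minus twice the popular mass 1/8. Two vertices per pair give
  -- η = 2 / m; label conflicts cost 4 / D, which is no more since 2m ≤ D.
  obtain ⟨k, hk, x, l, h2, hle, hw, hc, hl⟩ := exists_closed_walk (w := Y.unpopularWeight m)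
    (CE := Y.PairConflict) (CL := LabelConflict) (η := 2 / m) (ρ := 1 / 4)
    (Y.unpopularWeight_nonneg m) (Y.unpopularWeight_symm m)
    (fun x => (Finset.sum_le_sum fun y _ => Finset.sum_le_sum fun s _ =>
      Y.unpopularWeight_le m x s y).trans (Y.sum_sum_weight_le hD x))
    (fun _ _ => PairConflict.symm Y) (fun _ _ => LabelConflict.symm) (by positivity)
    (Y.sum_pair_conflict_le m hm)
    (fun u s => by
      refine (Finset.sum_le_sum fun z _ => ?_).trans ((Y.sum_label_conflict_weight hD u s).trans ?_)
      · split_ifs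
        · exact Finset.sum_le_sum fun y _ => Y.unpopularWeight_le m u z y
        · exact le_rfl
      · rw [div_le_div_iff₀ (by exact_mod_cast hD) hm']
        have : (2 * m : ℝ) ≤ D := by exact_mod_cast hmD
        linarith)
    (by norm_num)
    (by
      have := Y.le_sum_unpopularWeight m
      linarith) r hcount
  exact ⟨k, hk, x, l, h2, hle, fun i => (hw i).trans_le (Y.unpopularWeight_le m _ _ _), hc, hl⟩

/-- Four vertices of `P` that are robustly joined over `a, a'`. -/
def RobustQuad (P : Finset V) (a a' : V) : Prop :=
  ∃ x : Fin 4 → V, Function.Injective x ∧ (∀ i, x i ∈ P) ∧ ∀ i j, Y.rob a a' (x i) (x j)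

variable {Y}

/-- Pairs of one class share the second vertex, so they have distinct first vertices, which are
pairwise robust. Four of them in P would be a robust quadruple. -/
theorem card_class_C_le {P : Finset V} {a a' : V} (h : ¬ Y.RobustQuad P a a') (e : S) :
    ((Y.FC a a').filter fun g => Y.kC a a' g = Y.kC a a' e ∧ Y.fst g ∈ P).card ≤ 3 := by
  by_contra hcard
  obtain ⟨f, hf⟩ := Function.Embedding.exists_of_card_le_finset (α := Fin 4)
    (s := (Y.FC a a').filter fun g => Y.kC a a' g = Y.kC a a' e ∧ Y.fst g ∈ P)
    (by rw [Fintype.card_fin]; omega)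
  have hf' : ∀ i, f i ∈ Y.FC a a' ∧ Y.kC a a' (f i) = Y.kC a a' e ∧ Y.fst (f i) ∈ P := fun i =>
    Finset.mem_filter.1 (hf ⟨i, rfl⟩)
  have hij := fun i j => Y.rob_C a a' _ (hf' i).1 _ (hf' j).1 ((hf' i).2.1.trans (hf' j).2.1.symm)
  exact h ⟨fun i => Y.fst (f i), fun i j h => f.injective (Y.ext_pair _ _ h (hij i j).1),
    fun i => (hf' i).2.2, fun i j => (hij i j).2⟩

theorem card_class_B_le {P : Finset V} {a a' : V} (h : ¬ Y.RobustQuad P a a') (e : S) :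
    ((Y.FB a a').filter fun g => Y.kB a a' g = Y.kB a a' e ∧ Y.snd g ∈ P).card ≤ 3 := by
  by_contra hcard
  obtain ⟨f, hf⟩ := Function.Embedding.exists_of_card_le_finset (α := Fin 4)
    (s := (Y.FB a a').filter fun g => Y.kB a a' g = Y.kB a a' e ∧ Y.snd g ∈ P)
    (by rw [Fintype.card_fin]; omega)
  have hf' : ∀ i, f i ∈ Y.FB a a' ∧ Y.kB a a' (f i) = Y.kB a a' e ∧ Y.snd (f i) ∈ P := fun i =>
    Finset.mem_filter.1 (hf ⟨i, rfl⟩)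
  have hij := fun i j => Y.rob_B a a' _ (hf' i).1 _ (hf' j).1 ((hf' i).2.1.trans (hf' j).2.1.symm)
  exact h ⟨fun i => Y.snd (f i), fun i j h => f.injective (Y.ext_pair _ _ (hij i j).1 h),
    fun i => (hf' i).2.2, fun i j => (hij i j).2⟩

theorem sum_classKernel_C_popular_le {P : Finset V} {a a' : V} (h : ¬ Y.RobustQuad P a a') (e : S) :
    ∑ g, (if Y.fst g ∈ P then classKernel (Y.FC a a') (Y.kC a a') e g else 0) ≤ 3 / t := by
  have := sum_classKernel_if_le (m := 3) Y.t_pos (Y.size_C a a') (p := fun g => Y.fst g ∈ P)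
    (fun e _ => card_class_C_le h e) e
  exact_mod_cast this

theorem sum_classKernel_B_popular_le {P : Finset V} {a a' : V} (h : ¬ Y.RobustQuad P a a') (e : S) :
    ∑ g, (if Y.snd g ∈ P then classKernel (Y.FB a a') (Y.kB a a') e g else 0) ≤ 3 / t := by
  have := sum_classKernel_if_le (m := 3) Y.t_pos (Y.size_B a a') (p := fun g => Y.snd g ∈ P)
    (fun e _ => card_class_B_le h e) e
  exact_mod_cast this

theorem sum_classKernel_mul_le {F : Finset S} {k : S → K} {c : ℝ} (hc : 0 ≤ c) {f : S → ℝ}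
    (hf : ∀ g, f g ≤ c) (e : S) : ∑ g, classKernel F k e g * f g ≤ c := by
  calc ∑ g, classKernel F k e g * f g ≤ ∑ g, classKernel F k e g * c :=
        Finset.sum_le_sum fun g _ => mul_le_mul_of_nonneg_left (hf g) (classKernel_nonneg _ _)
    _ ≤ c := by
        rw [← Finset.sum_mul]
        exact mul_le_of_le_one_left hc (sum_classKernel_le_one e)

theorem sum_classKernel_B_fst_le {P : Finset V} {a a' : V} (g : S) :
    ∑ e', (if Y.fst e' ∈ P then classKernel (Y.FB a a') (Y.kB a a') g e' else 0) ≤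
      if Y.fst g ∈ P then 1 else 0 := by
  by_cases h : Y.fst g ∈ P
  · rw [if_pos h]
    refine (Finset.sum_le_sum fun e' _ => ?_).trans (sum_classKernel_le_one (F := Y.FB a a')
      (k := Y.kB a a') g)
    split_ifs
    · exact le_rfl
    · exact classKernel_nonneg _ _
  · rw [if_neg h]
    refine (Finset.sum_eq_zero fun e' _ => ?_).le
    split_ifs with h'
    · by_contra hne
      obtain ⟨h1, h2, h3⟩ := mem_of_classKernel_pos
        (lt_of_le_of_ne (classKernel_nonneg _ _) (Ne.symm hne))
      exact h ((Y.rob_B a a' g h1 e' h2 h3).1 ▸ h')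
    · rfl

theorem sum_classKernel_C_snd_le {P : Finset V} {a a' : V} (g : S) :
    ∑ e', (if Y.snd e' ∈ P then classKernel (Y.FC a a') (Y.kC a a') g e' else 0) ≤
      if Y.snd g ∈ P then 1 else 0 := by
  by_cases h : Y.snd g ∈ P
  · rw [if_pos h]
    refine (Finset.sum_le_sum fun e' _ => ?_).trans (sum_classKernel_le_one (F := Y.FC a a')
      (k := Y.kC a a') g)
    split_ifs
    · exact le_rfl
    · exact classKernel_nonneg _ _
  · rw [if_neg h]
    refine (Finset.sum_eq_zero fun e' _ => ?_).le
    split_ifs with h'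
    · by_contra hne
      obtain ⟨h1, h2, h3⟩ := mem_of_classKernel_pos
        (lt_of_le_of_ne (classKernel_nonneg _ _) (Ne.symm hne))
      exact h ((Y.rob_C a a' g h1 e' h2 h3).1 ▸ h')
    · rfl

/-- The move at the first vertex preserves it, so entering P with the first vertex is decided by the
other move, and conversely for the second vertex. Each move enters P with probability at most 3 / t,
as a class has at least t members and at most three in P. Two vertices and two directions give 12 /
t. -/
theorem sum_twoStep_popular_le {P : Finset V} {a a' : V} (h : ¬ Y.RobustQuad P a a') (e : S) :
    ∑ e', (if Y.fst e' ∈ P ∨ Y.snd e' ∈ P then Y.twoStep a a' e e' + Y.twoStep a a' e' e else 0) ≤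
      12 / t := by
  have h0 : (0 : ℝ) ≤ 3 / t := by positivity
  have h1 : ∑ e', (if Y.fst e' ∈ P then Y.twoStep a a' e e' else 0) ≤ 3 / t := by
    rw [Y.sum_twoStep_if a a' e fun e' => Y.fst e' ∈ P]
    refine le_trans (Finset.sum_le_sum fun g _ => ?_) (sum_classKernel_C_popular_le h e)
    have := mul_le_mul_of_nonneg_left (sum_classKernel_B_fst_le (Y := Y) (P := P) (a := a) (a' := a') g)
      (classKernel_nonneg (F := Y.FC a a') (k := Y.kC a a') e g)
    rwa [mul_ite, mul_one, mul_zero] at this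
  have h2 : ∑ e', (if Y.snd e' ∈ P then Y.twoStep a a' e e' else 0) ≤ 3 / t := by
    rw [Y.sum_twoStep_if a a' e fun e' => Y.snd e' ∈ P]
    exact sum_classKernel_mul_le h0 (fun g => sum_classKernel_B_popular_le h g) e
  have h3 : ∑ e', (if Y.snd e' ∈ P then Y.twoStep a a' e' e else 0) ≤ 3 / t := by
    rw [Y.sum_twoStep_if' a a' e fun e' => Y.snd e' ∈ P]
    refine le_trans (Finset.sum_le_sum fun g _ => ?_) (sum_classKernel_B_popular_le h e)
    have := mul_le_mul_of_nonneg_left (sum_classKernel_C_snd_le (Y := Y) (P := P) (a := a) (a' := a') g)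
      (classKernel_nonneg (F := Y.FB a a') (k := Y.kB a a') e g)
    rwa [mul_ite, mul_one, mul_zero] at this
  have h4 : ∑ e', (if Y.fst e' ∈ P then Y.twoStep a a' e' e else 0) ≤ 3 / t := by
    rw [Y.sum_twoStep_if' a a' e fun e' => Y.fst e' ∈ P]
    exact sum_classKernel_mul_le h0 (fun g => sum_classKernel_C_popular_le h g) e
  have h5 : ∀ e', (if Y.fst e' ∈ P ∨ Y.snd e' ∈ P then Y.twoStep a a' e e' + Y.twoStep a a' e' e
      else 0) ≤ (if Y.fst e' ∈ P then Y.twoStep a a' e e' else 0) +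
      (if Y.snd e' ∈ P then Y.twoStep a a' e e' else 0) +
      (if Y.snd e' ∈ P then Y.twoStep a a' e' e else 0) +
      (if Y.fst e' ∈ P then Y.twoStep a a' e' e else 0) := by
    intro e'
    have p1 := Y.twoStep_nonneg a a' e e'
    have p2 := Y.twoStep_nonneg a a' e' e
    by_cases p : Y.fst e' ∈ P <;> by_cases q : Y.snd e' ∈ P <;> simp [p, q] <;> linarith
  refine (Finset.sum_le_sum fun e' _ => h5 e').trans ?_
  simp only [Finset.sum_add_distrib]
  calc _ ≤ 3 / (t : ℝ) + 3 / t + 3 / t + 3 / t :=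
        add_le_add (add_le_add (add_le_add h1 h2) h3) h4
    _ = 12 / t := by ring

variable (Y)

/-- Without a robust quadruple the two-step mass is at most 12 / t ≤ 1/8, and symmetrisation halves
it; this is the constant 1/16. -/
theorem sum_popular_weight_le (ht : 96 ≤ t) (e : S) (l : V × V) :
    ∑ e', (if Y.HitsPopular m e e' then Y.weight e l e' else 0) ≤
      (if Y.Inn l.1 l.2 e then (1 / 16) * ((D : ℝ) ^ 2)⁻¹ else 0) +
      if Y.Inn l.1 l.2 e ∧ l.1 ≠ l.2 ∧ Y.RobustQuad (Y.popular m e) l.1 l.2 then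
        ((D : ℝ) ^ 2)⁻¹ else 0 := by
  have ht' : (0 : ℝ) < t := by exact_mod_cast Y.t_pos
  have htle : (96 : ℝ) ≤ t := by exact_mod_cast ht
  have hle : ∑ e', (if Y.HitsPopular m e e' then Y.weight e l e' else 0) ≤
      ∑ e', Y.weight e l e' := Finset.sum_le_sum fun e' _ => by
    split_ifs
    · exact le_rfl
    · exact Y.weight_nonneg e l e'
  have hle' := hle.trans (Y.sum_weight_le e l)
  have hpos : (0 : ℝ) ≤ ((D : ℝ) ^ 2)⁻¹ := by positivity
  by_cases hin : Y.Inn l.1 l.2 e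
  · rw [if_pos hin] at hle'
    by_cases hl : l.1 = l.2
    · have : ∑ e', (if Y.HitsPopular m e e' then Y.weight e l e' else 0) = 0 := by
        refine Finset.sum_eq_zero fun e' _ => ?_
        have : Y.weight e l e' = 0 := if_neg fun h => h.1 hl
        simp [this]
      rw [this]
      refine add_nonneg ?_ ?_ <;> split_ifs <;> positivity
    by_cases hq : Y.RobustQuad (Y.popular m e) l.1 l.2
    · rw [if_pos hin, if_pos ⟨hin, hl, hq⟩]
      linarith
    · rw [if_pos hin, if_neg fun h => hq h.2.2, add_zero]
      calc ∑ e', (if Y.HitsPopular m e e' then Y.weight e l e' else 0)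
          ≤ ∑ e', (if Y.fst e' ∈ Y.popular m e ∨ Y.snd e' ∈ Y.popular m e then
              Y.twoStep l.1 l.2 e e' + Y.twoStep l.1 l.2 e' e else 0) * (2⁻¹ * ((D : ℝ) ^ 2)⁻¹) := by
            refine Finset.sum_le_sum fun e' _ => ?_
            by_cases h : Y.HitsPopular m e e'
            · rw [if_pos h, if_pos (show Y.fst e' ∈ Y.popular m e ∨ Y.snd e' ∈ Y.popular m e from h)]
              refine (Y.weight_le e l e').trans (le_of_eq ?_)
              rw [div_eq_mul_inv, div_eq_mul_inv, mul_assoc]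
            · rw [if_neg h, if_neg (show ¬ (Y.fst e' ∈ Y.popular m e ∨ Y.snd e' ∈ Y.popular m e)
                from h), zero_mul]
        _ ≤ 12 / t * (2⁻¹ * ((D : ℝ) ^ 2)⁻¹) := by
            rw [← Finset.sum_mul]
            exact mul_le_mul_of_nonneg_right (sum_twoStep_popular_le hq e) (by positivity)
        _ ≤ 12 / 96 * (2⁻¹ * ((D : ℝ) ^ 2)⁻¹) := by gcongr
        _ = _ := by ring
  · rw [if_neg hin] at hle'
    rw [if_neg hin, if_neg fun h => hin h.1]
    linarith

/-- If the popular mass is 1/8 per pair on average, then some pair attains this average. Apex pairs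
without a robust quadruple explain at most 1/16 of it, so the others number at least D² / 16. -/
theorem exists_many_robustQuad [Nonempty S] (ht : 96 ≤ t) (hD : 0 < D)
    (hpop : (Fintype.card S : ℝ) / 8 ≤ Y.popularMass m) :
    ∃ e, D ^ 2 ≤ 16 * ((Y.A e ×ˢ Y.A e).filter fun l =>
      l.1 ≠ l.2 ∧ Y.RobustQuad (Y.popular m e) l.1 l.2).card := by
  by_contra hno
  push Not at hno
  have hD' : (0 : ℝ) < (D : ℝ) ^ 2 := by positivity
  have key : ∀ e, ∑ e', (if Y.HitsPopular m e e' then ∑ l, Y.weight e l e' else 0) < 1 / 8 := by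
    intro e
    have h1 : ∑ e', (if Y.HitsPopular m e e' then ∑ l, Y.weight e l e' else 0) =
        ∑ l, ∑ e', (if Y.HitsPopular m e e' then Y.weight e l e' else 0) := by
      rw [Finset.sum_comm]
      refine Finset.sum_congr rfl fun e' _ => ?_
      split_ifs
      · rfl
      · simp
    have h2 : (Finset.univ.filter fun l : V × V => Y.Inn l.1 l.2 e ∧ l.1 ≠ l.2 ∧
        Y.RobustQuad (Y.popular m e) l.1 l.2) = (Y.A e ×ˢ Y.A e).filter fun l =>
        l.1 ≠ l.2 ∧ Y.RobustQuad (Y.popular m e) l.1 l.2 := by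
      ext l
      simp only [Finset.mem_filter, Finset.mem_univ, true_and, Finset.mem_product]
      rfl
    rw [h1]
    refine (Finset.sum_le_sum fun l _ => Y.sum_popular_weight_le m ht e l).trans_lt ?_
    rw [Finset.sum_add_distrib, sum_inn, ← Finset.sum_filter, Finset.sum_const, nsmul_eq_mul, h2]
    have h3 := hno e
    have h4 : (16 : ℝ) * ((Y.A e ×ˢ Y.A e).filter fun l =>
      l.1 ≠ l.2 ∧ Y.RobustQuad (Y.popular m e) l.1 l.2).card < D ^ 2 := by exact_mod_cast h3
    rw [← div_eq_mul_inv (Nat.cast _), mul_left_comm, mul_inv_cancel₀ hD'.ne', mul_one]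
    have : (((Y.A e ×ˢ Y.A e).filter fun l =>
      l.1 ≠ l.2 ∧ Y.RobustQuad (Y.popular m e) l.1 l.2).card : ℝ) / D ^ 2 < 1 / 16 := by
      rw [div_lt_iff₀ hD']; linarith
    linarith
  have : Y.popularMass m < ∑ e : S, (1 / 8 : ℝ) :=
    Finset.sum_lt_sum_of_nonempty Finset.univ_nonempty fun e _ => key e
  rw [Finset.sum_const, Finset.card_univ, nsmul_eq_mul] at this
  linarith

/-- There are at most (2m)⁴ quadruples of popular vertices, so one quadruple serves at least D² /
(256 m⁴) of the apex pairs. For D > 2^17 m⁸ this exceeds the threshold of `exists_four_cycle`. -/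
theorem exists_four_apices [Nonempty S] (ht : 96 ≤ t) (hm : 2 ^ 17 * m ^ 8 < D)
    (hpop : (Fintype.card S : ℝ) / 8 ≤ Y.popularMass m) :
    ∃ (x : Fin 4 → V) (a b c d : V), Function.Injective x ∧ [a, b, c, d].Nodup ∧
      ∀ i j, Y.rob a b (x i) (x j) ∧ Y.rob b c (x i) (x j) ∧ Y.rob c d (x i) (x j) ∧
        Y.rob d a (x i) (x j) := by
  have hD : 0 < D := by omega
  obtain ⟨e, he⟩ := Y.exists_many_robustQuad m ht hD hpop
  set N := (Y.A e ×ˢ Y.A e).filter fun l =>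
      l.1 ≠ l.2 ∧ Y.RobustQuad (Y.popular m e) l.1 l.2 with hN
  have hch : ∀ l : V × V, ∃ x : Fin 4 → V, l ∈ N →
      Function.Injective x ∧ (∀ i, x i ∈ Y.popular m e) ∧ ∀ i j, Y.rob l.1 l.2 (x i) (x j) := by
    intro l
    by_cases hl : l ∈ N
    · obtain ⟨x, hx⟩ := (Finset.mem_filter.1 hl).2.2
      exact ⟨x, fun _ => hx⟩
    · exact ⟨fun _ => l.1, fun h => absurd h hl⟩
  choose x hx using hch
  set T := Fintype.piFinset fun _ : Fin 4 => Y.popular m e with hT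
  have hTcard : T.card ≤ 16 * m ^ 4 := by
    rw [hT, Fintype.card_piFinset_const]
    refine (Nat.pow_le_pow_left (Y.card_popular_le m hD e) 4).trans (le_of_eq ?_)
    ring
  have hmaps : ∀ l ∈ N, x l ∈ T := fun l hl => Fintype.mem_piFinset.2 (hx l hl).2.1
  obtain ⟨τ, hτ⟩ : ∃ τ, D ^ 2 ≤ 256 * m ^ 4 * (N.filter fun l => x l = τ).card := by
    by_contra hno
    push Not at hno
    have hsum := Finset.card_eq_sum_card_fiberwise hmaps
    have hT0 : T.Nonempty := by
      have : 0 < N.card := by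
        by_contra h
        have : 0 < D ^ 2 := by positivity
        omega
      obtain ⟨l, hl⟩ := Finset.card_pos.1 this
      exact ⟨_, hmaps l hl⟩
    have h1 : ∑ τ ∈ T, 256 * m ^ 4 * (N.filter fun l => x l = τ).card < ∑ τ ∈ T, D ^ 2 :=
      Finset.sum_lt_sum_of_nonempty hT0 fun τ _ => hno τ
    rw [← Finset.mul_sum, ← hsum, Finset.sum_const, smul_eq_mul] at h1
    have h2 : T.card * D ^ 2 ≤ 16 * m ^ 4 * D ^ 2 := Nat.mul_le_mul_right _ hTcard
    have h3 : 16 * m ^ 4 * D ^ 2 ≤ 16 * m ^ 4 * (16 * N.card) := Nat.mul_le_mul_left _ he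
    have : 16 * m ^ 4 * (16 * N.card) = 256 * m ^ 4 * N.card := by ring
    omega
  have hτ0 : (N.filter fun l => x l = τ).Nonempty := by
    rw [← Finset.card_pos]
    by_contra h
    have h0 : (N.filter fun l => x l = τ).card = 0 := by omega
    rw [h0] at hτ
    have : 0 < D ^ 2 := by positivity
    omega
  have hinj : Function.Injective τ := by
    obtain ⟨l, hl⟩ := hτ0
    rw [Finset.mem_filter] at hl
    exact hl.2 ▸ (hx l hl.1).1
  have hsub : (N.filter fun l => x l = τ) ⊆ (Y.A e ×ˢ Y.A e).filter fun l =>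
      l.1 ≠ l.2 ∧ ∀ i j, Y.rob l.1 l.2 (τ i) (τ j) := by
    intro l hl
    rw [Finset.mem_filter] at hl ⊢
    have h1 := Finset.mem_filter.1 hl.1
    exact ⟨h1.1, h1.2.1, hl.2 ▸ (hx l hl.1).2.2⟩
  have hcard := hτ.trans (Nat.mul_le_mul_left (256 * m ^ 4) (Finset.card_le_card hsub))
  obtain ⟨a, b, c, d, hnd, h1, h2, h3, h4⟩ := exists_four_cycle (Y.A e)
    (r := fun a b => a ≠ b ∧ ∀ i j, Y.rob a b (τ i) (τ j)) (fun _ _ h => h.1)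
    (fun a b h => ⟨h.1.symm, fun i j => Y.rob_comm _ _ _ _ (h.2 i j)⟩) (by
      rw [Y.card_A]
      set M := ((Y.A e ×ˢ Y.A e).filter fun l =>
        l.1 ≠ l.2 ∧ ∀ i j, Y.rob l.1 l.2 (τ i) (τ j)).card
      by_contra hle
      have h1 : (D ^ 2) ^ 2 ≤ (256 * m ^ 4 * M) ^ 2 := Nat.pow_le_pow_left hcard 2
      have h2 : (256 * m ^ 4 * M) ^ 2 = 2 ^ 16 * m ^ 8 * M ^ 2 := by ring
      have h3 : 2 ^ 16 * m ^ 8 * M ^ 2 ≤ 2 ^ 16 * m ^ 8 * (2 * D ^ 3) :=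
        Nat.mul_le_mul_left _ (not_lt.1 hle)
      have h4 : 2 ^ 16 * m ^ 8 * (2 * D ^ 3) = 2 ^ 17 * m ^ 8 * D ^ 3 := by ring
      have h5 : 2 ^ 17 * m ^ 8 * D ^ 3 < D * D ^ 3 :=
        Nat.mul_lt_mul_of_pos_right hm (by positivity)
      have h6 : D * D ^ 3 = (D ^ 2) ^ 2 := by ring
      omega)
  exact ⟨τ, a, b, c, d, hinj, hnd, fun i j => ⟨h1.2 i j, h2.2 i j, h3.2 i j, h4.2 i j⟩⟩

end LinkSystem

/-! ### Tori from four apices and from closed walks. -/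

section torusConstructions

open scoped Classical

variable {V : Type*} [Fintype V] {H : Finset (Finset V)} {R : ℕ} {χ : V → Fin R}

/-- With three colours some colour avoids both x and y. The path in that colour has a first edge at
x in the common link, whose edges avoid the apices. -/
theorem Robust.ne_apex (hR : 3 ≤ R) {p p' x y : V} (hxy : x ≠ y)
    (hr : Robust χ (linkGraph H p p') x y) : x ≠ p ∧ x ≠ p' := by
  obtain ⟨s, -, hs⟩ := Finset.exists_mem_notMem_of_card_lt_card (s := {χ x, χ y})
    (t := (Finset.univ : Finset (Fin R))) (by
      rw [Finset.card_univ, Fintype.card_fin]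
      exact lt_of_le_of_lt Finset.card_le_two hR)
  simp only [Finset.mem_insert, Finset.mem_singleton, not_or] at hs
  obtain ⟨vs, h1, -, -, h4⟩ := exists_path_of_viaGraph (W := fun v => χ v = s) hxy (Ne.symm hs.1)
    (Ne.symm hs.2) (hr s hs.1 hs.2)
  obtain ⟨v, vs, rfl⟩ := List.exists_cons_of_ne_nil h1
  have hadj := (List.isChain_cons_cons.1 h4).1
  exact ⟨hadj.2.1.1, hadj.2.1.2.1⟩

/-- Four vertices that are pairwise robustly joined over the sides of a 4-cycle of apices span
a torus. -/
theorem containsTorus_of_four_apices (hR : 24 ≤ R) {x : Fin 4 → V} (hx : Function.Injective x)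
    {a b c d : V} (hnd : [a, b, c, d].Nodup)
    (hrob : ∀ i j, Robust χ (linkGraph H a b) (x i) (x j) ∧ Robust χ (linkGraph H b c) (x i) (x j) ∧
      Robust χ (linkGraph H c d) (x i) (x j) ∧ Robust χ (linkGraph H d a) (x i) (x j)) :
    ContainsTorus H := by
  -- The cycle a b c d is laid around the 2 × 2 torus so that any two positions differing in one
  -- coordinate carry consecutive apices. The four vertices x may then be placed arbitrarily.
  set A : Fin 2 × Fin 2 → V := fun r => if r.1 = 0 then (if r.2 = 0 then a else b) else
    (if r.2 = 0 then d else c) with hA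
  set X : Fin 2 × Fin 2 → V := fun r => x (finProdFinEquiv r) with hX
  have hXinj : Function.Injective X := hx.comp finProdFinEquiv.injective
  simp only [List.nodup_cons, List.mem_cons, List.not_mem_nil, or_false, not_or,
    List.nodup_nil, not_false_iff, and_true] at hnd
  obtain ⟨⟨hab, hac, had⟩, ⟨hbc, hbd⟩, hcd⟩ := hnd
  have hAinj : Function.Injective A := by
    rintro ⟨i, j⟩ ⟨i', j'⟩ h
    fin_cases i <;> fin_cases j <;> fin_cases i' <;> fin_cases j' <;>
      simp_all [eq_comm]
  have hne : ∀ i, ∃ j : Fin 4, i ≠ j := by decide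
  have hxa : ∀ i r, x i ≠ A r := by
    intro i r
    obtain ⟨j, hij⟩ := hne i
    have h1 := (hrob i j).1.ne_apex (by omega) (hx.ne hij)
    have h2 := (hrob i j).2.2.1.ne_apex (by omega) (hx.ne hij)
    simp only [hA]
    split_ifs
    exacts [h1.1, h1.2, h2.2, h2.1]
  refine containsTorus_of_quads le_rfl le_rfl hXinj hAinj (fun r r' => hxa _ r') χ (fun _ => ∅)
    (fun _ _ _ => Finset.disjoint_empty_left _) (fun _ _ => Finset.notMem_empty _)
    (fun _ _ => Finset.notMem_empty _) (N := 0) (fun _ => le_rfl) (by omega) ?_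
  intro q s₀ s₁ _ hXs _ _
  have hadj : ∀ i j, Robust χ (linkGraph H (A q.1) (quadP' A q)) (x i) (x j) := by
    intro i j
    obtain ⟨h1, h2, h3, h4⟩ := hrob i j
    obtain ⟨⟨u, v⟩, β⟩ := q
    fin_cases u <;> fin_cases v <;> cases β <;> simp only [hA, quadP'] <;> simp <;>
      first | assumption | (rw [linkGraph_comm]; assumption)
  have hpp : A q.1 ≠ quadP' A q := by
    obtain ⟨⟨u, v⟩, β⟩ := q
    fin_cases u <;> fin_cases v <;> cases β <;> simp only [hA, quadP'] <;> simp <;>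
      first | assumption | (apply Ne.symm; assumption)
  have hxy : quadX X q ≠ quadY X q := by
    obtain ⟨⟨u, v⟩, β⟩ := q
    cases β <;> simp only [quadX, quadY] <;> simp [hXinj.eq_iff]
  have hxq : ∃ r, quadX X q = X r := by
    unfold quadX; split_ifs <;> exact ⟨_, rfl⟩
  obtain ⟨r, hr⟩ := hxq
  rw [hr] at hxy ⊢
  obtain ⟨D, I, hD, hI, -, hdisc⟩ := Robust.exists_disc (s := s₀) hpp hxy (hadj _ _) (hXs r).1
    (hXs _).1
  exact ⟨D, I, hD, fun v hv => Or.inl (hI v hv), hdisc⟩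

theorem exists_injective_choice {ι α : Type*} [Fintype ι] (C : ι → Finset α)
    (h : ∀ i, Fintype.card ι ≤ (C i).card) : ∃ f : ι → α, Function.Injective f ∧ ∀ i, f i ∈ C i := by
  refine (Finset.all_card_le_biUnion_card_iff_exists_injective C).1 fun s => ?_
  rcases s.eq_empty_or_nonempty with rfl | ⟨i, hi⟩
  · simp
  · exact (Finset.card_le_univ s).trans ((h i).trans
      (Finset.card_le_card (Finset.subset_biUnion_of_mem C hi)))

namespace LinkSystem

variable {S K : Type*} [Fintype S] {D t : ℕ} (Y : LinkSystem S V K D t)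

theorem card_common_ge {e : S} {a a' : V} (ha : a ∈ Y.goodApex e) (ha' : a' ∈ Y.goodApex e) :
    3 * D ≤ 4 * ((Y.A e).filter fun b => e ∈ Y.FC a b ∧ e ∈ Y.FC a' b).card := by
  have h1 := (Finset.mem_filter.1 ha).2
  have h2 := (Finset.mem_filter.1 ha').2
  have hsub : Y.A e ⊆ ((Y.A e).filter fun b => e ∈ Y.FC a b ∧ e ∈ Y.FC a' b) ∪
      ((Y.A e).filter fun b => e ∉ Y.FC a b) ∪ ((Y.A e).filter fun b => e ∉ Y.FC a' b) := by
    intro b hb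
    simp only [Finset.mem_union, Finset.mem_filter, hb, true_and]
    tauto
  have h3 := (Finset.card_le_card hsub).trans ((Finset.card_union_le _ _).trans
    (Nat.add_le_add_right (Finset.card_union_le _ _) _))
  rw [Y.card_A] at h3
  omega

/-- The grid is k × 2, with the vertices (b_i, c_i) of the i-th pair and the apices (a_i, a'_i) of
the i-th step. The quadrilaterals a_i b_i a'_i b_{i+1} and a_i c_i a'_i c_{i+1} are filled because
the step is robust. The quadrilateral joining a_i to a_{i+1} through b_{i+1}, c_{i+1}, and its
primed copy, is glued from two discs along an auxiliary apex. -/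
theorem containsTorus_of_walk (hrob : ∀ a a' x y, Y.rob a a' x y → Robust χ (linkGraph H a a') x y)
    (hfs : ∀ e e', Y.fst e ≠ Y.snd e') (hAf : ∀ e e', Y.fst e ∉ Y.A e')
    (hAs : ∀ e e', Y.snd e ∉ Y.A e') {k : ℕ} [NeZero k] (hk : 2 ≤ k) (hR : 16 * k ≤ R)
    (hD : 8 * k ≤ D) (x : Fin k → S) (l : Fin k → V × V)
    (hw : ∀ i, 0 < Y.weight (x i) (l i) (x (i + 1)))
    (hx : ∀ i j, i ≠ j → ¬ Y.PairConflict (x i) (x j))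
    (hl : ∀ i j, i ≠ j → ¬ LabelConflict (l i) (l j)) : ContainsTorus H := by
  set X : Fin k × Fin 2 → V := fun r => if r.2 = 0 then Y.fst (x r.1) else Y.snd (x r.1) with hX
  set A : Fin k × Fin 2 → V := fun r => if r.2 = 0 then (l r.1).1 else (l r.1).2 with hA
  have hX0 : ∀ i, X (i, 0) = Y.fst (x i) := fun i => by simp [hX]
  have hX1 : ∀ i, X (i, 1) = Y.snd (x i) := fun i => by simp [hX]
  have hA0 : ∀ i, A (i, 0) = (l i).1 := fun i => by simp [hA]
  have hA1 : ∀ i, A (i, 1) = (l i).2 := fun i => by simp [hA]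
  have hok := fun i => (Y.weight_pos (hw i)).1
  have hrf := fun i => hrob _ _ _ _ (Y.weight_pos (hw i)).2.1
  have hrs := fun i => hrob _ _ _ _ (Y.weight_pos (hw i)).2.2
  have h01 : ∀ j : Fin 2, j = 0 ∨ j = 1 := by decide
  have hXinj : Function.Injective X := by
    rintro ⟨i, j⟩ ⟨i', j'⟩ h
    rcases h01 j with rfl | rfl <;> rcases h01 j' with rfl | rfl <;>
      simp only [hX0, hX1] at h
    · by_contra hne
      exact hx i i' (fun h => hne (by rw [h])) (Or.inl h)
    · exact absurd h (hfs _ _)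
    · exact absurd h.symm (hfs _ _)
    · by_contra hne
      exact hx i i' (fun h => hne (by rw [h])) (Or.inr h)
  have hAinj : Function.Injective A := by
    rintro ⟨i, j⟩ ⟨i', j'⟩ h
    by_cases hii : i = i'
    · subst hii
      rcases h01 j with rfl | rfl <;> rcases h01 j' with rfl | rfl <;>
        simp only [hA0, hA1] at h
      · rfl
      · exact absurd h (hok i).1
      · exact absurd h.symm (hok i).1
      · rfl
    · refine absurd ?_ (hl i i' hii)
      rcases h01 j with rfl | rfl <;> rcases h01 j' with rfl | rfl <;>
        simp only [hA0, hA1] at h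
      · exact Or.inl h
      · exact Or.inr (Or.inl h)
      · exact Or.inr (Or.inr (Or.inl h))
      · exact Or.inr (Or.inr (Or.inr h))
  have hgood : ∀ r : Fin k × Fin 2, A r ∈ Y.goodApex (x r.1) ∧ A r ∈ Y.goodApex (x (r.1 + 1)) := by
    rintro ⟨i, j⟩
    rcases h01 j with rfl | rfl
    · rw [hA0]; exact ⟨(hok i).2.2.2.1.1, (hok i).2.2.2.2.1⟩
    · rw [hA1]; exact ⟨(hok i).2.2.2.1.2, (hok i).2.2.2.2.2⟩
  have hXnot : ∀ r e, X r ∉ Y.A e := by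
    rintro ⟨i, j⟩ e
    rcases h01 j with rfl | rfl
    · rw [hX0]; exact hAf _ _
    · rw [hX1]; exact hAs _ _
  have hXA : ∀ r r', X r ≠ A r' := fun r r' h =>
    hXnot r (x r'.1) (h ▸ (Finset.mem_filter.1 (hgood r').1).1)
  -- The auxiliary apices are chosen distinct, away from the grid apices, and such that the pair
  -- they border is classified with each of the two grid apices. Two good apices leave 3D/4 ≥ 6k
  -- candidates; 2k of them may be grid apices, and only 2k choices have to be made.
  obtain ⟨f, hf, hfC⟩ := exists_injective_choice (fun r : Fin k × Fin 2 =>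
      ((Y.A (x (r.1 + 1))).filter fun b => x (r.1 + 1) ∈ Y.FC (A r) b ∧
        x (r.1 + 1) ∈ Y.FC (A (r.1 + 1, r.2)) b) \ Finset.univ.image A) (by
    intro r
    have h1 := Y.card_common_ge (hgood r).2 (hgood (r.1 + 1, r.2)).1
    have h2 : (Finset.univ.image A).card ≤ k * 2 := by
      refine Finset.card_image_le.trans ?_
      simp
    have h3 := Finset.le_card_sdiff (Finset.univ.image A) ((Y.A (x (r.1 + 1))).filter fun b =>
      x (r.1 + 1) ∈ Y.FC (A r) b ∧ x (r.1 + 1) ∈ Y.FC (A (r.1 + 1, r.2)) b)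
    simp only [Fintype.card_prod, Fintype.card_fin]
    omega)
  have hfA : ∀ r r', A r ≠ f r' := fun r r' h => (Finset.mem_sdiff.1 (hfC r')).2
    (Finset.mem_image.2 ⟨r, Finset.mem_univ _, h⟩)
  have hfm := fun r => Finset.mem_filter.1 (Finset.mem_sdiff.1 (hfC r)).1
  have hXf : ∀ r r', X r ≠ f r' := fun r r' h => hXnot r _ (h ▸ (hfm r').1)
  refine containsTorus_of_quads hk le_rfl hXinj hAinj hXA χ
    (fun q => if q.2 then ∅ else {f q.1}) ?_ ?_ ?_ (N := 1) ?_ (by omega) ?_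
  · rintro ⟨r, β⟩ ⟨r', β'⟩ hne
    cases β <;> cases β'
    · simp only [Bool.false_eq_true, if_false, Finset.disjoint_singleton]
      exact hf.ne fun h => hne (by rw [h])
    all_goals simp
  · rintro r ⟨r', β⟩
    cases β
    · simpa using hXf r r'
    · simp
  · rintro r ⟨r', β⟩
    cases β
    · simpa using hfA r r'
    · simp
  · rintro ⟨r', β⟩
    cases β <;> simp
  · rintro ⟨⟨i, j⟩, β⟩ s₀ s₁ hs hXs hAs hEs
    cases β
    · have hcol : χ (f (i, j)) ≠ s₀ ∧ χ (f (i, j)) ≠ s₁ := hEs ((i, j), false) _ (by simp)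
      have hi : i ≠ i + 1 := fun h => (hok i).2.1 (by rw [← h])
      have hr : ∀ b, x (i + 1) ∈ Y.FC b (f (i, j)) →
          Robust χ (linkGraph H b (f (i, j))) (X (i + 1, j)) (X (i + 1, j + 1)) := by
        intro b hb
        have := hrob _ _ _ _ (Y.rob_pair _ _ _ hb)
        rcases h01 j with rfl | rfl
        · rw [hX0, zero_add, hX1]; exact this
        · rw [hX1, show (1 : Fin 2) + 1 = 0 from rfl, hX0]; exact this.symm
      have hr2 := hr _ (hfm (i, j)).2.2
      rw [linkGraph_comm] at hr2
      obtain ⟨D', I, hD', hI, hdisc⟩ := Robust.exists_disc_glue (p := A (i, j)) (p' := A (i + 1, j))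
        (p'' := f (i, j)) (x := X (i + 1, j)) (y := X (i + 1, j + 1)) (by
          have h1 : A (i, j) ≠ A (i + 1, j) := hAinj.ne (by simpa using hi)
          have h2 : X (i + 1, j) ≠ X (i + 1, j + 1) := hXinj.ne (by simp)
          simp [h1, h2, hfA, (hXA _ _).symm, (hXf _ _).symm])
        (hr _ (hfm (i, j)).2.1) hr2 hs (by
          intro v hv
          simp only [List.mem_cons, List.not_mem_nil, or_false] at hv
          rcases hv with rfl | rfl | rfl | rfl | rfl
          exacts [hAs _, hAs _, hcol, hXs _, hXs _])
      refine ⟨D', I, hD', fun v hv => ?_, by simpa [quadX, quadP', quadY] using hdisc⟩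
      simpa using hI v hv
    · have hr : Robust χ (linkGraph H (A (i, j)) (A (i, j + 1))) (X (i, j + 1))
          (X (i + 1, j + 1)) := by
        rcases h01 j with rfl | rfl
        · rw [zero_add, hX1, hX1, hA0, hA1]; exact hrs i
        · rw [show (1 : Fin 2) + 1 = 0 from rfl, hX0, hX0, hA0, hA1, linkGraph_comm]; exact hrf i
      have hi : i ≠ i + 1 := fun h => (hok i).2.1 (by rw [← h])
      obtain ⟨D', I, hD', hI, -, hdisc⟩ := Robust.exists_disc (s := s₀)
        (hAinj.ne (by simp)) (hXinj.ne (by simpa using hi)) hr (hXs _).1 (hXs _).1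
      exact ⟨D', I, hD', fun v hv => Or.inl (hI v hv), by simpa [quadX, quadP', quadY] using hdisc⟩

end LinkSystem

end torusConstructions

/-! ### A link system with small losses yields a torus. -/

namespace LinkSystem

open scoped Classical

variable {S V K : Type*} [Fintype S] [Fintype V] {D t : ℕ}

theorem lossC_le (Y : LinkSystem S V K D t) {β : Type*} (f : V × V → Finset β) {φ : S → β}
    (hφ : Function.Injective φ)
    (h : ∀ l e, Y.Inn l.1 l.2 e → e ∉ Y.FC l.1 l.2 → φ e ∈ f l) : Y.lossC ≤ ∑ l, (f l).card :=
  Finset.sum_le_sum fun l _ => Finset.card_le_card_of_injOn φ (fun e he => by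
    obtain ⟨-, h1, h2⟩ := Finset.mem_filter.1 (Finset.mem_coe.1 he)
    exact Finset.mem_coe.2 (h l e h1 h2)) hφ.injOn

theorem lossB_le (Y : LinkSystem S V K D t) {β : Type*} (f : V × V → Finset β) {φ : S → β}
    (hφ : Function.Injective φ)
    (h : ∀ l e, Y.Inn l.1 l.2 e → e ∉ Y.FB l.1 l.2 → φ e ∈ f l) : Y.lossB ≤ ∑ l, (f l).card :=
  Finset.sum_le_sum fun l _ => Finset.card_le_card_of_injOn φ (fun e he => by
    obtain ⟨-, h1, h2⟩ := Finset.mem_filter.1 (Finset.mem_coe.1 he)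
    exact Finset.mem_coe.2 (h l e h1 h2)) hφ.injOn

/-- The case distinction is on the popular mass: if it is small, a conflict-free closed walk exists;
if it is large, four apices share a robust quadruple. -/
theorem containsTorus [Nonempty S] (Y : LinkSystem S V K D t) {H : Finset (Finset V)} {R : ℕ}
    {χ : V → Fin R} (hrob : ∀ a a' x y, Y.rob a a' x y → Robust χ (linkGraph H a a') x y)
    (hfs : ∀ e e', Y.fst e ≠ Y.snd e') (hAf : ∀ e e', Y.fst e ∉ Y.A e')
    (hAs : ∀ e e', Y.snd e ∉ Y.A e') (ht : 96 ≤ t)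
    (hloss : 100 * (Y.lossC + Y.lossB) ≤ Fintype.card S * D ^ 2) {r m : ℕ} (hm : 0 < m)
    (hR : 16 * (8 * 4 ^ r) ≤ R) (hD : 8 * (8 * 4 ^ r) ≤ D) (hDm : 2 ^ 17 * m ^ 8 < D)
    (hcount : Fintype.card S * (2 * (8 * 4 ^ r) ^ 2 * (2 / m : ℝ)) ^ r < (1 / 4) ^ 2 ^ (2 * r + 1)) :
    ContainsTorus H := by
  have hm8 : m ≤ m ^ 8 := Nat.le_self_pow (by norm_num) m
  have hpos : 1 ≤ 4 ^ r := Nat.one_le_pow _ _ (by norm_num)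
  rcases le_total (Y.popularMass m) ((Fintype.card S : ℝ) / 8) with h | h
  · have hmass := Y.le_sum_weight ht (by omega) hloss
    obtain ⟨k, hk, x, l, hk2, hkr, hw, hx, hl⟩ :=
      Y.exists_closed_walk_of_unpopular m hm (by omega) hmass h r hcount
    exact Y.containsTorus_of_walk hrob hfs hAf hAs hk2 (by omega) (by omega) x l hw hx hl
  · obtain ⟨x, a, b, c, d, hx, hnd, hr⟩ := Y.exists_four_apices m ht hDm h
    exact containsTorus_of_four_apices (by omega) hx hnd fun i j =>
      ⟨hrob _ _ _ _ (hr i j).1, hrob _ _ _ _ (hr i j).2.1, hrob _ _ _ _ (hr i j).2.2.1,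
        hrob _ _ _ _ (hr i j).2.2.2⟩

end LinkSystem

/-! ### Link systems from dense pair systems. -/

section construction

open scoped Classical

variable {V : Type*}

/-- Pairs `e ∈ E` with `D` apices each, where apices, first and second vertices lie in different
parts and every pair forms an edge of `H` with each of its apices. -/
structure IsPairSystem (H : Finset (Finset V)) (g : V → Fin 3) (E : Finset (V × V))
    (A : V × V → Finset V) (D : ℕ) : Prop where
  card_apices : ∀ e ∈ E, (A e).card = D
  edge : ∀ e ∈ E, ∀ a ∈ A e, ({a, e.1, e.2} : Finset V) ∈ H
  part_apex : ∀ e ∈ E, ∀ a ∈ A e, g a = 0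
  part_fst : ∀ e ∈ E, g e.1 = 1
  part_snd : ∀ e ∈ E, g e.2 = 2

/-- The pairs seen by both apices. -/
noncomputable def commonPairs (E : Finset (V × V)) (A : V × V → Finset V) (l : V × V) :
    Finset (V × V) := E.filter fun e => l.1 ∈ A e ∧ l.2 ∈ A e

variable {H : Finset (Finset V)} {g : V → Fin 3} {E : Finset (V × V)} {A : V × V → Finset V} {D : ℕ}

theorem bipGraph_swap (G : Finset (V × V)) : bipGraph (G.image Prod.swap) = bipGraph G := by
  ext u v
  simp only [bipGraph, Finset.mem_image, Prod.exists, Prod.swap_prod_mk, Prod.mk.injEq]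
  constructor
  · rintro ⟨h, ⟨a, b, hab, rfl, rfl⟩ | ⟨a, b, hab, rfl, rfl⟩⟩
    · exact ⟨h, Or.inr hab⟩
    · exact ⟨h, Or.inl hab⟩
  · rintro ⟨h, h' | h'⟩
    · exact ⟨h, Or.inr ⟨_, _, h', rfl, rfl⟩⟩
    · exact ⟨h, Or.inl ⟨_, _, h', rfl, rfl⟩⟩

theorem IsPairSystem.bipGraph_le (h : IsPairSystem H g E A D) (l : V × V) :
    bipGraph (commonPairs E A l) ≤ linkGraph H l.1 l.2 := by
  have key : ∀ u v, (u, v) ∈ commonPairs E A l → (linkGraph H l.1 l.2).Adj u v := by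
    intro u v huv
    obtain ⟨hE, h1, h2⟩ := Finset.mem_filter.1 huv
    have hu := h.part_fst _ hE
    have hv := h.part_snd _ hE
    have a1 := h.part_apex _ hE _ h1
    have a2 := h.part_apex _ hE _ h2
    have hne : ∀ {x y : V} {i j : Fin 3}, g x = i → g y = j → i ≠ j → x ≠ y := by
      rintro x y i j rfl rfl hij rfl; exact hij rfl
    exact ⟨hne hu hv (by decide), ⟨hne hu a1 (by decide), hne hu a2 (by decide),
      hne hv a1 (by decide), hne hv a2 (by decide)⟩, h.edge _ hE _ h1, h.edge _ hE _ h2⟩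
  rintro u v ⟨-, huv | huv⟩
  · exact key u v huv
  · exact (key v u huv).symm

/-- Both classifications come from the same common link: hubs are second vertices for C, and first
vertices for B after swapping the pairs. Swapping does not change the graph, so robustness refers to
the same link. -/
theorem IsPairSystem.exists_linkSystem_of_core [Fintype V] (h : IsPairSystem H g E A D) {R t : ℕ}
    (ht : 0 < t) {K : Type*} (χ : V → Fin R) (coreC coreB : V × V → Finset (V × V))
    (keyC keyB : V × V → V × V → K) (hCsub : ∀ l, coreC l ⊆ commonPairs E A l)
    (hBsub : ∀ l, coreB l ⊆ (commonPairs E A l).image Prod.swap)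
    (hCpair : ∀ l, ∀ p ∈ coreC l, Robust χ (bipGraph (commonPairs E A l)) p.1 p.2)
    (hCrob : ∀ l, ∀ p ∈ coreC l, ∀ q ∈ coreC l, keyC l p = keyC l q →
      p.2 = q.2 ∧ Robust χ (bipGraph (commonPairs E A l)) p.1 q.1)
    (hBrob : ∀ l, ∀ p ∈ coreB l, ∀ q ∈ coreB l, keyB l p = keyB l q →
      p.2 = q.2 ∧ Robust χ (bipGraph ((commonPairs E A l).image Prod.swap)) p.1 q.1)
    (hCsize : ∀ l, ∀ p ∈ coreC l, t ≤ ((coreC l).filter fun q => keyC l q = keyC l p).card)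
    (hBsize : ∀ l, ∀ p ∈ coreB l, t ≤ ((coreB l).filter fun q => keyB l q = keyB l p).card) :
    ∃ Y : LinkSystem E V K D t, (∀ e, Y.fst e = e.1.1) ∧ (∀ e, Y.snd e = e.1.2) ∧
      (∀ e, Y.A e = A e.1) ∧ (∀ a a' x y, Y.rob a a' x y → Robust χ (linkGraph H a a') x y) ∧
      Y.lossC ≤ ∑ l, (commonPairs E A l \ coreC l).card ∧
      Y.lossB ≤ ∑ l, ((commonPairs E A l).image Prod.swap \ coreB l).card := by
  have hBmem : ∀ l p, p.swap ∈ coreB l → p ∈ commonPairs E A l := by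
    intro l p hp
    obtain ⟨q, hq, hqp⟩ := Finset.mem_image.1 (hBsub l hp)
    rwa [← Prod.swap_injective hqp]
  let Y : LinkSystem E V K D t :=
    { fst := fun e => e.1.1
      snd := fun e => e.1.2
      A := fun e => A e.1
      rob := fun a a' x y => Robust χ (linkGraph H a a') x y
      FC := fun a a' => Finset.univ.filter fun e => e.1 ∈ coreC (a, a')
      FB := fun a a' => Finset.univ.filter fun e => e.1.swap ∈ coreB (a, a')
      kC := fun a a' e => keyC (a, a') e.1
      kB := fun a a' e => keyB (a, a') e.1.swap
      ext_pair := fun e e' h1 h2 => Subtype.ext (Prod.ext h1 h2)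
      card_A := fun e => h.card_apices e.1 e.2
      mem_C := fun a a' e he =>
        (Finset.mem_filter.1 (hCsub _ (Finset.mem_filter.1 he).2)).2
      mem_B := fun a a' e he =>
        (Finset.mem_filter.1 (hBmem _ _ (Finset.mem_filter.1 he).2)).2
      rob_C := fun a a' e he e' he' hk => by
        have := hCrob _ _ (Finset.mem_filter.1 he).2 _ (Finset.mem_filter.1 he').2 hk
        exact ⟨this.1, this.2.mono (h.bipGraph_le (a, a'))⟩
      rob_B := fun a a' e he e' he' hk => by
        have := hBrob _ _ (Finset.mem_filter.1 he).2 _ (Finset.mem_filter.1 he').2 hk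
        rw [bipGraph_swap] at this
        exact ⟨this.1, this.2.mono (h.bipGraph_le (a, a'))⟩
      rob_pair := fun a a' e he =>
        (hCpair _ _ (Finset.mem_filter.1 he).2).mono (h.bipGraph_le (a, a'))
      rob_symm := fun a a' x y hr => hr.symm
      rob_comm := fun a a' x y hr => by rw [linkGraph_comm]; exact hr
      size_C := fun a a' e he => by
        refine (hCsize _ _ (Finset.mem_filter.1 he).2).trans
          ((Finset.card_le_card (t := Finset.image Subtype.val _) ?_).trans Finset.card_image_le)
        intro p hp
        obtain ⟨hp, hk⟩ := Finset.mem_filter.1 hp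
        exact Finset.mem_image.2 ⟨⟨p, (Finset.mem_filter.1 (hCsub _ hp)).1⟩, Finset.mem_filter.2
          ⟨Finset.mem_filter.2 ⟨Finset.mem_univ _, hp⟩, hk⟩, rfl⟩
      size_B := fun a a' e he => by
        refine (hBsize _ _ (Finset.mem_filter.1 he).2).trans ((Finset.card_le_card
          (t := Finset.image (fun e : E => e.1.swap) _) ?_).trans Finset.card_image_le)
        intro p hp
        obtain ⟨hp, hk⟩ := Finset.mem_filter.1 hp
        exact Finset.mem_image.2 ⟨⟨p.swap, (Finset.mem_filter.1 (hBmem _ p.swap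
          (by rwa [Prod.swap_swap]))).1⟩, Finset.mem_filter.2 ⟨Finset.mem_filter.2
            ⟨Finset.mem_univ _, by simpa using hp⟩, by simpa using hk⟩, by simp⟩
      t_pos := ht }
  refine ⟨Y, fun _ => rfl, fun _ => rfl, fun _ => rfl, fun _ _ _ _ h => h, ?_, ?_⟩
  · exact Y.lossC_le _ Subtype.val_injective fun l e h1 h2 => Finset.mem_sdiff.2
      ⟨Finset.mem_filter.2 ⟨e.2, h1⟩, fun h3 => h2 (Finset.mem_filter.2 ⟨Finset.mem_univ _, h3⟩)⟩
  · exact Y.lossB_le _ (Prod.swap_injective.comp Subtype.val_injective) fun l e h1 h2 =>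
      Finset.mem_sdiff.2 ⟨Finset.mem_image.2 ⟨e.1, Finset.mem_filter.2 ⟨e.2, h1⟩, rfl⟩,
        fun h3 => h2 (Finset.mem_filter.2 ⟨Finset.mem_univ _, h3⟩)⟩

theorem IsPairSystem.sum_card_commonPairs [Fintype V] (h : IsPairSystem H g E A D) :
    ∑ l, (commonPairs E A l).card = E.card * D ^ 2 := by
  simp only [commonPairs, Finset.card_filter]
  rw [Finset.sum_comm, ← smul_eq_mul, ← Finset.sum_const]
  refine Finset.sum_congr rfl fun e he => ?_
  rw [← Finset.card_filter, ← h.card_apices e he, pow_two, ← Finset.card_product]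
  congr 1
  ext l
  simp

/-- Average the losses of `exists_core` over the colourings and sum over all pairs of apices, which
contain |E| D² incidences in total. With κ = 400 R the Markov term is 1/400 of this, the term linear
in n is at most another 1/400 by density, and there are two classifications; so some colouring loses
at most 1/100. -/
theorem IsPairSystem.exists_linkSystem [Fintype V] (h : IsPairSystem H g E A D) {R t : ℕ}
    (ht : 0 < t) (hR : 0 < R)
    (hdense : 400 * (R * (R * R + R) + t * (R * (400 * R + 1) ^ R)) * Fintype.card V ^ 3 ≤
      E.card * D ^ 2) :
    ∃ (χ : V → Fin R) (Y : LinkSystem E V (V × Fin R × (Fin R → Option V)) D t),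
      (∀ e, Y.fst e = e.1.1) ∧ (∀ e, Y.snd e = e.1.2) ∧
      (∀ e, Y.A e = A e.1) ∧ (∀ a a' x y, Y.rob a a' x y → Robust χ (linkGraph H a a') x y) ∧
      100 * (Y.lossC + Y.lossB) ≤ Fintype.card E * D ^ 2 := by
  have hbip : ∀ l, ∀ p ∈ commonPairs E A l, ∀ q ∈ commonPairs E A l, p.1 ≠ q.2 := by
    intro l p hp q hq hpq
    have h1 := h.part_fst _ (Finset.mem_filter.1 hp).1
    have h2 := h.part_snd _ (Finset.mem_filter.1 hq).1
    rw [hpq, h2] at h1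
    exact absurd h1 (by decide)
  have hbip' : ∀ l, ∀ p ∈ (commonPairs E A l).image Prod.swap,
      ∀ q ∈ (commonPairs E A l).image Prod.swap, p.1 ≠ q.2 := by
    intro l p hp q hq hpq
    obtain ⟨p, hp', rfl⟩ := Finset.mem_image.1 hp
    obtain ⟨q, hq', rfl⟩ := Finset.mem_image.1 hq
    exact hbip l q hq' p hp' hpq.symm
  choose coreC keyC hC1 hC2 hC3 hC4 hC5 using fun l => exists_core (hbip l) R (400 * R) t
  choose coreB keyB hB1 hB2 hB3 hB4 hB5 using fun l => exists_core (hbip' l) R (400 * R) t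
  set C := R * (R * R + R) + t * (R * (400 * R + 1) ^ R) with hCdef
  set n := Fintype.card V with hn
  set N := Fintype.card (V → Fin R) with hN
  set loss : (V → Fin R) → ℕ := fun χ => ∑ l, (commonPairs E A l \ coreC l χ).card +
    ∑ l, ((commonPairs E A l).image Prod.swap \ coreB l χ).card with hloss
  have hsum : ∀ (G : V × V → Finset (V × V)) (core : V × V → (V → Fin R) → Finset (V × V)),
      (∀ l, (G l).card ≤ (commonPairs E A l).card) →
      (∀ l, 400 * R * ∑ χ, (G l \ core l χ).card ≤ N * (400 * R * C * n + R * (G l).card)) →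
      400 * R * ∑ χ, ∑ l, (G l \ core l χ).card ≤
        N * (400 * R * C * n ^ 3 + R * (E.card * D ^ 2)) := by
    intro G core hG hcore
    calc 400 * R * ∑ χ, ∑ l, (G l \ core l χ).card
        = ∑ l, 400 * R * ∑ χ, (G l \ core l χ).card := by
          rw [Finset.sum_comm, Finset.mul_sum]
      _ ≤ ∑ l, N * (400 * R * C * n + R * (commonPairs E A l).card) :=
          Finset.sum_le_sum fun l _ => (hcore l).trans (Nat.mul_le_mul_left _
            (Nat.add_le_add_left (Nat.mul_le_mul_left _ (hG l)) _))
      _ = N * (400 * R * C * n ^ 3 + R * (E.card * D ^ 2)) := by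
          rw [← Finset.mul_sum, Finset.sum_add_distrib, ← Finset.mul_sum Finset.univ _ R, h.sum_card_commonPairs,
            Finset.sum_const, Finset.card_univ, Fintype.card_prod, smul_eq_mul, ← hn]
          ring
  have hsumC := hsum (commonPairs E A) coreC (fun _ => le_rfl) hC5
  have hsumB := hsum (fun l => (commonPairs E A l).image Prod.swap) coreB
    (fun _ => Finset.card_image_le) hB5
  obtain ⟨χ, hχ⟩ : ∃ χ, 100 * loss χ ≤ E.card * D ^ 2 := by
    by_contra hno
    push Not at hno
    have hNE : Nonempty (V → Fin R) := ⟨fun _ => ⟨0, hR⟩⟩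
    have h1 : ∑ χ : V → Fin R, E.card * D ^ 2 < ∑ χ, 100 * loss χ :=
      Finset.sum_lt_sum_of_nonempty Finset.univ_nonempty fun χ _ => hno χ
    rw [Finset.sum_const, Finset.card_univ, smul_eq_mul, ← Finset.mul_sum, ← hN] at h1
    have h2 : 400 * R * ∑ χ, loss χ ≤ 2 * (N * (400 * R * C * n ^ 3 + R * (E.card * D ^ 2))) := by
      simp only [hloss, Finset.sum_add_distrib, mul_add (400 * R), two_mul]
      exact add_le_add hsumC hsumB
    have h3 : N * (R * (400 * C * n ^ 3)) ≤ N * (R * (E.card * D ^ 2)) :=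
      Nat.mul_le_mul_left _ (Nat.mul_le_mul_left _ hdense)
    have h4 : R * (N * (E.card * D ^ 2)) < R * (100 * ∑ χ, loss χ) := Nat.mul_lt_mul_of_pos_left h1 hR
    have e1 : 2 * (N * (400 * R * C * n ^ 3 + R * (E.card * D ^ 2))) =
        2 * (N * (R * (400 * C * n ^ 3))) + 2 * (N * (R * (E.card * D ^ 2))) := by ring
    have e2 : R * (N * (E.card * D ^ 2)) = N * (R * (E.card * D ^ 2)) := by ring
    have e3 : 400 * R * ∑ χ, loss χ = 4 * (R * (100 * ∑ χ, loss χ)) := by ring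
    omega
  obtain ⟨Y, h1, h2, h3, h4, h5, h6⟩ := h.exists_linkSystem_of_core ht χ (fun l => coreC l χ)
    (fun l => coreB l χ) (fun l => keyC l χ) (fun l => keyB l χ) (fun l => hC1 l χ)
    (fun l => hB1 l χ) (fun l => hC2 l χ) (fun l => hC3 l χ) (fun l => hB3 l χ)
    (fun l p hp => by convert hC4 l χ p hp) (fun l p hp => by convert hB4 l χ p hp)
  refine ⟨χ, Y, h1, h2, h3, h4, le_trans (Nat.mul_le_mul_left _ (add_le_add h5 h6)) ?_⟩
  rw [Fintype.card_coe]
  exact hχ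

end construction

/-! ### Choice of the parameters. -/

section density

open scoped Classical

theorem exists_pow_le_lt_succ_pow (k D : ℕ) (hk : k ≠ 0) : ∃ m, m ^ k ≤ D ∧ D < (m + 1) ^ k := by
  have hex : ∃ m, D < (m + 1) ^ k := ⟨D, (Nat.lt_succ_self D).trans_le (Nat.le_self_pow hk _)⟩
  refine ⟨Nat.find hex, ?_, Nat.find_spec hex⟩
  rcases Nat.eq_zero_or_pos (Nat.find hex) with h | h
  · rw [h, zero_pow hk]; exact Nat.zero_le _
  · have := Nat.find_min hex (m := Nat.find hex - 1) (by omega)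
    rw [Nat.sub_add_cancel h] at this
    exact not_lt.1 this

/-- A sufficiently dense pair system yields a torus. -/
theorem exists_density_containsTorus : ∃ K : ℕ, ∀ {V : Type*} [Fintype V] {H : Finset (Finset V)}
    {g : V → Fin 3} {E : Finset (V × V)} {A : V × V → Finset V} {D : ℕ},
    IsPairSystem H g E A D → E.Nonempty → K * Fintype.card V ^ 3 ≤ E.card * D ^ 2 →
    ContainsTorus H := by
  -- With m about D^(1/9), so that m⁹ ≤ D leaves room for 2^17 m⁸ < D, one has |E| ≤ n² ≤ D⁴ ≤
  -- (2m)^36. The decay factor is c / m at each scale, so 37 scales beat |E| by a further factor m.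
  obtain ⟨r, hr⟩ : ∃ r, r = 36 + 1 := ⟨_, rfl⟩
  obtain ⟨R, hR⟩ : ∃ R, R = 16 * (8 * 4 ^ r) := ⟨_, rfl⟩
  have hRpos : 0 < R := hR ▸ by positivity
  obtain ⟨c, hc⟩ : ∃ c : ℝ, c = 2 * (8 * 4 ^ r) ^ 2 * 2 := ⟨_, rfl⟩
  have hcpos : 0 < c := hc ▸ by positivity
  obtain ⟨ε, hε⟩ : ∃ ε : ℝ, ε = (1 / 4) ^ 2 ^ (2 * r + 1) := ⟨_, rfl⟩
  have hεpos : 0 < ε := hε ▸ by positivity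
  obtain ⟨M, hM⟩ := exists_nat_gt ((2 * c) ^ 36 * c / ε)
  obtain ⟨C, hC⟩ : ∃ C, C = 400 * (R * (R * R + R) + 96 * (R * (400 * R + 1) ^ R)) := ⟨_, rfl⟩
  obtain ⟨M₀, hM₀⟩ : ∃ M₀, M₀ = M + R + 2 ^ 17 + 1 := ⟨_, rfl⟩
  -- The summand C is the density required by `IsPairSystem.exists_linkSystem` with t = 96. Since
  -- |E| ≤ n², the summand M₀^18 forces D ≥ M₀⁹ and hence m ≥ M₀, which makes all other requirements
  -- hold.
  refine ⟨C + M₀ ^ 18, fun {V} _ {H g E A D} h hE hdense => ?_⟩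
  set n := Fintype.card V with hn
  obtain ⟨e₀, he₀⟩ := hE
  have hnpos : 0 < n := Fintype.card_pos_iff.2 ⟨e₀.1⟩
  have hEcard : E.card ≤ n ^ 2 := by
    refine (Finset.card_le_univ E).trans (le_of_eq ?_)
    rw [Fintype.card_prod, pow_two]
  have hDn : (C + M₀ ^ 18) * n ≤ D ^ 2 := by
    have h1 : n ^ 2 * ((C + M₀ ^ 18) * n) ≤ n ^ 2 * D ^ 2 := by
      calc n ^ 2 * ((C + M₀ ^ 18) * n) = (C + M₀ ^ 18) * n ^ 3 := by ring
        _ ≤ E.card * D ^ 2 := hdense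
        _ ≤ n ^ 2 * D ^ 2 := Nat.mul_le_mul_right _ hEcard
    exact Nat.le_of_mul_le_mul_left h1 (by positivity)
  have hM18 : 1 ≤ M₀ ^ 18 := Nat.one_le_pow _ _ (by omega)
  have hDn' : n ≤ D ^ 2 := le_trans (Nat.le_mul_of_pos_left n (by omega)) hDn
  have hDM : M₀ ^ 9 ≤ D := by
    have h1 : (M₀ ^ 9) ^ 2 ≤ D ^ 2 := by
      calc (M₀ ^ 9) ^ 2 = M₀ ^ 18 := by rw [← pow_mul]
        _ ≤ C + M₀ ^ 18 := Nat.le_add_left _ _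
        _ ≤ (C + M₀ ^ 18) * n := Nat.le_mul_of_pos_right _ hnpos
        _ ≤ D ^ 2 := hDn
    exact (Nat.pow_le_pow_iff_left (by norm_num)).1 h1
  obtain ⟨m, hm1, hm2⟩ := exists_pow_le_lt_succ_pow 9 D (by norm_num)
  have hMm : M₀ ≤ m := by
    have := (Nat.pow_lt_pow_iff_left (by norm_num)).1 (hDM.trans_lt hm2)
    omega
  have hmpos : 0 < m := by omega
  have hmpos' : (0 : ℝ) < m := by exact_mod_cast hmpos
  have hmD : m ≤ D := (Nat.le_self_pow (by norm_num) m).trans hm1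
  have hcount : (E.card : ℝ) * (2 * (8 * 4 ^ r) ^ 2 * (2 / m : ℝ)) ^ r <
      (1 / 4) ^ 2 ^ (2 * r + 1) := by
    have h1 : (E.card : ℝ) ≤ (2 * m) ^ 36 := by
      have h2 : E.card ≤ (2 * m) ^ 36 := by
        calc E.card ≤ n ^ 2 := hEcard
          _ ≤ (D ^ 2) ^ 2 := Nat.pow_le_pow_left hDn' 2
          _ = D ^ 4 := by rw [← pow_mul]
          _ ≤ ((m + 1) ^ 9) ^ 4 := Nat.pow_le_pow_left hm2.le 4
          _ = (m + 1) ^ 36 := by rw [← pow_mul]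
          _ ≤ (2 * m) ^ 36 := Nat.pow_le_pow_left (by omega) 36
      exact_mod_cast h2
    have h2 : (2 * (8 * 4 ^ r) ^ 2 * (2 / m : ℝ)) = c / m := by rw [hc]; ring
    have h3 : (c / m : ℝ) ^ r = (c / m) ^ 36 * (c / m) := by
      obtain ⟨x, hx⟩ : ∃ x, x = c / (m : ℝ) := ⟨_, rfl⟩
      rw [← hx, hr, pow_succ]
    rw [← hε, h2, h3]
    calc (E.card : ℝ) * ((c / m) ^ 36 * (c / m)) ≤ (2 * m) ^ 36 * ((c / m) ^ 36 * (c / m)) :=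
          mul_le_mul_of_nonneg_right h1 (by positivity)
      _ = ((2 * m) * (c / m)) ^ 36 * (c / m) := by
          rw [mul_pow (2 * (m : ℝ)) (c / m), mul_assoc]
      _ = (2 * c) ^ 36 * c / m := by
          rw [show (2 * m : ℝ) * (c / m) = 2 * c by field_simp, mul_div_assoc]
      _ < ε := by
          rw [div_lt_iff₀ hmpos']
          rw [div_lt_iff₀ hεpos] at hM
          have h4 : (M : ℝ) ≤ m := by exact_mod_cast (show M ≤ m by omega)
          calc (2 * c) ^ 36 * c < M * ε := hM
            _ ≤ m * ε := mul_le_mul_of_nonneg_right h4 hεpos.le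
            _ = ε * m := mul_comm _ _
  obtain ⟨χ, Y, hf, hs, hA, hrob, hloss⟩ := h.exists_linkSystem (R := R) (t := 96) (by norm_num)
    hRpos (by
      rw [← hC]
      exact (Nat.mul_le_mul_right _ (Nat.le_add_right _ _)).trans hdense)
  have hne : ∀ {x y : V} {i j : Fin 3}, g x = i → g y = j → i ≠ j → x ≠ y := by
    rintro x y i j rfl rfl hij rfl; exact hij rfl
  have : Nonempty E := ⟨⟨e₀, he₀⟩⟩
  refine Y.containsTorus hrob ?_ ?_ ?_ le_rfl hloss hmpos hR.ge (by omega) ?_ ?_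
  · intro e e'
    rw [hf, hs]
    exact hne (h.part_fst _ e.2) (h.part_snd _ e'.2) (by decide)
  · intro e e' hmem
    rw [hf, hA] at hmem
    exact hne (h.part_fst _ e.2) (h.part_apex _ e'.2 _ hmem) (by decide) rfl
  · intro e e' hmem
    rw [hs, hA] at hmem
    exact hne (h.part_snd _ e.2) (h.part_apex _ e'.2 _ hmem) (by decide) rfl
  · calc 2 ^ 17 * m ^ 8 < m * m ^ 8 := Nat.mul_lt_mul_of_pos_right (by omega) (by positivity)
      _ = m ^ 9 := by ring
      _ ≤ D := hm1
  · rw [Fintype.card_coe]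
    exact hcount

end density

/-! ### Reduction to tripartite hypergraphs and summation over thresholds. -/

section tripartition

open scoped Classical

variable {V : Type*} [Fintype V]

/-- Recolour x, y, z as prescribed and remember their old colours: this is injective, and there are
27 possible memories. -/
theorem card_coloring_le {x y z : V} (hxy : x ≠ y) (hxz : x ≠ z) (hyz : y ≠ z) :
    Fintype.card (V → Fin 3) ≤
      27 * (Finset.univ.filter fun g : V → Fin 3 => g x = 0 ∧ g y = 1 ∧ g z = 2).card := by
  set F := Finset.univ.filter fun g : V → Fin 3 => g x = 0 ∧ g y = 1 ∧ g z = 2 with hF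
  have h := Finset.card_le_card_of_injOn (s := Finset.univ)
    (t := F ×ˢ (Finset.univ : Finset (Fin 3 × Fin 3 × Fin 3)))
    (fun g : V → Fin 3 => (Function.update (Function.update (Function.update g x 0) y 1) z 2,
      g x, g y, g z)) (by
      intro g _
      simp [hF, hxy, hxz, hyz]) (by
      intro g _ g' _ hgg
      simp only [Prod.mk.injEq] at hgg
      obtain ⟨h, hx, hy, hz⟩ := hgg
      funext v
      by_cases hvz : v = z
      · rw [hvz, hz]
      by_cases hvy : v = y
      · rw [hvy, hy]
      by_cases hvx : v = x
      · rw [hvx, hx]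
      have := congrFun h v
      simpa [hvx, hvy, hvz] using this)
  rw [Finset.card_univ, Finset.card_product, Finset.card_univ] at h
  simpa [mul_comm] using h

/-- The vertices of part 0 that form an edge with the pair `e`. -/
noncomputable def apexSet (H : Finset (Finset V)) (g : V → Fin 3) (e : V × V) : Finset V :=
  Finset.univ.filter fun a => g a = 0 ∧ ({a, e.1, e.2} : Finset V) ∈ H

/-- The pairs between parts 1 and 2. -/
noncomputable def crossPairs (g : V → Fin 3) : Finset (V × V) :=
  Finset.univ.filter fun e => g e.1 = 1 ∧ g e.2 = 2

theorem exists_tripartition [Nonempty V] {H : Finset (Finset V)} (hH : IsThreeUniform H) :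
    ∃ g : V → Fin 3, H.card ≤ 27 * ∑ e ∈ crossPairs g, (apexSet H g e).card := by
  have hch : ∀ h ∈ H, ∃ p : V × V × V, p.1 ≠ p.2.1 ∧ p.1 ≠ p.2.2 ∧ p.2.1 ≠ p.2.2 ∧
      h = {p.1, p.2.1, p.2.2} := by
    intro h hh
    obtain ⟨x, y, z, h1, h2, h3, h4⟩ := Finset.card_eq_three.1 (hH h hh)
    exact ⟨(x, y, z), h1, h2, h3, h4⟩
  choose! p hxy hxz hyz hp using hch
  set Q : (V → Fin 3) → Finset V → Prop := fun g h =>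
    g (p h).1 = 0 ∧ g (p h).2.1 = 1 ∧ g (p h).2.2 = 2 with hQ
  have hle : ∀ g, (H.filter (Q g)).card ≤ ∑ e ∈ crossPairs g, (apexSet H g e).card := by
    intro g
    rw [← Finset.card_sigma]
    refine Finset.card_le_card_of_injOn (fun h => ⟨((p h).2.1, (p h).2.2), (p h).1⟩) ?_ ?_
    · intro h hh
      obtain ⟨h1, h2, h3, h4⟩ := Finset.mem_filter.1 (Finset.mem_coe.1 hh)
      simp only [Finset.coe_sigma, Set.mem_sigma_iff, Finset.mem_coe, crossPairs, apexSet,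
        Finset.mem_filter, Finset.mem_univ, true_and]
      exact ⟨⟨h3, h4⟩, h2, hp h h1 ▸ h1⟩
    · intro h hh h' hh' heq
      have m1 := (Finset.mem_filter.1 (Finset.mem_coe.1 hh)).1
      have m2 := (Finset.mem_filter.1 (Finset.mem_coe.1 hh')).1
      simp only [Sigma.mk.injEq, Prod.mk.injEq, heq_eq_eq] at heq
      rw [hp h m1, hp h' m2, heq.1.1, heq.1.2, heq.2]
  by_contra hno
  push Not at hno
  have h1 : ∑ g : V → Fin 3, 27 * (H.filter (Q g)).card < ∑ g : V → Fin 3, H.card :=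
    Finset.sum_lt_sum_of_nonempty Finset.univ_nonempty fun g _ =>
      (Nat.mul_le_mul_left 27 (hle g)).trans_lt (hno g)
  have h2 : ∑ g : V → Fin 3, (H.filter (Q g)).card =
      ∑ h ∈ H, (Finset.univ.filter fun g => Q g h).card := by
    simp only [Finset.card_filter]
    exact Finset.sum_comm
  have h3 : ∑ h ∈ H, Fintype.card (V → Fin 3) ≤
      ∑ h ∈ H, 27 * (Finset.univ.filter fun g => Q g h).card :=
    Finset.sum_le_sum fun h hh => card_coloring_le (hxy h hh) (hxz h hh) (hyz h hh)
  rw [← Finset.mul_sum, h2, Finset.mul_sum] at h1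
  have h4 := h3.trans_lt h1
  rw [Finset.sum_const, Finset.sum_const, Finset.card_univ, smul_eq_mul, smul_eq_mul, mul_comm] at h4
  exact lt_irrefl _ h4

theorem exists_isPairSystem (H : Finset (Finset V)) (g : V → Fin 3) (D : ℕ) :
    ∃ A, IsPairSystem H g ((crossPairs g).filter fun e => D ≤ (apexSet H g e).card) A D := by
  have hch : ∀ e : V × V, ∃ A : Finset V, D ≤ (apexSet H g e).card →
      A ⊆ apexSet H g e ∧ A.card = D := by
    intro e
    by_cases h : D ≤ (apexSet H g e).card
    · obtain ⟨A, hA⟩ := Finset.exists_subset_card_eq h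
      exact ⟨A, fun _ => hA⟩
    · exact ⟨∅, fun h' => absurd h' h⟩
  choose A hA using hch
  have hA' := fun e (he : e ∈ (crossPairs g).filter fun e => D ≤ (apexSet H g e).card) =>
    hA e (Finset.mem_filter.1 he).2
  have hP := fun e (he : e ∈ (crossPairs g).filter fun e => D ≤ (apexSet H g e).card) =>
    (Finset.mem_filter.1 (Finset.mem_filter.1 he).1).2
  exact ⟨A, fun e he => (hA' e he).2,
    fun e he a ha => (Finset.mem_filter.1 ((hA' e he).1 ha)).2.2,
    fun e he a ha => (Finset.mem_filter.1 ((hA' e he).1 ha)).2.1,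
    fun e he => (hP e he).1, fun e he => (hP e he).2⟩

/-- The sum of f is the sum of the sizes of its level sets. Up to s ≈ √n each is bounded by |P| ≤
n²; beyond s the bound K n³ / D² adds up to at most K n³ / s. Both contributions have order n^(5/2).
-/
theorem sum_card_le_of_level_sets {ι : Type*} (P : Finset ι) (f : ι → ℕ) {n K : ℕ} (hn : 0 < n)
    (hf : ∀ e ∈ P, f e ≤ n) (hP : P.card ≤ n ^ 2)
    (hlevel : ∀ D, 0 < D → (P.filter fun e => D ≤ f e).card * D ^ 2 ≤ K * n ^ 3) :
    (∑ e ∈ P, f e : ℕ) ≤ (K + 2 : ℝ) * (n : ℝ) ^ (5 / 2 : ℝ) := by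
  have hn' : (1 : ℝ) ≤ n := by exact_mod_cast hn
  set s := Nat.sqrt n + 1 with hs
  have hs1 : (s : ℝ) ≤ 2 * √n := by
    have h1 : (Nat.sqrt n : ℝ) ≤ √n := Real.nat_sqrt_le_real_sqrt
    have h2 : 1 ≤ √(n : ℝ) := Real.one_le_sqrt.2 hn'
    rw [hs]; push_cast; linarith
  have hs2 : √(n : ℝ) ≤ s := by
    rw [hs]; push_cast
    exact Real.real_sqrt_le_nat_sqrt_succ
  have hsqpos : 0 < √(n : ℝ) := Real.sqrt_pos.2 (by linarith)
  have hpow : (n : ℝ) ^ (5 / 2 : ℝ) = n ^ 2 * √n := by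
    rw [Real.sqrt_eq_rpow, ← Real.rpow_natCast, ← Real.rpow_add (by linarith)]
    norm_num
  have hsum : ∑ e ∈ P, f e = ∑ D ∈ Finset.Ioc 0 n, (P.filter fun e => D ≤ f e).card := by
    simp only [Finset.card_filter]
    rw [Finset.sum_comm]
    refine Finset.sum_congr rfl fun e he => ?_
    rw [← Finset.card_filter]
    have : (Finset.Ioc 0 n).filter (fun D => D ≤ f e) = Finset.Ioc 0 (f e) := by
      ext D
      simp only [Finset.mem_filter, Finset.mem_Ioc]
      have := hf e he
      omega
    rw [this, Nat.card_Ioc, Nat.sub_zero]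
  have hsub : Finset.Ioc 0 n ⊆ Finset.Ioc 0 s ∪ Finset.Ioc s (max s n) := by
    intro D hD
    simp only [Finset.mem_union, Finset.mem_Ioc] at hD ⊢
    omega
  have hb : ∀ D ∈ Finset.Ioc s (max s n), ((P.filter fun e => D ≤ f e).card : ℝ) ≤
      K * n ^ 3 * ((D : ℝ) ^ 2)⁻¹ := by
    intro D hD
    have hD0 : 0 < D := lt_of_le_of_lt (Nat.zero_le _) (Finset.mem_Ioc.1 hD).1
    have hD0' : (0 : ℝ) < D := by exact_mod_cast hD0
    rw [← div_eq_mul_inv, le_div_iff₀ (by positivity)]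
    exact_mod_cast hlevel D hD0
  have hs0 : s ≠ 0 := by omega
  rw [hsum]
  push_cast
  calc ∑ D ∈ Finset.Ioc 0 n, ((P.filter fun e => D ≤ f e).card : ℝ)
      ≤ ∑ D ∈ Finset.Ioc 0 s ∪ Finset.Ioc s (max s n), ((P.filter fun e => D ≤ f e).card : ℝ) :=
        Finset.sum_le_sum_of_subset_of_nonneg hsub fun _ _ _ => Nat.cast_nonneg _
    _ ≤ ∑ D ∈ Finset.Ioc 0 s, ((P.filter fun e => D ≤ f e).card : ℝ) +
        ∑ D ∈ Finset.Ioc s (max s n), ((P.filter fun e => D ≤ f e).card : ℝ) := by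
        rw [← Finset.sum_union_inter]
        exact le_add_of_nonneg_right (Finset.sum_nonneg fun _ _ => Nat.cast_nonneg _)
    _ ≤ ∑ D ∈ Finset.Ioc 0 s, (n : ℝ) ^ 2 +
        ∑ D ∈ Finset.Ioc s (max s n), (K : ℝ) * n ^ 3 * ((D : ℝ) ^ 2)⁻¹ := by
        refine add_le_add (Finset.sum_le_sum fun D _ => ?_) (Finset.sum_le_sum hb)
        exact_mod_cast (Finset.card_le_card (Finset.filter_subset _ _)).trans hP
    _ ≤ s * (n : ℝ) ^ 2 + K * n ^ 3 * (s : ℝ)⁻¹ := by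
        rw [Finset.sum_const, Nat.card_Ioc, nsmul_eq_mul, Nat.sub_zero, ← Finset.mul_sum]
        refine add_le_add le_rfl (mul_le_mul_of_nonneg_left ?_ (by positivity))
        refine (sum_Ioc_inv_sq_le_sub hs0 (le_max_left s n)).trans ?_
        exact sub_le_self _ (by positivity)
    _ ≤ (2 * √n) * (n : ℝ) ^ 2 + K * n ^ 3 * (√n)⁻¹ := by
        gcongr
    _ = (K + 2) * (n : ℝ) ^ (5 / 2 : ℝ) := by
        rw [hpow]
        have h1 : (n : ℝ) ^ 3 * (√n)⁻¹ = n ^ 2 * √n := by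
          rw [← div_eq_mul_inv, div_eq_iff hsqpos.ne', mul_assoc, Real.mul_self_sqrt (by linarith)]
          ring
        rw [mul_assoc (K : ℝ), h1]
        ring

end tripartition

/-! ### The theorem. -/

theorem theorem1 :
    ∃ c : ℝ, 0 < c ∧ ∀ (V : Type*) [Fintype V] (H : Finset (Finset V)),
      IsThreeUniform H → ¬ ContainsTorus H →
        (H.card : ℝ) ≤ c * (Fintype.card V : ℝ) ^ (5 / 2 : ℝ) := by
  classical
  obtain ⟨K, hK⟩ := exists_density_containsTorus
  refine ⟨27 * (K + 2), by positivity, fun V _ H hH hno => ?_⟩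
  rcases isEmpty_or_nonempty V with hV | hV
  · have h0 : H = ∅ := Finset.eq_empty_of_forall_notMem fun e he => by
      have := hH e he
      rw [Finset.eq_empty_of_isEmpty e] at this
      simp at this
    rw [h0, Finset.card_empty, Nat.cast_zero]
    positivity
  obtain ⟨g, hg⟩ := exists_tripartition hH
  have hcast : (H.card : ℝ) ≤ 27 * (∑ e ∈ crossPairs g, (apexSet H g e).card : ℕ) := by
    exact_mod_cast hg
  refine hcast.trans ?_
  rw [mul_assoc]
  refine mul_le_mul_of_nonneg_left ?_ (by norm_num)
  refine sum_card_le_of_level_sets (crossPairs g) _ Fintype.card_pos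
    (fun e _ => Finset.card_le_univ _) ?_ fun D hD => ?_
  · refine (Finset.card_le_univ _).trans (le_of_eq ?_)
    rw [Fintype.card_prod, pow_two]
  -- A level set that is too large is a nonempty dense pair system, after cutting each apex set down
  -- to exactly D elements, and so yields a torus.
  · by_contra hlt
    obtain ⟨A, hA⟩ := exists_isPairSystem H g D
    refine hno (hK hA ?_ ?_)
    · rw [← Finset.card_pos]
      by_contra h0
      rw [Nat.eq_zero_of_not_pos h0, zero_mul] at hlt
      exact hlt (Nat.zero_le _)
    · exact (not_le.1 hlt).le
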